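/- Work over $\mathbb{C}$. Let $\varepsilon$ be a primitive 7th root of unity, let $x_{i,j}$ ($i<j$) be the Plücker coordinates on $\mathrm{Gr}(2,n)\subset\mathbb{P}(\bigwedge^2\mathbb{C}^n)$ for the standard basis $v_1,\dots,v_n$, and let the dihedral group $D_7$ of order 14 act as follows. * For $n=7$: $\tau_7$ scales $x_{i,j}$ by $\varepsilon^{i+j-2}$, and $\sigma_7$ exchanges $x_{i,j}\leftrightarrow x_{9-j,9-i}$ for $2\le i<j$ and $x_{1,j}\leftrightarrow x_{1,9-j}$. * For $n=6$: $\tau_6$ scales $v_i$ by $\varepsilon^{i}$ and $x_{i,j}$ by $\varepsilon^{i+j}$, and $\sigma_6$ exchanges $v_i\leftrightarrow v_{7-i}$ and $x_{i,j}\leftrightarrow x_{7-j,7-i}$. For $c=(c_{1,2},c_{2,6},c_{3,5},c_{3,6},c_{4,5},c_{4,6})\in\mathbb{C}^6$ let $\Sigma_c\subset\bigwedge^2(\mathbb{C}^7)^*$ be spanned by $$x_{1,7}-c_{2,6}x_{2,6}-c_{3,5}x_{3,5},\quad x_{1,6}-c_{3,6}x_{2,5}-c_{4,5}x_{3,4},\quad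 x_{1,5}-c_{4,6}x_{2,4}-c_{1,2}x_{6,7},$$ $$x_{1,4}-c_{1,2}x_{2,3}-c_{4,6}x_{5,7},\quad x_{1,3}-c_{3,6}x_{4,7}-c_{4,5}x_{5,6},\quad x_{1,2}-c_{2,6}x_{3,7}-c_{3,5}x_{4,6},$$ and for linearly independent $h_1,h_2\in\mathbb{C}^3$ let $\Sigma_{c,h}$ be spanned by $\Sigma_c$ and the two forms $h_{r,1}x_{2,7}+h_{r,2}x_{3,6}+h_{r,3}x_{4,5}$, $r=1,2$. Let $Z_c\subset\mathrm{Gr}(2,7)$ and $S_{c,h}\subset\mathrm{Gr}(2,7)$ be the linear sections (zero schemes) of codimension 6 and 8 defined by $\Sigma_c$ and $\Sigma_{c,h}$. Let $\lambda_c:\bigwedge^2\mathbb{C}^6\to\mathbb{C}^6$ be $$\begin{aligned}\lambda_c={}&v_1\otimes(c_{2,6}x_{2,6}+c_{3,5}x_{3,5})+v_2\otimes(c_{3,6}x_{3,6}+c_{4,5}x_{4,5})+v_3\otimes(c_{1,2}x_{1,2}+c_{4,6}x_{4,6})\\&+v_4\otimes(c_{4,6}x_{1,3}+c_{1,2}x_{5,6})+v_5\otimes(c_{3,6}x_{1,4}+c_{4,5}x_{2,3})+v_6\otimes(c_{2,6}x_{1,5}+c_{3,5}x_{2,4}),\end{aligned}$$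 and let $Y_{\lambda_c}=\{P\in\mathrm{Gr}(2,6):\lambda_c(\textstyle\bigwedge^2P)\subseteq P\}$ be the zero scheme of the corresponding section of $\mathcal{Q}(1)$. (1) These are the maximal $D_7$-invariant families. The $\Sigma_c$ are exactly the $D_7$-stable subspaces $\Sigma\subset\bigwedge^2(\mathbb{C}^7)^*$ in which each non-trivial character of $\langle\tau_7\rangle$ occurs exactly once and the trivial one does not occur, and on which none of the $x_{1,j}$-coefficients ($2\le j\le7$) vanishes identically. The $\Sigma_{c,h}$ are exactly those for which the same holds with the trivial character occurring exactly twice. The $\lambda_c$ are exactly the linear maps $\bigwedge^2\mathbb{C}^6\to\mathbb{C}^6$ that commute with $\tau_6$ and $\sigma_6$. (2) The general surface $S_Z$ is smooth: there is a non-zero polynomial $G$ in the entries of $(c,h)$ such that, if $h_1,h_2$ are linearly independent and $G(c,h)\ne0$, then $S_{c,h}$ is non-empty and smooth of pure dimension 2. (3) The general fourfolds $Z$ and $Y_\lambda$ are smooth: there is a non-zero polynomial $F$ in $c$ such that, if $F(c)\ne0$, then both $Z_c$ and $Y_{\lambda_c}$ are non-empty and smooth of pure dimension 4. -/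

import Mathlib

noncomputable section

namespace DihedralSections

open AlgebraicGeometry

/-! ### Grassmannians of planes in their Plücker embedding

The basis vectors `v_1, …, v_n` of `ℂ^n` are indexed from zero: `i : Fin n` stands for `v_{i+1}`.
A function on `Pair n` is the coordinate vector of a bivector with respect to `v_i ∧ v_j`, `i < j`,
or of a two-form with respect to the dual basis. -/

/-- Index set of the Plücker coordinates `x_{i,j}`, `i < j`. -/
abbrev Pair (n : ℕ) : Type := {q : Fin n × Fin n // q.1 < q.2}

/-- The pair `(i, j)` with `i < j`. -/
def pair {n : ℕ} (i j : Fin n) (h : i < j := by decide) : Pair n := ⟨(i, j), h⟩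

/-- The two-form `x_{i,j} = v_i^* ∧ v_j^*`, `i < j`. -/
def x {n : ℕ} (i j : Fin n) (h : i < j := by decide) : Pair n → ℂ := Pi.single (pair i j h) 1

/-- The Plücker coordinate ring of `ℙ(⋀² ℂ^n)`. -/
abbrev PluckerRing (n : ℕ) : Type := MvPolynomial (Pair n) ℂ

/-- The `(i, j)` entry of the generic skew-symmetric matrix: `x_{i,j}` for `i < j`,
`- x_{j,i}` for `j < i`, and `0` for `i = j`. -/
def skewEntry {n : ℕ} (i j : Fin n) : PluckerRing n :=
  if h : i < j then MvPolynomial.X ⟨(i, j), h⟩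
  else if h : j < i then - MvPolynomial.X ⟨(j, i), h⟩
  else 0

/-- The homogeneous ideal of `Gr(2, n)`: it is generated by the `4 × 4` Pfaffians of the generic
skew-symmetric matrix. -/
def pluckerIdeal (n : ℕ) : Ideal (PluckerRing n) :=
  Ideal.span {f | ∃ i j k l : Fin n, f = skewEntry i j * skewEntry k l
    - skewEntry i k * skewEntry j l + skewEntry i l * skewEntry j k}

/-- A two-form, as a linear form in the Plücker coordinates. -/
def linearForm {n : ℕ} (ω : Pair n → ℂ) : PluckerRing n :=
  ∑ q, MvPolynomial.C (ω q) * MvPolynomial.X q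

/-- The homogeneous ideal of the linear section of `Gr(2, n)` by a linear system `S ⊆ ⋀² (ℂ^n)^*`,
the zero scheme of the corresponding section of `𝒪(1)^{⊕ dim S}`. -/
def linearSectionIdeal {n : ℕ} (S : Submodule ℂ (Pair n → ℂ)) : Ideal (PluckerRing n) :=
  pluckerIdeal n ⊔ Ideal.span {f | ∃ ω ∈ S, f = linearForm ω}

/-- The homogeneous ideal of `Y_λ = {P ∈ Gr(2, n) | λ(⋀² P) ⊆ P}`, where the matrix `lam` is that of
`λ : ⋀² ℂ^n → ℂ^n`. It is the zero scheme of the section of `𝒬(1)` defined by `λ`: a vector `u`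
lies in the plane with Plücker vector `p` iff `u ∧ p = 0`, and the added generators are the
coordinates of `λ(p) ∧ p`. -/
def quotientSectionIdeal {n : ℕ} (lam : Matrix (Fin n) (Pair n) ℂ) : Ideal (PluckerRing n) :=
  pluckerIdeal n ⊔ Ideal.span {f | ∃ i j k : Fin n,
    f = linearForm (lam i) * skewEntry j k - linearForm (lam j) * skewEntry i k
      + linearForm (lam k) * skewEntry i j}

/-! ### Smooth projective schemes -/

/-- For a homogeneous ideal `I`, the closed subscheme `V(I)` of projective space is non-empty and
smooth over `ℂ` of pure dimension `d`. Smoothness is local and is required on the standard affine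
charts `V(I) ∩ {X_i ≠ 0} = Spec (ℂ[X] / (I, X_i - 1))`. -/
def IsSmoothProjective {ι : Type} (d : ℕ) (I : Ideal (MvPolynomial ι ℂ)) : Prop :=
  (∃ z : ι → ℂ, z ≠ 0 ∧ ∀ f ∈ I, MvPolynomial.eval z f = 0) ∧
  ∀ i : ι, SmoothOfRelativeDimension d (Spec.map (CommRingCat.ofHom
    (algebraMap ℂ (MvPolynomial ι ℂ ⧸ (I ⊔ Ideal.span {MvPolynomial.X i - 1})))))

/-! ### The two actions of the dihedral group of order 14 -/

/-- The diagonal operator on bivectors or two-forms with `v_i ∧ v_j ↦ ε^{w_i + w_j} v_i ∧ v_j`. -/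
def tau {n : ℕ} (ε : ℂ) (w : Fin n → ℕ) : Module.End ℂ (Pair n → ℂ) where
  toFun p := fun q => ε ^ (w q.1.1 + w q.1.2) * p q
  map_add' p p' := by ext q; simp [mul_add]
  map_smul' a p := by ext q; simp [mul_left_comm]

/-- The effect of a permutation of the basis vectors on the index set of the Plücker
coordinates. -/
def pairMap {n : ℕ} (e : Equiv.Perm (Fin n)) (q : Pair n) : Pair n :=
  ⟨(min (e q.1.1) (e q.1.2), max (e q.1.1) (e q.1.2)),
    min_lt_max.2 fun h => q.2.ne (e.injective h)⟩

/-- The operator on bivectors or two-forms that permutes the Plücker coordinates. -/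
def sigma {n : ℕ} (e : Equiv.Perm (Fin n)) : Module.End ℂ (Pair n → ℂ) where
  toFun p := fun q => p (pairMap e q)
  map_add' _ _ := rfl
  map_smul' _ _ := rfl

/-- `τ_7 = 1/7 (0, 1, 2, 3, 4, 5, 6)` on `⋀²`. -/
def tau7 (ε : ℂ) : Module.End ℂ (Pair 7 → ℂ) := tau ε fun i => (i : ℕ)

/-- `σ_7` on `⋀²`: `x_{i,j} ↔ x_{9-j,9-i}` for `2 ≤ i < j`, and `x_{1,j} ↔ x_{1,9-j}`. -/
def sigma7 : Module.End ℂ (Pair 7 → ℂ) := sigma (Equiv.neg (Fin 7))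

/-- `τ_6 = 1/7 (1, 2, 3, 4, 5, 6)` on `⋀²`. -/
def tau6 (ε : ℂ) : Module.End ℂ (Pair 6 → ℂ) := tau ε fun i => (i : ℕ) + 1

/-- `σ_6` on `⋀²`: `x_{i,j} ↔ x_{7-j,7-i}`. -/
def sigma6 : Module.End ℂ (Pair 6 → ℂ) := sigma Fin.revPerm

/-- The linear systems of two-forms on `ℂ^7` that are stable under the dihedral group, in which each
non-trivial character of `τ_7` occurs once and the trivial character `m` times. -/
def IsInvariantSystem (ε : ℂ) (m : ℕ) (S : Submodule ℂ (Pair 7 → ℂ)) : Prop :=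
  (∀ ω ∈ S, tau7 ε ω ∈ S ∧ sigma7 ω ∈ S) ∧
  (∀ k : ℕ, 0 < k → k < 7 →
    Module.finrank ℂ ↥(S ⊓ Module.End.eigenspace (tau7 ε) (ε ^ k)) = 1) ∧
  Module.finrank ℂ ↥(S ⊓ Module.End.eigenspace (tau7 ε) 1) = m

/-- No coordinate `x_{1,j}` vanishes identically on the system. -/
def HasLeadingTerms (S : Submodule ℂ (Pair 7 → ℂ)) : Prop :=
  ∀ q : Pair 7, q.1.1 = 0 → ∃ ω ∈ S, ω q ≠ 0

/-- The maps `λ : ⋀² ℂ^6 → ℂ^6` that commute with the actions of `τ_6` and `σ_6`. -/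
def IsInvariantMap (ε : ℂ) (lam : Matrix (Fin 6) (Pair 6) ℂ) : Prop :=
  ∀ p : Pair 6 → ℂ,
    (lam.mulVec (tau6 ε p) = fun i : Fin 6 => ε ^ ((i : ℕ) + 1) * lam.mulVec p i) ∧
    (lam.mulVec (sigma6 p) = fun i : Fin 6 => lam.mulVec p i.rev)

/-! ### The explicit families -/

/-- The parameters `c_{1,2}, c_{2,6}, c_{3,5}, c_{3,6}, c_{4,5}, c_{4,6}`. -/
inductive Coeff
  | c12 | c26 | c35 | c36 | c45 | c46

open Coeff

/-- The six forms that cut out the fourfold `Z` in `Gr(2, 7)`. -/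
def formsZ (c : Coeff → ℂ) : Fin 6 → (Pair 7 → ℂ) :=
  ![x 0 6 - c c26 • x 1 5 - c c35 • x 2 4,
    x 0 5 - c c36 • x 1 4 - c c45 • x 2 3,
    x 0 4 - c c46 • x 1 3 - c c12 • x 5 6,
    x 0 3 - c c12 • x 1 2 - c c46 • x 4 6,
    x 0 2 - c c36 • x 3 6 - c c45 • x 4 5,
    x 0 1 - c c26 • x 2 6 - c c35 • x 3 5]

/-- The linear system that defines `Z`. -/
def systemZ (c : Coeff → ℂ) : Submodule ℂ (Pair 7 → ℂ) := Submodule.span ℂ (Set.range (formsZ c))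

/-- The two further forms, in the coordinates `x_{2,7}`, `x_{3,6}`, `x_{4,5}`. -/
def formsH (h : Fin 2 → Fin 3 → ℂ) (r : Fin 2) : Pair 7 → ℂ :=
  h r 0 • x 1 6 + h r 1 • x 2 5 + h r 2 • x 3 4

/-- The linear system that defines the surface `S_Z`. -/
def systemS (c : Coeff → ℂ) (h : Fin 2 → Fin 3 → ℂ) : Submodule ℂ (Pair 7 → ℂ) :=
  systemZ c ⊔ Submodule.span ℂ (Set.range (formsH h))

/-- The map `λ : ⋀² ℂ^6 → ℂ^6` that defines the fourfold `Y_λ`; row `i` is its `v_{i+1}`-component. -/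
def mapY (c : Coeff → ℂ) : Matrix (Fin 6) (Pair 6) ℂ :=
  Matrix.of ![c c26 • x 1 5 + c c35 • x 2 4,
    c c36 • x 2 5 + c c45 • x 3 4,
    c c12 • x 0 1 + c c46 • x 3 5,
    c c46 • x 0 2 + c c12 • x 4 5,
    c c36 • x 0 3 + c c45 • x 1 2,
    c c26 • x 0 4 + c c35 • x 1 3]

end DihedralSections

end

open DihedralSections

noncomputable section
namespace DihedralSections
open Coeff

/-! ### Bilinear equations with symbolic coefficients -/

/-- A signed monomial in the parameters; `true` stands for the sign `-1`. -/
abbrev Coef (κ : Type) := Bool × List κ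
def Coef.neg {κ : Type} (q : Coef κ) : Coef κ := (!q.1, q.2)
def Coef.mul {κ : Type} (q r : Coef κ) : Coef κ := (xor q.1 r.1, q.2 ++ r.2)
def Coef.map {κ κ' : Type} (f : κ → κ') (q : Coef κ) : Coef κ' := (q.1, q.2.map f)

/-- Linear forms in variables indexed by natural numbers. -/
abbrev Lin (κ : Type) := List (Coef κ × ℕ)

/-- Bilinear forms in two sets of variables, or two-forms, indexed by pairs of natural numbers. -/
abbrev Bil (κ : Type) := List (Coef κ × ℕ × ℕ)

/-- The entries of a skew-symmetric matrix with upper triangle `X`. -/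
def skewLin {κ : Type} (X : ℕ → ℕ → Lin κ) (p q : ℕ) : Lin κ :=
  bif Nat.blt p q then X p q
  else bif Nat.blt q p then (X q p).map fun u => (u.1.neg, u.2) else []

/-- The entry `(k, j)` of the product of the matrix of the two-form `φ` with the skew-symmetric
matrix with upper triangle `X`. -/
def contract {κ : Type} (X : ℕ → ℕ → Lin κ) (φ : Bil κ) (k j : ℕ) : Lin κ :=
  φ.flatMap fun u =>
    bif Nat.beq u.2.1 k then (skewLin X u.2.2 j).map fun z => (u.1.mul z.1, z.2)
    else bif Nat.beq u.2.2 k then (skewLin X u.2.1 j).map fun z => ((u.1.mul z.1).neg, z.2) else []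

/-- The combination of linear forms with further unknown coefficients. -/
def combine {κ : Type} (l : List (Lin κ)) : Bil κ :=
  l.zipIdx.flatMap fun φ => φ.1.map fun z => (z.1, φ.2, z.2)

/-- All entries of all products of a combination of the two-forms `Φ` with the matrix `X`. -/
def contractions {κ : Type} (n : ℕ) (X : ℕ → ℕ → Lin κ) (Φ : List (Bil κ)) : List (Bil κ) :=
  (List.range n).flatMap fun k => (List.range n).map fun j => combine (Φ.map (contract X · k j))

/-- The forms `formsZ`. -/
def dataZ : List (Bil Coeff) :=
  [[((false, []), 0, 6), ((true, [c26]), 1, 5), ((true, [c35]), 2, 4)],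
   [((false, []), 0, 5), ((true, [c36]), 1, 4), ((true, [c45]), 2, 3)],
   [((false, []), 0, 4), ((true, [c46]), 1, 3), ((true, [c12]), 5, 6)],
   [((false, []), 0, 3), ((true, [c12]), 1, 2), ((true, [c46]), 4, 6)],
   [((false, []), 0, 2), ((true, [c36]), 3, 6), ((true, [c45]), 4, 5)],
   [((false, []), 0, 1), ((true, [c26]), 2, 6), ((true, [c35]), 3, 5)]]

/-- A numbering of the pairs `0 < p < q`. -/
def index (p q : ℕ) : ℕ := (q - 1) * (q - 2) / 2 + (p - 1)

/-- The generic skew-symmetric matrix on which the forms `dataZ` vanish. -/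
def upperZ (p q : ℕ) : Lin Coeff :=
  match p with
  | 0 => (dataZ.getD (6 - q) []).tail.map fun u => (u.1.neg, index u.2.1 u.2.2)
  | p + 1 => [((false, []), index (p + 1) q)]

/-- The equations of a singular combination of the six forms at a point of the fourfold. -/
def equationsZ : List (Bil Coeff) := contractions 7 upperZ dataZ

/-- The parameters of the surfaces. -/
abbrev CoeffS := Coeff ⊕ Fin 2 × Fin 3

/-- The forms `formsZ` and `formsH`. -/
def dataS : List (Bil CoeffS) :=
  (dataZ.map fun φ => φ.map fun u => (u.1.map Sum.inl, u.2)) ++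
  [[((false, [Sum.inr (0, 0)]), 1, 6), ((false, [Sum.inr (0, 1)]), 2, 5),
      ((false, [Sum.inr (0, 2)]), 3, 4)],
   [((false, [Sum.inr (1, 0)]), 1, 6), ((false, [Sum.inr (1, 1)]), 2, 5),
      ((false, [Sum.inr (1, 2)]), 3, 4)]]

/-- The variable with index `5` times a `2 × 2` minor. -/
def minorLin (i j : Fin 3) : Lin CoeffS :=
  [((false, [Sum.inr (0, i), Sum.inr (1, j)]), 5), ((true, [Sum.inr (0, j), Sum.inr (1, i)]), 5)]

/-- The generic skew-symmetric matrix on which the forms `dataS` vanish. -/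
def upperS (p q : ℕ) : Lin CoeffS :=
  match p, q with
  | 1, 6 => minorLin 1 2
  | 2, 5 => minorLin 2 0
  | 3, 4 => minorLin 0 1
  | p, q => (upperZ p q).map fun u => (u.1.map Sum.inl, u.2)

/-- The equations of a singular combination of the eight forms at a point of the surface. -/
def equationsS : List (Bil CoeffS) := contractions 7 upperS dataS

/-- The rows of `mapY`. -/
def dataY : List (Bil Coeff) :=
  [[((false, [c26]), 1, 5), ((false, [c35]), 2, 4)],
   [((false, [c36]), 2, 5), ((false, [c45]), 3, 4)],
   [((false, [c12]), 0, 1), ((false, [c46]), 3, 5)],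
   [((false, [c46]), 0, 2), ((false, [c12]), 4, 5)],
   [((false, [c36]), 0, 3), ((false, [c45]), 1, 2)],
   [((false, [c26]), 0, 4), ((false, [c35]), 1, 3)]]

/-- The generic skew-symmetric matrix of size `6`. -/
def upperY (p q : ℕ) : Lin Coeff := [((false, []), index (p + 1) (q + 1))]

/-- The value of a two-form on the generic matrix of size `6`. -/
def linearY (φ : Bil Coeff) : Lin Coeff := φ.map fun u => (u.1, index (u.2.1 + 1) (u.2.2 + 1))

/-- The equations of a covector on which the differential of the section `mapY` vanishes at a point. -/
def equationsY : List (Bil Coeff) :=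
  ((List.range 6).map fun j => combine ((List.range 6).map (skewLin upperY · j))) ++
  (List.range 6).flatMap fun k => (List.range 6).map fun j =>
    combine (dataY.zipIdx.map fun φ =>
      contract upperY φ.1 k j ++ bif Nat.beq φ.2 k then linearY (dataY.getD j []) else [])

/-! ### Gaussian elimination over the field with 31 elements

A row is a natural number with digits at most `30` in base `1024`. The seven lowest digits carry no
information; they only make the rows differ in their lowest bits. -/

/-- The number with `n` digits `1` in base `1024`. -/
def ones (n : ℕ) : ℕ := Nat.div (Nat.sub (Nat.pow 1024 n) 1) 1023

/-- Reduction of all digits modulo `31`, for `o` and `m` with all digits `1` and `31`. -/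
def red (o m x : ℕ) : ℕ :=
  Nat.land (Nat.add x (Nat.land (Nat.shiftRight
    (Nat.add (Nat.add x (Nat.land (Nat.shiftRight x 5) m)) o) 5) m)) m

/-- The reduction of `x + f v`. -/
def axpy (o m x f v : ℕ) : ℕ := red o m (Nat.add x (Nat.mul f v))

/-- A binary tree of rows; a node holds a mask for the digits of its left branch, a leaf the position
of its pivot. -/
inductive Store
  | nil
  | leaf (p v : ℕ)
  | node (m : ℕ) (l r : Store)

namespace Store

/-- A row that may be used to remove the first digit of `x`. -/
def find (x : ℕ) : Store → Option (ℕ × ℕ)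
  | nil => none
  | leaf p v => match Nat.land (Nat.shiftRight x p) 31 with
    | 0 => none
    | Nat.succ f => some (Nat.succ f, v)
  | node m l r => match Nat.land x m with
    | 0 => r.find x
    | Nat.succ _ => l.find x

/-- Insertion of `v` at the index `i` of an empty tree of depth `d`. -/
def insertNil (v : ℕ) : ℕ → ℕ → ℕ → (Store → Bool) → Bool
  | 0, _, p, k => k (leaf p v)
  | Nat.succ d, i, p, k =>
    match Nat.shiftLeft (Nat.sub (Nat.pow 2 (Nat.mul 10 (Nat.pow 2 d))) 1) p with
    | 0 => false
    | Nat.succ m => bif Nat.testBit i d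
      then insertNil v d i (Nat.add p (Nat.mul 10 (Nat.pow 2 d))) fun r => k (node (Nat.succ m) nil r)
      else insertNil v d i p fun l => k (node (Nat.succ m) l nil)

/-- Insertion of `v` at the index `i` of a tree of depth `d`. -/
def insert (v : ℕ) : Store → ℕ → ℕ → ℕ → (Store → Bool) → Bool
  | nil, d, i, p, k => insertNil v d i p k
  | leaf _ _, _, _, _, _ => false
  | node m l r, d, i, p, k =>
    bif Nat.testBit i (Nat.pred d)
    then r.insert v (Nat.pred d) i (Nat.add p (Nat.mul 10 (Nat.pow 2 (Nat.pred d))))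
      fun r => k (node m l r)
    else l.insert v (Nat.pred d) i p fun l => k (node m l r)

end Store

/-- Removal of the digits at the pivots of `S`, in at most `n` steps. -/
def reduce (o m : ℕ) (S : Store) (n : ℕ) : ℕ → ℕ :=
  Nat.rec (fun x => x) (fun _ ih x => match S.find x with
    | none => x
    | some (f, v) => match axpy o m x f v with
      | 0 => 0
      | Nat.succ y => ih (Nat.succ y)) n

/-- The value of a coefficient modulo `31`. -/
def coefVal {κ : Type} (e : κ → ℕ) (q : Coef κ) : ℕ :=
  Nat.mod (q.2.foldr (fun p n => Nat.mul (e p) n) (bif q.1 then 30 else 1)) 31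

/-- An elimination problem: the monomials of degree `deg` in variables of weights `wtT` times
variables of weights `wtX`, in total weight `w` modulo `7`. Each entry of `rows` packs ten triples of
the key of a pivot, the code of a monomial and the number of an equation; `P` is the modulus of a hash
function for the keys. -/
structure Block where
  deg : ℕ
  wtT : List ℕ
  wtX : List (ℕ × ℕ)
  w : ℕ
  size : ℕ
  P : ℕ
  rows : List ℕ

/-- The triples packed in a list of numbers. -/
def unpack (l : List ℕ) : List ℕ := l.flatMap fun v => (List.range 10).map fun i =>
  Nat.land (Nat.shiftRight v (Nat.mul 58 i)) 288230376151711743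
def keyOf (u : ℕ) : ℕ := Nat.land u 268435455
def codeOf (u : ℕ) : ℕ := Nat.land (Nat.shiftRight u 28) 16777215
def genOf (u : ℕ) : ℕ := Nat.shiftRight u 52

/-- The hash table for the positions of keys. -/
def hashTable (P : ℕ) : List ℕ → ℕ → ℕ → ℕ
  | [], _, T => T
  | u :: l, n, T => match Nat.lor T (Nat.shiftLeft n (Nat.mul 10 (Nat.mod (keyOf u) P))) with
    | 0 => hashTable P l (Nat.succ n) 0
    | Nat.succ T => hashTable P l (Nat.succ n) (Nat.succ T)
def keyTable : List ℕ → ℕ → ℕ → ℕ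
  | [], _, D => D
  | u :: l, n, D => match Nat.lor D (Nat.shiftLeft (keyOf u) (Nat.mul 28 n)) with
    | 0 => keyTable l (Nat.succ n) 0
    | Nat.succ T => keyTable l (Nat.succ n) (Nat.succ T)
def keyAt (D p : ℕ) : ℕ := Nat.land (Nat.shiftRight D (Nat.mul 28 p)) 268435455

/-- The position of a key, if it is present. -/
def locate (n P T D key : ℕ) : Option ℕ :=
  match Nat.land (Nat.shiftRight T (Nat.mul 10 (Nat.mod key P))) 1023 with
  | p => bif Nat.blt p n then bif Nat.beq (keyAt D p) key then some p else none else none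

/-- Monomials are coded by their exponents as digits in base `8`. -/
def digitAt (E s : ℕ) : ℕ := Nat.mod (Nat.div E (Nat.pow 8 s)) 8

/-- The key of the product of `t s`, of the monomial with code `E`, and of the variable `x q`. -/
def keyMul (E s q : ℕ) : ℕ := Nat.add (Nat.mul (Nat.add E (Nat.pow 8 s)) 16) q

/-- The row of the product of an equation and the monomial with code `E`. -/
def numRow {κ : Type} (e : κ → ℕ) (o m : ℕ) (loc : ℕ → Option ℕ) (E : ℕ) : Bil κ → ℕ → Option ℕ
  | [], x => some x
  | u :: g, x => bif Nat.blt (digitAt E u.2.1) 7 && (Nat.blt u.2.1 8 && Nat.blt u.2.2 16) then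
      match loc (keyMul E u.2.1 u.2.2) with
      | none => none
      | some p => match axpy o m x (coefVal e u.1) (Nat.shiftLeft 1 (Nat.mul 10 (Nat.add p 7))) with
        | 0 => numRow e o m loc E g 0
        | Nat.succ x => numRow e o m loc E g (Nat.succ x)
    else none

def startRow (u : ℕ) : ℕ :=
  red (ones 7) (Nat.mul 31 (ones 7))
    (Nat.land (Nat.mul u 1000003000050070003) (Nat.mul 31 (ones 7)))

/-- The first non-zero digit of `v` is `-1`, in position `i`. -/
def isPivot (i v : ℕ) : Bool :=
  Nat.beq (Nat.mod (Nat.shiftRight v 70) (Nat.pow 1024 (Nat.succ i))) (Nat.mul 30 (Nat.pow 1024 i))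

/-- The rows are reduced one after the other, and the `i`-th has its pivot in position `i`. -/
def eliminate {κ : Type} (e : κ → ℕ) (gens : List (Bil κ)) (o m : ℕ) (loc : ℕ → Option ℕ) :
    List ℕ → ℕ → Store → Bool
  | [], _, _ => true
  | u :: l, i, S => match numRow e o m loc (codeOf u) (gens.getD (genOf u) []) (startRow u) with
    | none => false
    | some x => match reduce o m S 1000 x with
      | y => match Nat.land (Nat.shiftRight y (Nat.mul 10 (Nat.add i 7))) 1023 with
        | c => match axpy o m 0 (Nat.mod (Nat.mul 30 (Nat.pow c 29)) 31) y with
          | 0 => false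
          | Nat.succ v => bif isPivot i (Nat.succ v)
            then S.insert (Nat.succ v) 10 i 70 fun S => eliminate e gens o m loc l (Nat.succ i) S
            else false

namespace Block

/-- All monomials of the right weight with at most two variables of the first kind are present. -/
def covers (B : Block) (loc : ℕ → Option ℕ) : Bool :=
  (List.range B.wtT.length).all fun a => (List.range B.wtT.length).all fun b =>
    (List.range (B.deg + 1)).all fun i => B.wtX.all fun q =>
      bif Nat.beq (Nat.mod (Nat.add (Nat.add (Nat.mul i (B.wtT.getD a 0))
        (Nat.mul (Nat.sub B.deg i) (B.wtT.getD b 0))) q.2) 7) B.w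
      then (loc (Nat.add (Nat.mul (Nat.add (Nat.mul i (Nat.pow 8 a))
        (Nat.mul (Nat.sub B.deg i) (Nat.pow 8 b))) 16) q.1)).isSome else true

def items (B : Block) : List ℕ := (unpack B.rows).take B.size

/-- The elimination succeeds and shows that all monomials of the block vanish. -/
def check {κ : Type} (B : Block) (e : κ → ℕ) (gens : List (Bil κ)) : Bool :=
  match ones (Nat.add B.size 7) with
  | 0 => false
  | Nat.succ o => match Nat.mul 31 (Nat.succ o) with
    | 0 => false
    | Nat.succ m => match hashTable B.P B.items 0 0 with
      | 0 => false
      | Nat.succ T => match keyTable B.items 0 0 with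
        | 0 => false
        | Nat.succ D => Nat.beq B.items.length B.size &&
          (B.covers (locate B.size B.P (Nat.succ T) (Nat.succ D)) &&
            eliminate e gens (Nat.succ o) (Nat.succ m)
              (locate B.size B.P (Nat.succ T) (Nat.succ D)) B.items 0 .nil)

end Block

/-- A parameter modulo `31` at which the elimination for the fourfolds succeeds. -/
def pointZ : Coeff → ℕ | .c46 => 2 | _ => 1
/-- A parameter modulo `31` at which the elimination for the surfaces succeeds. -/
def pointS : CoeffS → ℕ
  | .inl .c46 => 2
  | .inl _ => 1
  | .inr (0, 0) => 1
  | .inr (0, 1) => 30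
  | .inr (1, 1) => 1
  | .inr (1, 2) => 30
  | .inr _ => 0

def blockZ1 : Block where
  deg := 5
  wtT := [1, 2, 3, 4, 5, 6]
  wtX := [(0, 3), (1, 4), (2, 5), (3, 5), (4, 6), (5, 0), (6, 6), (7, 0), (8, 1), (9, 2), (10, 0), (11, 1), (12, 2), (13, 3), (14, 4)]
  w := 1
  size := 540
  P := 3728
  rows := [
    0x28000048000069440000040002045b80800000a0001120040000050001740000100000141b000100000140a5800c0200100228300010000014054404000804000d6c0001000001407,
    0x5000001000001746019000021000a5000900000980286010010018010a0400006400006a85001600002600730021800022001c90002030002047100218000220014a0180080180105,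
    0x8001120001141c9000480000481708000048000069c90100020100037140800000a0001a60200000210005100090000098015100b00000b00150c0600040601055a004000005000e,
    0x1c00200000280246000800008800a5800024000424294001018001218a0400804000804681010002010003a1400890000c901cc010080010280708000b00000b21c20180080180107,
    0xc0200600201614300044100048150c004204004305440004090006095280080240080454400120200140250c0080080081094300000b00004b5200000800000a0d00000200000282,
    0x24060100060105c50000c10010c1708001804001825c5000402001402714004108008109c200004300004b70c02810002820143010240010280528010000010021440102080104085,
    0x400500400500a81002041002042a0400012800012e81000203000204a14024200028201c2004000004008708041000041021c2001088001090708004840004861c20080500080587,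
    0x2802400802402954003040003240a1800820002820286008408010408a50000320000b2294000250000450a180001600201628100b00000b001a0400430000430681000608000609a,
    0x24020904020909c300320000324050c000a20000b214300041000045050c0041400042414400101800121851004400404480543008049008089510020044020845430082020082425,
    0x18020a00040a028600220800a208a1802412004412281018040018041a040012000012068100900900900aa5c064000084001c500844000944071402800402c005c20020090020117,
    0x8044100044121c5010201011201708020204020225c200820900821170c0250000251014400a00800a20850c0440200441215f000800000a00c34000304000407250000c8000108b,
    0xac00010c0001122800002000002164c00c800010800d300010000110022002030002040046001440009440a0404480004480681008088008089a040208400208468200a20000a2087,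
    0x640000640000852b00060100080134c00800800c008df00800300800422000020800030841001248001249a0402090402090a82001241001249708024008024029d3018001020001e,
    0x4c020060040063a0018200018400d3400c02000c0434d000218000418b4004800004c0024801200001a0008200608000808021f00208000308087c00c004010006190006080006104,
    0x640601000801025300041000061062000400c004011900010030010044ac041000041800d90010c000110036400080c00100c4300120900124954806002008002359000480000680e,
    0xac00004800004ed300000b00000c97c0400400400604800064000084007c00016000026000000020008020b2c06000408000450018200020200b34005800006002e5003040003080b,
    0x20024040044042d90112000192009940009400009626500860001060024000020800022885003008004001b780003040004065d001018002018668000b00001300a8012000013000c,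
    0x6800010c000112dc00320000340067800c02000c040280080c0008100e3400100800100f98008401008601d7c0401040402074d010048010088c34000240000343100080c00100c0b,
    0x40004a00008a025901000201800293800c02000c024480000510000911ac0240080280086b0180080200080200008280010280c002400001800858008900010101870080030080043,
    0x4c00110400110a530094000096006200400240400299000005100005247c00084400084898000640000840d2c00002c0000330d001011001012e7c000908000a0b5800901000a010c,
    0x64020840040842530002880004886340211000411011300a04000b040320008120008140df00220800221012000880400900425008042008043010000320000342590080880100889,
    0x380008600008836d0000c8000108830001024002004aa0180400180802a406010008010313011008019008e6400500400900765008011008019c6000400c00800f3001200001a000b,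
    0xc00081200082238d00024900024ae3400410800412b68018200019200c940040600040826b008081008082834024200044201ab0010880010c864c004204008204c80014080016080,
    0x380040440040486500104900104a02c00c80000d0011f0082800082c0d3404080404082763000043008043d940048080088090000204800205023c000160000183ad008011008012d,
    0x640049200249226b00a20000a40039404400406400488008248008448068004840008843a1018040019040d6800802400802ae10080880080c8280024040028042480012800012c01,
    0x8000502000902270008401008402464020904024907530082020082039400400240400292b0080500100500200210040218040d002240002241e340248200248278d00a00100a041c,
    0x6080006082093010240010440694000a04000a082600300800b0086580280040300002e00300800c000d8000400c00402cc00010030020039a0000144000247a3008050010050d,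
    0xa000400c00480f580182000184000c0004a00004b039f001440001640cb0000a20000c01070014400016409a8020840020940a9008210010210c1c020a000212024b0004410006414,
    0x5c0002240003240f008408008608c54044004064004d50002810002c187802420004420130001408001409620024104024124cb00940000960042c004204008204ae0010420030022,
    0xb404020004030215001018001020ca00210040410060e00224000224118802014000018061000608000808e540048080088098701004101004232c044020064020510004800006801,
    0xac000b00000c019d000250000290b680202040203058b0002880004884b400406000806118012000012040e000480000481004e000249000449b38024820024824500006400086408,
    0x9002080804080870008248008448d2c02012402012a55008011010011394040820060820d10010c00020c00180008440008678e009080009088d6802880002c8038900b000012200d,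
    0x9800404400802a0e000090001058b80000144000164d2009002011002d3c000844000848dc008202008203c3800030400030b9200004300800b1b000002c02002f970002110004119,
    0x9800890001080080008401010401b4000812000c12324018001018002c1c0210200218224f0082800082c008400080c00102b58001408001410328020140020082160090800020c0d,
    0x24040024060d000901000901829c000224000228c0000051000059240021004021024de00a00100a00906800422000432120002048003048960008120008220630006010006028,
    0x5c00c00400c80644003040004040470001104001905970100410180803b400480800480c1e0010110022093780008600008801c001081001082c6c020124020320e8009010009050e,
    0x240240240440265b001050000098da800120002120318001280001288200004a00005200120002c00004c0380004a000052035d0110010114001b40009400010620c0080110080199,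
    0x400050200090230000140800141023804012006012104000250000258c880202040203052c00120900120a95c024804060805a40102400112403240208400208611d0002810002c1b,
    0x5002010800410c630090020090038740200440200481b010240008640b38021100001920a400a04000b04026c0281000243026200a20000b20016c00482400582356009208003208b,
    0x6800004800004e2300121000320883c00090800090cc50000900000c9d600001440041466a0006080008081bc0248040250067000020a000602bbc0401040401088a0004480006483,
    0x18040104060121a600920800b008478040804021009ab00124100144132c00414000416221011200011400e30028020029000a300108800908801c00820002430314011001011009c,
    0x440050040058078000020a00020b6c000880400580461008241008281278000924000a26550102080182014140040440040642e001011001019d3c040104040204280090410090811,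
    0xa40049200051205400801101001124000082800082d0b01024001824015c000160020241a1001248001448e48020140024140550002500002908700409000449009300804900804ac,
    0x1c0008440010472b00820900820a82802880004880019002041003041dbc0008440008645e002240002440bb800890000910228010009018009b6802400802410918008248008288e,
    0x10000a0400090c9600800a01800981c00402800402c9d009240002280c7800410800410fa600024900120ac6c02080804080ba600009000005262802020402020ad60002490004498,
    0xa4020904021107ad00040900024a15800410800c104240080490100491700201240401279500104900204969000482400c027a200820900820ab840208400408240e0010420000834,
    0x300041240041470b00120900220921c040040044042260010420010829b4000a0400110b0a0012410012428380280040480051a0110400190400b800030400020daa0082410084411,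
    0x400241040280275d001049001089bb002006002024116008440018240e180248040250071f00840800840929c000844004846cf00920100a2018ac0048400050251400924000a2404,
    0xc0024104024207ad011001012001614000924000a270900124800224806000880400c80724000410001211894028020048020dc01100801200827404082004092212008081010241c,
    0xb80248200448219d008042009042654020108044106d1001248000251d3c040040024045a0008248010248b1c000908004a05aa00124800128836002410402810640009041009003b,
    0x1c000224008125230012410012506680049040089236900900900920238802400802800b9500040901100203c005100028901ac00105000a048840020920020a20400082480112084,
    0x6c060004028806db00028800a048b44008104020925260000c1008051b00000208024124ac001081008051890001104020a04ef00024200924105c000908044106140010490010898,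
    0x480410000210438001000900144123c00c004024a021e000090008410124004300020940cb000100009408b4404480002502211000019009210d24000128024045160010110092022,
    0x880400490ace000402000251070008008020925870022080012814000203000049412a010002009280b240448000249231d00a008009210024020220040906600100090082186]

def blockY1 : Block where
  deg := 5
  wtT := [6, 5, 4, 3, 2, 1]
  wtX := [(0, 3), (1, 4), (2, 5), (3, 5), (4, 6), (5, 0), (6, 6), (7, 0), (8, 1), (9, 2), (10, 0), (11, 1), (12, 2), (13, 3), (14, 4)]
  w := 1
  size := 540
  P := 3728
  rows := [
    0x600800000a000017000800000a00a480040600040828a0000c100010174c00040000050242000800000a005380400080600096700000400000543c0000800000a065000800000a007,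
    0x1400800800800e8500000b00000ca1c060100080101c40000c80000d07100000100000158801200001300050c080000080101430000c100010152000400c00800d6000000400000c5,
    0x1c00182000202080000608000610018010000014000cd0040000050002580000800000a391020000028000d1400040000050318001600001800b0002c00004c002910000900000d0a,
    0x28001008001109c100100300200375c0001600002619100021800022060c00024000034148000020001020538000064020065420080030082035040019000021011e0000580000603,
    0x804002804280010002018002a1c00080c0008124801820002020081004020004030201012000013000704004a00008a01c7000480008480710000940000961c70100020180027,
    0xc0041080042094c0080180100183040203000204008201001001001829c0218000418004001804001808016402180002200301018200020200b4800900000902291003008003048a,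
    0x4c00002c000031d60006400008406000043000083018200828000848050c0242000243014301004801008852002404002804142003001003201508000844001045420002420004425,
    0xc00c0200100224700001900001a90800820000c2020100140800240870400812000c121c4010208010210704000080004081c1002201003201710001024001045c10000820010827,
    0x4400580000980318000402000602b0004480006480291002240002280a0002022004022280008210010210a1400c80000c8068c000100000101a1400104000104685001081001082a,
    0x80401040409054801000901100950c020028020129470010c00020c04000012000013005e00800300800413c00400c00401357008003008004e8000c10001010342019000021000c,
    0x280058000060020100901000a01071c020904040905c400028100028975806080006100182001440001640508008820009021420000580002585080248040250054300a00100a0415,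
    0x500018040020044d0002c000030008c00080c00081323018040020040a4800094000096280009009011009a140041400041468500120900120aa24040040060042650014400016407,
    0x80c00100cc70112000114002080210200210408f018200018208148021800025800220002c00004c0e2c0040600080635b000043000083d1800010c0001121a0180010200012,
    0x4021004025005c100904100a041704000144004145c400804200804a74c02080802080dc20000890002895080040280048294100020a00040a400000064000864c30010110010123,
    0x6800c8000108006700304000b040e4402420002430280001401009401a0000810402810685000288000289a0000012802012a89019000021000910021800021821c70080880100887,
    0x10020044020049970100410100814a0044020064020cf00204800208836002110004110022000601000801e4000c00400c00b940000120000138a4060020080021240000820000c23,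
    0x7800c004010006cf000051000059e8c00006400008745008202008402d6400480800500b17001440001640a0000492002492293008018008058960040804041006010082480092487,
    0x2c000320000422d500004a00004b93400010c000112d50100020100039180201400401419f000218000220454001820002020da0110080120081540043000044038b003040003080b,
    0x7c0408040408089f0000c10000c22180288000290005600020a000212e1400110400110a830022400022805080241200249214c00041000041888c02c0000300019b0104000184004,
    0x380208400408414c0180010200013880288000290038b00a008012008e5002020402030754002009002011c1800802400802ad001004101804197c0002400002610d00900200a0022,
    0x28024200024301ce011200019200500020904021104c800204800208822c0402000602038d000012000013b6000c02000c0419500b00000c000414040900044903970082800082c06,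
    0x7c00410800810b0d000448000450940000224000325a40090100090181180441000442001a00044100064109000400c00401005008018009018e100440040640078c00820200820a8,
    0x680281000481009f00800a00800b27c04012006012017008408008608a0c00100800500a5901100101200103000c800010803950080880080c8e28000240000422190010180020180,
    0x8c04000804000f1c009009009049e4c0048240049264c010240010248850000b00000c0355002041002081e4000090800090f8d00121000121892c000a04000a09060012100022103,
    0x640010240018265600220100240148c00120000122363008241008249d04040024060026c900840801040897c008900009102da00105000105881800112000192048002201002202d,
    0x3800430000440061001050002050e440408040608074b010208010408c6c0080240080464b008042008043418024008028008da00801800802082400402800402f890082800102809,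
    0x9000502000582195008210008410318004904004a0416010009010011e7c00c0200100232600300800b00803c00082800082f43001600002600920001900001a009c0014010016012,
    0x2c0009400009450900300100300216800482400502766001011009011d4c044020044042e0008600010600e2c0440040480075701900001a000b8c00012800012f29001088001089b,
    0x9800100800100ca600104200104334402110004110348000051008051874020300040302ce008088018048d50004840004863100014400094409180202040402058d00a2000122004,
    0x9c0440040640044f01000901800984c0281000282024f0080c000810036400c10001010022000448000648e4c000a2000120653003200003400064020044020146e40022010022020,
    0x780009080019076201800802000869c00480800480d0900008900008ae30004140004162e800028800029089000082800084869001241001281d800041240241245e0100410100421,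
    0x900210040608041b00a20000b20036804090006090096001408001410e480010240018434700900900900a93800012802002cd00082800082c048c004920004a205e008280009280b,
    0x6000890000c903230080880080c819400c00402c006570092010016013a402400802400eca003008003010438001200001a00d9008042008043630028100048100e00002500000602,
    0x40024804024824e500220800160841c00810400410c960020480020501900400240400280e00b00001a00082c0218000220024d0080500100504540000640040659c0000190000210,
    0x6c000b00000b061f00920800921045002880004880183010201018041c3402082402082ae1003200003400d3c0088040100061a0010810010c1c240082000043064d0010880010c80,
    0x6c02400802400e290006010006028a40441000442036000a008019008260024820024841a20080810080c10a400802400802a2400824801824039400022400032514008050008058c,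
    0x24008820008840a10094000114003a40288000289000b008011008012498021100021902d60012800012c03940040280041291c011200019200788024008044009940090020110024,
    0x7800402800402c5f00101100101948800802400c024cd00808100908132002030002020ae9008081010042e34008024028025a200108800109099c000940000945950082410082429,
    0x6402802002c0234900144000148047400880400c822e3011200011208d4c0010400011261f008440008640874021004041006d20012020012036a000c80002c800a50092010084020,
    0x940400400600431700300100b001c70004920004a239c0080880090884480041240043236000040900020b020004a00004b00890002420002c1b1000c10002c10056008248008250e,
    0x50004904005104620000430000830700209040211048e00900901000ad5c000908000a099c0020410020429880208240408250e00824101020231802082402080e92008011008019a,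
    0x2404010402020a24002048003048578024120024140e00002810010898240248040448072501004101104188c001820001062cf001408001410120005020025022160084010086016,
    0x9c028020044042270102080086085780082000282030c002002009042d8c008104024204a601020100860142c024900024a0215001401001242b9c02004400006b19010208018208e,
    0x500441000641019b011040019040480020044040044590002500002c8c98040120020082d7000211000290b28000924000b2244002400009600d78024804024808650090480090886,
    0x5c0088200289034c00804900104a6a4000048000164430092080112401740209200049436900820900840913000110400090c4d001241001441e8800490400490a260022400032409,
    0x280401200202265800a00100a201b74024104044106e5000211000609c8c02084002086352010208008218048024900021202a1000441000481c5402402402402b1e0014400014806,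
    0x5c0241200202401d001280010280ca0028100008204590000c8000091354004920005120e30014010014090a0004824004829c7001248001211b28040804020a078f008401008409e,
    0x6802012400014b4700140100121189c0041240040489400820900821193c004a00025103090008000002192180018040010298300024900024a268020808020a0469008050008090d,
    0xa0025000025022ce0014010024016440009240012201200304000304147400812000c82213001050001090c4c06000402410828008202008211c200210040408258400a0080112080,
    0x6c0000480002448a001011000052080004808008904a100120900901106c0042200002285b004000003041668000a20000928d4000448000450c30000a20001126d00090480110489,
    0x2c0010240409069f00040200844863c02092000494008008248008242c600200280401249100800a01004931800422004412304001049008019738004920024140980002490082501,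
    0xc02110002480b9100040200224139c024900020924250002420084484800408200288225900924000a208c540012000091021c00020300828832400084400892186000012008089c,
    0x5001000000c024a101024000a201818000b000049271f0016000014482740019000249050c0012090112019a00011040248249900028100220914c001104040922d30102400092416,
    0xc0008600081274700004a00a04882402000c020a20960000820022484200002080088279700100a002049048028020028122dd0000510010515580240400280251d0000200110097]

def blockS1 : Block where
  deg := 4
  wtT := [1, 2, 3, 4, 5, 6, 0, 0]
  wtX := [(0, 3), (1, 4), (2, 5), (3, 5), (4, 6), (5, 0), (6, 6), (8, 1), (9, 2), (11, 1), (12, 2), (13, 3), (14, 4)]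
  w := 1
  size := 613
  P := 8416
  rows := [
    0x4c00180000200185000003000004eb800000c000010570000c000010000580000180002184018000020000304300000304000110c000010000088580000200000229600000800000b,
    0x84a00001200002210c00002c000082c0018000020010c0180000200002180003000004034b050000090000d2c2040003040034a0880000c8000c25800001900002c90c0000100000b,
    0x1820002020004385080040080080908000060000081420400800400c040c8400008600004305000005800010822000024000009440000480000b24a00000b00002e14400006400008,
    0x10100040100062422000802000c040c204000208000820002020004022090200010400000100220000320000400400800800818003000004000c8000c00001000246400008400010e,
    0x51000801800803996000006002001b42008003008005f08000808001011000002800002f43000011000012c0c00010800010f06001010002010b15000101000202450002800002c09,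
    0x890200018200030d400040400080c2810020020020322000018200018c280000601000632b2000802000c060d004001008000934010004020003b8108000208000df0400020400032,
    0x8008100008201040020010030014080050000058008300200800300820c02020004020041440000441000004a00000a040000201000101800104c8400008600038a408000410000d,
    0x210000050000098f04000204000331890002090004386000401000601c1802800002c002c420001020001891400102000182205011000019000604040020040041812010082010106,
    0x34000a00000b0306010200010400c240210000410024901000801001045c8000090000092b00140000160035800000c80000cc90000810000c127c80000880000c9f4000084000101,
    0x10124000144000c4400200408200304000140000240c10000810000c1308920000940000270800080c0008430200800300803a1008400008600e289200009400034a010001018001d,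
    0x59000101800100eb000202000402324000140000240ab0020400030401741000409000405f001010001018118804800808802c52400402400809141080001088020520200020a0006,
    0x288002009002030d000408000608b6c800120800142df00a00000b0008300042000043022b0400800400c065d0000218000211724000844000840c904000908000932410002420003,
    0x80801000801803570004010006019802000042000090820040020060002010100010180013008080010080e6d0040018040034b401000441000d2c904000a0400359002200003200d,
    0x710040018040000520000920000ae1410002410002b86048040048080d148208008408018420900020a0004081008201010208100840000860010c024004044004410410080420080,
    0x41009001011005300200800300836800810000c1038b002008042008d889200011200030b00004200004395c1000089000092b2010012020011ac1040041080046e04000904000a1,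
    0x1802002402004786041200042200b0800012400012ac32000482000508141208001408018100020900021160c00180000190144240200248200310020804040804c22002082004082,
    0x4800900800a00c1048001048201108020900040900300000880000c8ec010100010180366008010008018d20200004200009a00080020080034b8200100300100c6000248000250e,
    0xbc2000203000219708000828000845880002480004405001201001202e1800410400420743040048040049c18820100824102c400120800121090c020820020842040802000812004,
    0x610000058000055e4000406000402310008011008038c240200280200e648040208080234a002040042040c8c2200003200025a08800028800095c1048001050025d0802000812006,
    0x241040201040411d24020044020017410010490010444200041200042d14020104040105820410010412012048200048208045400200100300163404400006400108208008210008b,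
    0x580010200010401d0010800010c0b6080410080810311010008018008c080240200241210e0800400c0040288220000a2000325000440000480b24120004140006532002012004016,
    0x300011000012022c0080800080c0524000824000845162400404400403ac100820101020c900100200104227c020024020028ad04900008900015c000920000a20170010410010810,
    0x1010010410010b4500104800124880402410002490061002200002400e2c0208201208235e208200208400b95000801000902db008208008210b74800104800206c92080012100019,
    0x5c80480080500256011000011040924100900100a00af2400082400092b88000248000286b0000180002183808041008042038a041001081001c2002000804000a080480080480103,
    0x7800412000422322201001401001c74020120020222db0012400014406bd000021100021ac20020120040146c1008041010051a0082400084403550008018200024f2012004012006,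
    0xa4804021004022da24800044800093482080084080121200240200440e28005000025003480010090010113840008240010278b200048240048d2c10012020012349201008209008c,
    0xa4120004140007080410400410801280209000409034c0080480080509841200049200061d04900004a00065c8201010201010c008201010201258200100200120160400090400110,
    0x401200201200408a009008011008d780201040202070c2000412000818301240001280012e008041010041430008004028004cc2090002110002b4900800a0080069208001210001c,
    0x8c10400420400662200208400208c2880400480400a2e00120100120219400002800002c2c05000005020047080012100012018001009002009c3c004104004108c2201001201002b,
    0x20000904000a0462040208240208cb08001208001271e048200048400b24800900900902ec00900100900298404002084002221208001408001868000124000225ab2002082004083,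
    0x30100104200107a6001048001050da804002006002257001010001018e8480402080802013050000058000e6004010006010230000241000281e8800080800080eca0002020002038,
    0x4c10080410100591009040011040c500048200088219b009001011001e68804005004006610410080410106ac0240200280205000920000a2009b4100104200104602080082080103,
    0x580201040202064f2080404080406480081000082018b000011040011dc002000804000af024000124000265c12010012020028041040041080e908001210001234a00004900004a8,
    0x840241000242008f00800900800a358004804005006df2012002022008a400400800800b5104024004028032000022000032065080200080208c9c0009200009405a00900800a008e,
    0x4810400410400a14200041400041ea0024800028803110002090004091c0040100060102cd200009200011d9c12010022010111200240200440178200100a00100910480010880018,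
    0x400009040011042c00124004124006c100120100142dc20020140020103c040800060801552000414000411a0804100804200540082010084015b40201200202221f2080402080800,
    0x70020200020a012820800820801021c000920000a23530082080084086500201200201431d200010400009264820005020006de24004044004024c1001201001421e0012010014018,
    0x9c80480100480116208200400400594124000144000ae20200020300058c8040049040066c008208008408400000904000909ad20900021100033c120100920101af0480400880406,
    0x5c020024040025670412000802089580041200041400d0080410080421940208040208081901000805000880c10080410080b1b2002012002029a0004024004029912010084010088,
    0x64000204000209600002410002424600009040011075b000011000019b881040041080079e01100001200051c8048008050032a200240400240894100104100206ea048001088001b,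
    0x4c004900008900de04200004300056c9040010240005000100900100a45812080012100225001208001210cb80200400200446a041008081008b4410402020402230048008050008b,
    0x2c1008042008075a2002084002089641009001011039920024020028022c02400402400b1c04020104020293802010402010b8800920000940009c8201008202035c008208208208d,
    0xbc0040400080421600801000801808800012400022523008240008440290100804200804280480080880085bc100008200024c00800010c000150c80080480080b1e000408000410d,
    0x2c8008050008075f000248000448c5880800102400394049000089000ebc0009200011224e2000092800086681008201008416a2010082010104b0100120a00100e52000412000420,
    0x6000084000086099048001248001b98800024900024ef201200241200680104100108102520000490000515000040240040449f001041002041bbc00410400400d4d0012010022015,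
    0x680050000090006d00120800140854c000044000066200010090012090602000042000249508020008820035402080402080b520082400082806bc82010084010152201001202001e,
    0x501001041002060704804024804040c004900004a01660482000882002ac04000402000d9040000144000156000022000016195049000049008c94020120040120c00000880000584,
    0xb8820800821002262082004082002b0100804104804c40080480100482640008240008295204008008104059c0041040081060700800904800944c800120804120d50400410400420,
    0x1c0041041041059020800840800854080410080810269040240080240b90004900004922cc00000a00001297c12010014010164008208010208130004820008821260080410082418,
    0xc002480010500312200208200210500104100028103670080090090098b00080200440201c001240009240e540201208201206e4000404010405a4000824000924aa0002090002493,
    0x8c005000044802d8009200209200501000005000024c9002200041240d1c0408001240225c00900100a00123800480410400ace001048041048290800804820009400092000112008,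
    0x8c1008209009021804104004104149010012010022162009008241008ba81009002009020e04820008040051c82010082410210080001280001574020804020906dc0400480400499,
    0x540048208048205820800800901050082002092002151208001049001d681040041040256c210000249000120804100904101660012010092016ac22000012480168400001240041e,
    0x508000408208202900005024004803400412080012666000408010208eac000124800221402010400490408a88200048200250f0004010402415900080209040221d001208201208e,
    0x8c000808900807470004010480412bc00100402480512248000249000e900202008209026d001080049040ba402410012090265001080048240c80000840008026400080020490010,
    0x101000024820e8000088208048e200401008209032a008400240400500000840900822632002080482080200008401048238f0002482002486a8a00000824022520014002412004,
    0xc000120009680030002090010740080048240076520001020800963810002490400710000088048048e3c0040400041244a0402080092082481008209208009b0006000412081,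
    0x9c028000804804e72400080010889941000408201048020040020104141c000300120104ce042000008049d389001001009219020040004104833800000c8009054f4000080480096,
    0x1c20002002082700048008001241c6c020200800921150020010014404401010001201205144000000a040080900004120807ad01800004024848c000060008900910022002010095,
    0x401009008041d000440208201e490200001008260e0002800090486900001088008260e400040201048270904000024200d904100800820991c0280000241054f0800082012400,
    0x2c84000000812148240001200209b5010004002012422200080040209b45800000020921660000032010416400401000049065e00028020804138400020480480487041200009009b,
    0x240001201240da83000000048274d008010001049e]

def blockS6 : Block where
  deg := 4
  wtT := [1, 2, 3, 4, 5, 6, 0, 0]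
  wtX := [(0, 3), (1, 4), (2, 5), (3, 5), (4, 6), (5, 0), (6, 6), (8, 1), (9, 2), (11, 1), (12, 2), (13, 3), (14, 4)]
  w := 6
  size := 613
  P := 8416
  rows := [
    0xb41000082000086e0800010c00013bc3000004000019f0c00000c000811830000030002383000003000004c19800001804002e70c000010000045d8000020000010f6000008000006,
    0x5d1000019000011728000048000045c300000b0000101000600000800164001800002003820180000200000280600000800034c0000c0000100874000300000402ef6000006400006,
    0x1080000880000f4520040020060081410100010180205003000004000508200800201000814010004020000042040002080000b00000300000493ca00001200001af2800002c00006,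
    0x40000440000658400a000012000310040800060800c30420000430002090008010010008200044000064020c0440000640004800001800002036000006000008085080001080002e,
    0x750000218000205b400040600040d7d800001800100170000810000c107480000880000c06010008010010e1500000500000b85010040010080910200020200042410020080020106,
    0x281000402000430d200400200600b241400001600024320200020300024c80800080c000ee0030000430003ad000801001000eb080200080400359000005800004df0010020010032,
    0x800002800002ec50000880000c8911000021000042430004080004108080042000043010400101000201040c0200400400404124100024200002c10800020800362200010400010c,
    0x1402000802000f86440000440040d18a00000a0010346000050000090d1800020400030744000401000402d1010000810000f46002200003200b18804020808022c2002001002002b,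
    0x2800002800002e1b0004080006086ac001100001900c10080800080c03840202000203008900004200008227410000810000c11050000058000c21020001040002c80400800400c01,
    0x810004010014101000042000082308900800901000810402010404011650040010080034b0800400c0040d8806000086000309210000218000918021000021803170084000086009,
    0xb802000802000c6c0800400c00400580002200002401e00021000021807400100400100805240001240002e0d00010100010703080040080041c0c80002480002b012100002100086,
    0x84840001040002214010006010008849040011040022108100028100082c001020001821090000110000194ac900800901000d60800012800013ac0042000082005d2400084400081,
    0x4140000140100f02000802000c0e78000220000323082000802000c012c80800090800362400200600200c340401000402030a200010240010c34101000101802d70022000024009,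
    0x7c1040201040406e40000140000213820000430000486040240040280d18104020108022c2200041200042b1410410010420244240008240010908020120020221020400410400814,
    0xc02010404010465001010001018c6c0440000640039a001080002080e2c1208002208034d048008048010d340008400008634a0020010020028300408000608009e2400014400012,
    0x9c00400800400cd2002001003001118024100028102c5009200009400804800120800141830002800002c050880004080014101040048040088308020804021004832400402480401,
    0x1400090400090b86048001048041d18800900804902c1200201200209610804800824800c4041200049200310020024040024c300104800204820c10002412002451002008003008d,
    0x281240002240030a001080041080c242040002240025d0412000422006b8000840100840dd08000828000817c8040208040406c4000404400400b0900100a00100170402400402800,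
    0xa820400030400206208001208041d1412002012012245201040209040608824000824101020490000490404c000500000580364008010008018b690008018008025b208200408200d,
    0x2c82080092080349401000409000c7c00880000c8022b04004104004284d00010100090193000280000480668004820005020de0080022080022bc120004120008972002402002800,
    0x300200240400248808800009000085002800002c00194201200202200680800820800840e104004804008821800082400102703208200208208814004024004826010090010092011,
    0x30004040004062490090010110019b000480400480a4c00a00000a0408680080040081059a20004120008165c04002084002117048001248001468000028000828de2080084080082,
    0x30900020a0002398040208040408010004104008105010082080082483080048200050208100124000144013082010092010399200201200401e841008041010078a209000211000d,
    0x4800002800402854400008600008e9080002500002424400040400048b71000101800004a2240200440200c2490400092400253080040080240658900005100004d60080022080023,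
    0x208040048040098a0004400004804c0040004040009210500000500402200001240002245e000241000281c2410080410082513040009041009384800120800220ad0412000812001,
    0x608040048080070c041200081200e840049000051038d009200009208d5c8200050200052100200800300803c0001400001606624000124000214080082080102022001080201080c,
    0x282008003008031c008010208010d58040100040902dd000248000288b84000044000144a60002410002421b40041040041081801000101800186c00000c00080da7008400008408e,
    0xc0104004104009a70402400802404280201200401234d001009001011db0020040020047280400800400c0e40220000240002cf2010084010086689008011008024a2000412000428,
    0x90004120008120d800824000828010c00480400480b1d208040208080b240208200408225604104024104034000080800080d100014000016000c0000124000227880090080110088,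
    0x9c00880000882057041008041010e681001041002058304820005020018c20080030080248248000250000bbc8009008011024c04804004808085c804020804043900410010410024,
    0x810200018200016f0410080420088b402800012800050002040003040c48900800a0080266000210000410b4c12080012100194010200010208c44024004044007112002014002018,
    0x740200240200282a200048240048ba4800805000806d1040201080201888020120020221890012400092409b4000920000a222f2010082410086780040240040440f0480010480023,
    0xb8120020220020db0012010014016881240009240031a00820101020106c8000250000275700020900040998080400480400913008041010041e880208040209052c0482000882000,
    0x7c10090010110262040041040042b9c800900800a035b001048001050b300041040042060b040009080009d7820000420002418041001042001c400240200280230e0480080880082,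
    0x6c100024100046e5048040048080bb480480080500154000248000250cc01008201010234a240200280200c880048200088238b001048041048d540010040011062c2000092400090,
    0x7480480100480055201200401200e4400490000890030200208200408d64800120800061630010800010c0688800104800205162080084080083700041200041420b400040440008e,
    0x1c80402100402124008041008042c7400410400c007a500040100060156882400102400244000248008408158120020140021a6048008050008480000124000144cc201200241200e,
    0x781200209200209e009200009400ba02200003200014f2080014080016ac8240008280006c208200208400470820800821001a4208200408200058804101004100ee2080080180085,
    0x8000810000c10268009008011008b2c80002490002765041200041208cbc0008240000496c01100001120047c0008240008288d000088000058e90200100200122de0100400180404,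
    0x90004804008804d9001240002240db0100024a00004b0201001202001924800804900806df009040009080db00041200041271c200009200011bc0020900020a03870480010880014,
    0x300009200009425400800900800ad4480012090012210201001201009300804005004005402000802080808b8104100204100ec008041008081520104004108006670480010880016,
    0x20800820800840920400410800419401008201008409220004120104116400010800010d47200240200440c44204000304002ca0082010082028700048040088049a049000281000b,
    0x548201010201039a200010240208510820100840100d50102000180406940408000409021d010200010400554000920001121662080080080188901208001210011f2002402402406,
    0x12400012925001041001081b34000904000a0661009001209001861020001104002eb2000104002085a8004900004a00d8001400002400c9402002402004648010001018001b,
    0x481240001440035f04800104000ac38000904001106e120020120040115c0001400401202d04804025000082c004804005005130010480410480a8100804200806d90400480400185,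
    0x441001202001220a04004108008056410080410080940008240008440080104004904005400410010410092c102000112000155008009009010290044000024040c92000482000883,
    0x9810100020082160008240008440db8000220100141ab0080480080505640240040240251200820100840133c0241000242001c0080410080429a4204000204021a30490000810084,
    0x8c0208040408076720100820200883810410020410098000049008049840000124000129a500024800824824c820800820822e72080010100026948048010009010d2080082080100,
    0xb800090402080aeb0082010082416a8140000a200016320900020a000e5c00400800410b6b20004140004193010000810002a6a20020120020943c800901004100a32000414000805,
    0xb4820100840100ab0012080012105a40240041240061f008400008210690000a001011030d24000120000a900005000044801a304004104104114c004804004826ef0090400110405,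
    0x701000241000460020020821020016c120800840803a9001240041240850820101020100650400020810015a80240040280075c0482002482000a41008041008259d048040088040e,
    0x7810410010810152008048008049b1c0241000480008e00920000920802c04400002c0012b04900000a00891c000824000847a52080402010809548000089200058f0002090002111,
    0xa8008020904021230080480002490200209000208411404120024120015800402400402ba300120800a2005002200002201005320000920001181c820004820024692000482402404,
    0x38900004100904cd400001240041c00024020128003a5200002041041e48004820124800880014000020095390000048041079b240040400048854100008100125550412000414005,
    0x4882400012410197009040240080598020008120123292410002020405b4800008824006e60800010402412a400180002082560001400041240b3c008800104822470022000012802,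
    0x50004104024104d50010412022004ac00800410880129002008009048e1c1040208240216500a0002110000740280001440001500a0000490085981041008041200f0410082410402,
    0x54200020140803a600100924800838400180000092751401000200248149000800120040230180000402481a00008081009239908100000124156400802002800423002001041201d,
    0xb00010201048041001000100900961c040020820123250000c02082405800000601208221b008010048208b4c0200408009239220001020804899c000204820027800100010482405,
    0x2000810082480090248000201208c4c04400082080647001002049001b1c3000000049210b008041200049538101000800904e400040800108859490002002412050200080048009e,
    0xa402082014000550408000048201940100200024009510080802012408a80001081208070004008000904121c000140900806112410002010092400209009001064d0030002002025,
    0x509000208400054000001800104991c02100082080707040240048041058101000804804240420000012486380008408048074a400200201048d00920000800904800402082080410,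
    0x2040009201e000008088048224e003000009240c]

set_option maxRecDepth 100000

theorem blockZ1_check : blockZ1.check pointZ equationsZ = true := by decide +kernel
theorem blockY1_check : blockY1.check pointZ equationsY = true := by decide +kernel
theorem blockS1_check : blockS1.check pointS equationsS = true := by decide +kernel
theorem blockS6_check : blockS6.check pointS equationsS = true := by decide +kernel

/-! ### Soundness of the elimination -/

/-- The number with the digits `d 0, …, d (n - 1)` in base `1024`. -/
def pack : ℕ → (ℕ → ℕ) → ℕ
  | 0, _ => 0
  | n + 1, d => d 0 + 1024 * pack n fun j => d (j + 1)

theorem pack_congr {n : ℕ} {d e : ℕ → ℕ} (h : ∀ j < n, d j = e j) : pack n d = pack n e := by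
  induction n generalizing d e with
  | zero => rfl
  | succ n ih =>
    simp only [pack, h 0 (by omega)]
    rw [ih fun j hj => h (j + 1) (by omega)]

theorem pack_add (n : ℕ) (d e : ℕ → ℕ) : pack n d + pack n e = pack n fun j => d j + e j := by
  induction n generalizing d e with
  | zero => rfl
  | succ n ih => simp only [pack, ← ih]; ring

theorem mul_pack (f n : ℕ) (d : ℕ → ℕ) : f * pack n d = pack n fun j => f * d j := by
  induction n generalizing d with
  | zero => rfl
  | succ n ih => simp only [pack, ← ih]; ring

theorem pack_append (a b : ℕ) (d : ℕ → ℕ) :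
    pack (a + b) d = pack a d + 1024 ^ a * pack b fun j => d (j + a) := by
  induction a generalizing d with
  | zero => simp [pack]
  | succ a ih =>
    rw [show a + 1 + b = a + b + 1 by ring]
    simp only [pack, ih, pow_succ]
    rw [show (fun j => d (j + (a + 1))) = fun j => d (j + a + 1) from by ext; rw [add_assoc]]
    ring

theorem pack_lt (n : ℕ) (d : ℕ → ℕ) (h : ∀ j, d j < 1024) : pack n d < 1024 ^ n := by
  induction n generalizing d with
  | zero => simp [pack]
  | succ n ih =>
    have := ih (fun j => d (j + 1)) fun j => h _
    have := h 0
    simp only [pack, pow_succ]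
    omega

theorem pack_inj {n : ℕ} {d e : ℕ → ℕ} (hd : ∀ j, d j < 1024) (he : ∀ j, e j < 1024)
    (h : pack n d = pack n e) : ∀ j < n, d j = e j := by
  induction n generalizing d e with
  | zero => simp
  | succ n ih =>
    have h0 := hd 0
    have h1 := he 0
    simp only [pack] at h
    intro j hj
    cases j with
    | zero => omega
    | succ j =>
      exact ih (d := fun j => d (j + 1)) (e := fun j => e (j + 1)) (fun j => hd _) (fun j => he _)
        (by omega) j (by omega)

theorem pack_single (n i a : ℕ) (hi : i < n) :
    pack n (fun j => if j = i then a else 0) = a * 1024 ^ i := by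
  induction n generalizing i with
  | zero => omega
  | succ n ih =>
    cases i with
    | zero =>
      have : pack n (fun _ => 0) = 0 := by
        have := mul_pack 0 n fun _ => 0
        simpa using this.symm
      simp [pack, this]
    | succ i =>
      have := ih i (by omega)
      simp only [pack, Nat.add_right_cancel_iff, this, pow_succ]
      simp; ring

theorem ones_eq (n : ℕ) : ones n = pack n fun _ => 1 := by
  have h : ∀ n, 1023 * pack n (fun _ => 1) + 1 = 1024 ^ n := by
    intro n
    induction n with
    | zero => rfl
    | succ n ih => simp only [pack, pow_succ, ← ih]; ring
  have := h n
  change (1024 ^ n - 1) / 1023 = _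
  omega

theorem land_digit (a b x y : ℕ) (ha : a < 1024) (hb : b < 1024) :
    Nat.land (a + 1024 * x) (b + 1024 * y) = Nat.land a b + 1024 * Nat.land x y := by
  change (a + 1024 * x) &&& (b + 1024 * y) = (a &&& b) + 1024 * (x &&& y)
  have hab : a &&& b < 2 ^ 10 := lt_of_le_of_lt Nat.and_le_left ha
  apply Nat.eq_of_testBit_eq
  intro i
  rw [Nat.testBit_and, show a + 1024 * x = 2 ^ 10 * x + a by ring,
    show b + 1024 * y = 2 ^ 10 * y + b by ring,
    show (a &&& b) + 1024 * (x &&& y) = 2 ^ 10 * (x &&& y) + (a &&& b) by ring,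
    Nat.testBit_two_pow_mul_add _ ha, Nat.testBit_two_pow_mul_add _ hb,
    Nat.testBit_two_pow_mul_add _ hab]
  split_ifs <;> simp

theorem land_31 (a : ℕ) : Nat.land a 31 = a % 32 := Nat.and_two_pow_sub_one_eq_mod a 5

theorem land_pack_31 (n : ℕ) (d : ℕ → ℕ) (h : ∀ j, d j < 1024) :
    Nat.land (pack n d) (pack n fun _ => 31) = pack n fun j => d j % 32 := by
  induction n generalizing d with
  | zero => exact Nat.and_zero 0
  | succ n ih =>
    simp only [pack]
    rw [land_digit _ _ _ _ (h 0) (by norm_num), land_31, ih _ fun j => h _]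

theorem exists_land_pack_31 (n z : ℕ) :
    ∃ d : ℕ → ℕ, (∀ j, d j < 32) ∧ Nat.land z (pack n fun _ => 31) = pack n d := by
  induction n generalizing z with
  | zero => exact ⟨fun _ => 0, by simp, Nat.and_zero z⟩
  | succ n ih =>
    obtain ⟨d, hd, he⟩ := ih (z / 1024)
    refine ⟨fun j => Nat.casesOn j (z % 32) d, fun j => ?_, ?_⟩
    · cases j with
      | zero => exact Nat.mod_lt _ (by norm_num)
      | succ j => exact hd j
    · simp only [pack]
      rw [← he]
      conv_lhs => rw [← Nat.mod_add_div z 1024]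
      rw [land_digit _ _ _ _ (Nat.mod_lt _ (by norm_num)) (by norm_num), land_31]
      have : z % 1024 % 32 = z % 32 := by omega
      rw [this]
      rfl

theorem land_shiftRight_pack_31 (n : ℕ) (d : ℕ → ℕ) (h : ∀ j, d j < 1024) :
    Nat.land (Nat.shiftRight (pack n d) 5) (pack n fun _ => 31) = pack n fun j => d j / 32 := by
  have hs : ∀ x, Nat.shiftRight x 5 = x / 32 := fun x => Nat.shiftRight_eq_div_pow x 5
  induction n generalizing d with
  | zero => exact Nat.and_zero _
  | succ n ih =>
    simp only [pack]
    rw [← ih _ fun j => h _, hs, hs]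
    set P := pack n fun j => d (j + 1)
    have h0 := h 0
    rw [show (d 0 + 1024 * P) / 32 = d 0 / 32 + 32 * (P % 32) + 1024 * (P / 32) by omega,
      land_digit _ _ _ _ (by omega) (by norm_num), land_31]
    omega

theorem red_pack (n : ℕ) (d : ℕ → ℕ) (h : ∀ j, d j ≤ 990) :
    red (pack n fun _ => 1) (pack n fun _ => 31) (pack n d) = pack n fun j => d j % 31 := by
  have h1 : ∀ j, d j < 1024 := fun j => by have := h j; omega
  unfold red
  rw [land_shiftRight_pack_31 n d h1]
  simp only [Nat.add_eq, pack_add]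
  rw [land_shiftRight_pack_31 _ _ fun j => by have := h j; omega]
  simp only [pack_add]
  rw [land_pack_31 _ _ fun j => by have := h j; omega]
  have key : ∀ d < 991, (d + (d + d / 32 + 1) / 32) % 32 = d % 31 := by decide +kernel
  exact pack_congr fun j _ => key _ (by have := h j; omega)

/-- `x` is a row with value `s` at the vector `V`. -/
def Represents (n : ℕ) (V : ℕ → ZMod 31) (x : ℕ) (s : ZMod 31) : Prop :=
  ∃ d : ℕ → ℕ, (∀ j, d j ≤ 30) ∧ x = pack n d ∧ s = ∑ j ∈ Finset.range n, d j * V j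

namespace Represents
variable {n : ℕ} {V : ℕ → ZMod 31} {x v : ℕ} {s t : ZMod 31}

theorem zero : Represents n V 0 0 :=
  ⟨fun _ => 0, by simp, by simpa using (mul_pack 0 n fun _ => 0), by simp⟩

theorem axpy (hx : Represents n V x s) (hv : Represents n V v t) {f : ℕ} (hf : f ≤ 31) :
    Represents n V (axpy (pack n fun _ => 1) (pack n fun _ => 31) x f v) (s + f * t) := by
  obtain ⟨d, hd, rfl, rfl⟩ := hx
  obtain ⟨e, he, rfl, rfl⟩ := hv
  refine ⟨fun j => (d j + f * e j) % 31, fun j => ?_, ?_, ?_⟩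
  · exact Nat.le_of_lt_succ (Nat.mod_lt _ (by norm_num))
  · unfold DihedralSections.axpy
    simp only [Nat.add_eq, Nat.mul_eq, mul_pack, pack_add]
    refine red_pack _ _ fun j => ?_
    have := hd j
    have := Nat.mul_le_mul hf (he j)
    omega
  · rw [Finset.mul_sum, ← Finset.sum_add_distrib]
    refine Finset.sum_congr rfl fun j _ => ?_
    simp only [ZMod.natCast_mod]
    push_cast
    ring

theorem single {i : ℕ} (hi : i < n) : Represents n V (Nat.shiftLeft 1 (Nat.mul 10 i)) (V i) := by
  refine ⟨fun j => if j = i then 1 else 0, fun j => by dsimp only; split_ifs <;> simp, ?_, ?_⟩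
  · rw [pack_single _ _ _ hi]
    change 1 <<< (10 * i) = _
    rw [Nat.shiftLeft_eq, pow_mul]; norm_num
  · simp [hi]

theorem startRow (hV : ∀ j < 7, V j = 0) (u : ℕ) : Represents (7 + n) V (startRow u) 0 := by
  have h31 : Nat.mul 31 (ones 7) = pack 7 fun _ => 31 := by rw [ones_eq]; exact mul_pack _ _ _
  unfold DihedralSections.startRow
  rw [h31, ones_eq]
  obtain ⟨d, hd, he⟩ := exists_land_pack_31 7 (Nat.mul u 1000003000050070003)
  rw [he, red_pack _ _ fun j => by have := hd j; omega]
  refine ⟨fun j => if j < 7 then d j % 31 else 0, fun j => by dsimp only; split_ifs <;> omega, ?_, ?_⟩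
  · rw [pack_append]
    have := mul_pack 0 n fun _ => 0
    rw [show (pack n fun j => if j + 7 < 7 then d (j + 7) % 31 else 0) = 0 by
      rw [pack_congr (e := fun _ => 0 * 0) (by simp)]; simpa using this.symm]
    rw [mul_zero, add_zero]
    exact pack_congr fun j hj => by simp [hj]
  · symm
    refine Finset.sum_eq_zero fun j _ => ?_
    by_cases hj : j < 7
    · rw [hV j hj, mul_zero]
    · simp [hj]

end Represents

/-- All rows in the tree satisfy `Q`. -/
def Store.All (Q : ℕ → Prop) : Store → Prop
  | nil => True
  | leaf _ v => Q v
  | node _ l r => l.All Q ∧ r.All Q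

theorem Store.find_all {Q : ℕ → Prop} {x f v : ℕ} {S : Store} (hS : S.All Q)
    (h : S.find x = some (f, v)) : f ≤ 31 ∧ Q v := by
  induction S with
  | nil => simp [find] at h
  | leaf p w =>
    rw [find] at h
    split at h
    · simp at h
    · next g hg =>
      simp only [Option.some.injEq, Prod.mk.injEq] at h
      obtain ⟨rfl, rfl⟩ := h
      refine ⟨?_, hS⟩
      rw [← hg]
      exact Nat.and_le_right
  | node m l r hl hr =>
    rw [find] at h
    split at h
    · exact hr hS.2 h
    · exact hl hS.1 h

theorem Store.insertNil_all {Q : ℕ → Prop} {v : ℕ} (hv : Q v) (d i p : ℕ) (k : Store → Bool)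
    (h : insertNil v d i p k = true) : ∃ S : Store, S.All Q ∧ k S = true := by
  induction d generalizing p k with
  | zero => exact ⟨leaf p v, hv, h⟩
  | succ d ih =>
    rw [insertNil] at h
    split at h
    · simp at h
    · cases hb : Nat.testBit i d
      · rw [hb] at h
        obtain ⟨S, hS, hk⟩ := ih _ _ h
        exact ⟨node _ S nil, ⟨hS, trivial⟩, hk⟩
      · rw [hb] at h
        obtain ⟨S, hS, hk⟩ := ih _ _ h
        exact ⟨node _ nil S, ⟨trivial, hS⟩, hk⟩

theorem Store.insert_all {Q : ℕ → Prop} {v : ℕ} (hv : Q v) {S : Store} (hS : S.All Q) (d i p : ℕ)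
    (k : Store → Bool) (h : S.insert v d i p k = true) : ∃ S : Store, S.All Q ∧ k S = true := by
  induction S generalizing d p k with
  | nil => exact insertNil_all hv d i p k h
  | leaf _ _ => simp [insert] at h
  | node m l r hl hr =>
    rw [insert] at h
    cases hb : Nat.testBit i (Nat.pred d)
    · rw [hb] at h
      obtain ⟨S, hS', hk⟩ := hl hS.1 _ _ _ h
      exact ⟨node m S r, ⟨hS', hS.2⟩, hk⟩
    · rw [hb] at h
      obtain ⟨S, hS', hk⟩ := hr hS.2 _ _ _ h
      exact ⟨node m l S, ⟨hS.1, hS'⟩, hk⟩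

theorem represents_reduce {n : ℕ} {V : ℕ → ZMod 31} {S : Store}
    (hS : S.All fun v => Represents n V v 0) (fuel : ℕ) {x : ℕ} {s : ZMod 31}
    (hx : Represents n V x s) :
    Represents n V (reduce (pack n fun _ => 1) (pack n fun _ => 31) S fuel x) s := by
  induction fuel generalizing x with
  | zero => exact hx
  | succ k ih =>
    change Represents n V (match S.find x with
      | none => x
      | some (f, v) => match axpy _ _ x f v with
        | 0 => 0
        | Nat.succ y => reduce _ _ S k (Nat.succ y)) s
    split
    · exact hx
    · next f v hf =>
      obtain ⟨hf31, hv⟩ := Store.find_all hS hf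
      have h := hx.axpy hv hf31
      rw [mul_zero, add_zero] at h
      split
      · next h0 => rwa [h0] at h
      · next y hy => rw [hy] at h; exact ih h

theorem natCast_coefVal {κ : Type} (e : κ → ℕ) (q : Coef κ) :
    (coefVal e q : ZMod 31) = (if q.1 then -1 else 1) * (q.2.map fun p => (e p : ZMod 31)).prod := by
  unfold coefVal
  rw [show ∀ a, Nat.mod a 31 = a % 31 from fun _ => rfl, ZMod.natCast_mod]
  obtain ⟨b, l⟩ := q
  induction l with
  | nil => cases b <;> simp; decide
  | cons p l ih =>
    simp only [List.foldr_cons, Nat.mul_eq, Nat.cast_mul, List.map_cons, List.prod_cons] at ih ⊢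
    rw [ih]; ring

/-- The value of a row given by a bilinear form and a monomial, at a vector indexed by positions. -/
def rowValue {κ R : Type} [CommRing R] (c : κ → R) (loc : ℕ → Option ℕ) (V : ℕ → R) (E : ℕ)
    (g : Bil κ) : R :=
  (g.map fun u => (if u.1.1 then -1 else 1) * (u.1.2.map c).prod *
    (loc (keyMul E u.2.1 u.2.2)).elim 0 V).sum

/-- The terms of the row are well formed and have a position. -/
def IsRow {κ : Type} (loc : ℕ → Option ℕ) (E : ℕ) (g : Bil κ) : Prop :=
  ∀ u ∈ g, digitAt E u.2.1 < 7 ∧ u.2.1 < 8 ∧ u.2.2 < 16 ∧ (loc (keyMul E u.2.1 u.2.2)).isSome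

theorem numRow_spec {κ : Type} {e : κ → ℕ} {n : ℕ} {V : ℕ → ZMod 31} {loc : ℕ → Option ℕ}
    (hloc : ∀ k p, loc k = some p → p < n) {E : ℕ} {g : Bil κ} {x y : ℕ} {s : ZMod 31}
    (hx : Represents (7 + n) (fun j => if j < 7 then 0 else V (j - 7)) x s)
    (h : numRow e (pack (7 + n) fun _ => 1) (pack (7 + n) fun _ => 31) loc E g x = some y) :
    IsRow loc E g ∧ Represents (7 + n) (fun j => if j < 7 then 0 else V (j - 7)) y
      (s + rowValue (fun p => (e p : ZMod 31)) loc V E g) := by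
  induction g generalizing x s with
  | nil =>
    simp only [numRow, Option.some.injEq] at h
    subst h
    exact ⟨by simp [IsRow], by simpa [rowValue] using hx⟩
  | cons u g ih =>
    rw [numRow] at h
    cases hc : Nat.blt (digitAt E u.2.1) 7 && (Nat.blt u.2.1 8 && Nat.blt u.2.2 16)
    · simp [hc] at h
    rw [hc, cond_true] at h
    simp only [Bool.and_eq_true, Nat.blt_eq] at hc
    split at h
    · simp at h
    next p hp =>
    have hpn := hloc _ _ hp
    have hx' := hx.axpy (Represents.single (show p + 7 < 7 + n by omega))
      (show coefVal e u.1 ≤ 31 from (Nat.mod_lt _ (by norm_num)).le)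
    have hy : IsRow loc E g ∧ Represents (7 + n) (fun j => if j < 7 then 0 else V (j - 7)) y
        (s + coefVal e u.1 * V p + rowValue (fun p => (e p : ZMod 31)) loc V E g) := by
      rw [show (if p + 7 < 7 then 0 else V (p + 7 - 7)) = V p by simp] at hx'
      split at h
      · next h0 => rw [show Nat.add p 7 = p + 7 from rfl] at h0; rw [h0] at hx'; exact ih hx' h
      · next z hz => rw [show Nat.add p 7 = p + 7 from rfl] at hz; rw [hz] at hx'; exact ih hx' h
    refine ⟨?_, ?_⟩
    · intro w hw
      rcases List.mem_cons.1 hw with rfl | hw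
      · exact ⟨hc.1, hc.2.1, hc.2.2, by simp [hp]⟩
      · exact hy.1 w hw
    · convert hy.2 using 1
      simp only [rowValue, List.map_cons, List.sum_cons, hp, Option.elim_some, natCast_coefVal]
      ring

theorem eliminate_spec {κ : Type} {e : κ → ℕ} {gens : List (Bil κ)} {n : ℕ} {V : ℕ → ZMod 31}
    {loc : ℕ → Option ℕ} (hloc : ∀ k p, loc k = some p → p < n) {l : List ℕ} {i : ℕ} {S : Store}
    (h : eliminate e gens (pack (7 + n) fun _ => 1) (pack (7 + n) fun _ => 31) loc l i S = true)
    (hS : S.All fun v => Represents (7 + n) (fun j => if j < 7 then 0 else V (j - 7)) v 0)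
    (hl : ∀ u ∈ l, rowValue (fun p => (e p : ZMod 31)) loc V (codeOf u)
      (gens.getD (genOf u) []) = 0) :
    (∀ u ∈ l, IsRow loc (codeOf u) (gens.getD (genOf u) [])) ∧
    ∀ j, i ≤ j → j < i + l.length → ∃ v, isPivot j v = true ∧
      Represents (7 + n) (fun j => if j < 7 then 0 else V (j - 7)) v 0 := by
  induction l generalizing i S with
  | nil => exact ⟨by simp, fun j h1 h2 => by simp at h2; omega⟩
  | cons u l ih =>
    rw [eliminate] at h
    split at h
    · simp at h
    next x hx =>
    obtain ⟨hrow, hrep⟩ := numRow_spec hloc (Represents.startRow (fun j hj => by simp [hj]) u) hx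
    rw [hl u (by simp), add_zero] at hrep
    have hred := represents_reduce hS 1000 hrep
    dsimp only at h
    set y := reduce (pack (7 + n) fun _ => 1) (pack (7 + n) fun _ => 31) S 1000 x
    set c := Nat.land (Nat.shiftRight y (Nat.mul 10 (Nat.add i 7))) 1023
    have hpiv := Represents.zero.axpy hred (f := (30 * c ^ 29) % 31)
      (Nat.mod_lt _ (by norm_num)).le
    rw [mul_zero, add_zero] at hpiv
    split at h
    · simp at h
    next v hv =>
    rw [show (30 * c ^ 29) % 31 = Nat.mod (Nat.mul 30 (Nat.pow c 29)) 31 from rfl, hv] at hpiv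
    cases hp : isPivot i (Nat.succ v)
    · simp [hp] at h
    rw [hp, cond_true] at h
    obtain ⟨S', hS', hk⟩ := Store.insert_all hpiv hS _ _ _ _ h
    obtain ⟨h1, h2⟩ := ih hk hS' fun w hw => hl w (List.mem_cons_of_mem _ hw)
    refine ⟨?_, fun j hij hj => ?_⟩
    · intro w hw
      rcases List.mem_cons.1 hw with rfl | hw
      · exact hrow
      · exact h1 w hw
    · rcases hij.eq_or_lt with rfl | hij
      · exact ⟨_, hp, hpiv⟩
      · exact h2 j hij (by simp at hj; omega)

instance : Fact (Nat.Prime 31) := ⟨by norm_num⟩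

theorem eq_zero_of_pivots {n : ℕ} {V : ℕ → ZMod 31}
    (h : ∀ j < n, ∃ v, isPivot j v = true ∧
      Represents (7 + n) (fun j => if j < 7 then 0 else V (j - 7)) v 0) : ∀ j < n, V j = 0 := by
  suffices H : ∀ k j, j < n → n ≤ j + k → V j = 0 from fun j hj => H n j hj (by omega)
  intro k
  induction k with
  | zero => intro j h1 h2; omega
  | succ k ih =>
    intro j hj hk
    obtain ⟨v, hp, d, hd, rfl, hs⟩ := h j hj
    have hlt : ∀ i, d i < 1024 := fun i => by have := hd i; omega
    have hp' : pack (7 + n) d / 1024 ^ 7 % 1024 ^ (j + 1) = 30 * 1024 ^ j := by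
      rw [isPivot, Nat.beq_eq] at hp
      rw [← show _ = 30 * 1024 ^ j from hp]
      change _ = pack (7 + n) d >>> 70 % _
      rw [Nat.shiftRight_eq_div_pow]
      norm_num
    rw [pack_append, Nat.add_mul_div_left _ _ (by positivity),
      Nat.div_eq_of_lt (pack_lt _ _ hlt), zero_add,
      show n = j + 1 + (n - (j + 1)) by omega, pack_append, Nat.add_mul_mod_self_left,
      Nat.mod_eq_of_lt (pack_lt _ _ fun _ => hlt _), ← pack_single (j + 1) j 30 (by omega)] at hp'
    have hdig := pack_inj (fun _ => hlt _) (fun i => by split_ifs <;> norm_num) hp'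
    rw [Finset.sum_range_add, Finset.sum_eq_zero (by
      intro i hi; simp [Finset.mem_range.1 hi]), zero_add, Finset.sum_eq_single j] at hs
    · have := hdig j (by omega)
      rw [if_pos rfl, add_comm] at this
      simp only [this, add_lt_iff_neg_left, not_lt_zero, if_false, add_tsub_cancel_left] at hs
      exact (mul_eq_zero.1 hs.symm).resolve_left (by decide)
    · intro i hi hij
      rcases lt_or_gt_of_ne hij with hlt | hgt
      · have := hdig i (by omega)
        rw [if_neg hij, add_comm] at this
        simp [this]
      · have := ih i (Finset.mem_range.1 hi) (by omega)
        simp [this]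
    · intro hj'
      exact absurd (Finset.mem_range.2 hj) hj'

/-! ### From one specialization to the general one -/

def Coef.eval {κ K : Type} [CommRing K] (c : κ → K) (q : Coef κ) : K :=
  (if q.1 then -1 else 1) * (q.2.map c).prod

def Bil.eval {κ K : Type} [CommRing K] (c : κ → K) (t x : ℕ → K) (g : Bil κ) : K :=
  (g.map fun u => u.1.eval c * (t u.2.1 * x u.2.2)).sum

/-- The coefficient in position `j` of a row. -/
def rowCoef {κ R : Type} [CommRing R] (c : κ → R) (loc : ℕ → Option ℕ) (E : ℕ) (g : Bil κ)
    (j : ℕ) : R :=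
  (g.map fun u => if loc (keyMul E u.2.1 u.2.2) = some j then u.1.eval c else 0).sum

theorem map_rowCoef {κ R R' : Type} [CommRing R] [CommRing R'] (f : R →+* R') (c : κ → R)
    (loc : ℕ → Option ℕ) (E : ℕ) (g : Bil κ) (j : ℕ) :
    f (rowCoef c loc E g j) = rowCoef (fun p => f (c p)) loc E g j := by
  unfold rowCoef
  rw [map_list_sum, List.map_map]
  congr 1
  refine List.map_congr_left fun u _ => ?_
  simp only [Function.comp, Coef.eval]
  split_ifs <;> simp [map_list_prod, List.map_map, Function.comp_def]

theorem rowValue_eq_sum {κ R : Type} [CommRing R] (c : κ → R) {loc : ℕ → Option ℕ} {n : ℕ}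
    (hloc : ∀ k p, loc k = some p → p < n) (V : ℕ → R) (E : ℕ) (g : Bil κ) :
    rowValue c loc V E g = ∑ j : Fin n, rowCoef c loc E g j * V j := by
  induction g with
  | nil => simp [rowValue, rowCoef]
  | cons u g ih =>
    simp only [rowValue, rowCoef, List.map_cons, List.sum_cons, add_mul,
      Finset.sum_add_distrib] at ih ⊢
    rw [ih]
    congr 1
    cases hk : loc (keyMul E u.2.1 u.2.2) with
    | none => simp
    | some p =>
      rw [Finset.sum_eq_single ⟨p, hloc _ _ hk⟩]
      · simp [Coef.eval]
      · intro j _ hj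
        rw [if_neg, zero_mul]
        simp only [Option.some.injEq]
        rintro rfl
        exact hj rfl
      · simp

/-- The monomial with code `E`. -/
def codedMonomial {K : Type} [CommRing K] (t : ℕ → K) (E : ℕ) : K :=
  ∏ s ∈ Finset.range 8, t s ^ digitAt E s

theorem digitAt_add {E s : ℕ} (h : digitAt E s < 7) (r : ℕ) :
    digitAt (E + 8 ^ s) r = digitAt E r + if r = s then 1 else 0 := by
  change (E + 8 ^ s) / 8 ^ r % 8 = E / 8 ^ r % 8 + _
  change E / 8 ^ s % 8 < 7 at h
  rcases lt_trichotomy r s with hr | rfl | hr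
  · obtain ⟨k, rfl⟩ := Nat.exists_eq_add_of_lt hr
    rw [show 8 ^ (r + k + 1) = 8 ^ r * (8 ^ k * 8) by ring,
      Nat.add_mul_div_left _ _ (by positivity), if_neg (by omega)]
    omega
  · rw [Nat.add_div_right _ (by positivity), if_pos rfl]
    omega
  · obtain ⟨k, rfl⟩ := Nat.exists_eq_add_of_lt hr
    rw [show 8 ^ (s + k + 1) = 8 ^ s * 8 * 8 ^ k by ring, ← Nat.div_div_eq_div_mul,
      ← Nat.div_div_eq_div_mul, ← Nat.div_div_eq_div_mul, ← Nat.div_div_eq_div_mul,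
      Nat.add_div_right _ (by positivity), if_neg (by omega),
      show Nat.succ (E / 8 ^ s) / 8 = E / 8 ^ s / 8 by omega, add_zero]

theorem codedMonomial_add {K : Type} [CommRing K] (t : ℕ → K) {E s : ℕ} (hs : s < 8)
    (h : digitAt E s < 7) : codedMonomial t (E + 8 ^ s) = codedMonomial t E * t s := by
  unfold codedMonomial
  simp only [digitAt_add h, pow_add, Finset.prod_mul_distrib]
  congr 1
  rw [Finset.prod_eq_single s (fun b _ hb => by simp [hb])
    (fun h => absurd (Finset.mem_range.2 hs) h)]
  simp

theorem codedMonomial_pair {K : Type} [CommRing K] (t : ℕ → K) {a b i j : ℕ} (ha : a < 8)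
    (hb : b < 8) (hij : i + j < 8) :
    codedMonomial t (i * 8 ^ a + j * 8 ^ b) = t a ^ i * t b ^ j := by
  have key : ∀ a < 8, ∀ b < 8, ∀ i < 8, ∀ j < 8 - i, ∀ s < 8, digitAt (i * 8 ^ a + j * 8 ^ b) s =
      (if s = a then i else 0) + if s = b then j else 0 := by decide +kernel
  unfold codedMonomial
  rw [Finset.prod_congr rfl fun s hs => by
    rw [key a ha b hb i (by omega) j (by omega) s (Finset.mem_range.1 hs), pow_add]]
  rw [Finset.prod_mul_distrib, Finset.prod_eq_single a (fun b _ hb => by simp [hb])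
    (fun h => absurd (Finset.mem_range.2 ha) h), Finset.prod_eq_single b (fun b _ hb => by simp [hb])
    (fun h => absurd (Finset.mem_range.2 hb) h)]
  simp

theorem locate_spec {n P T D key p : ℕ} (h : locate n P T D key = some p) :
    p < n ∧ keyAt D p = key := by
  unfold locate at h
  dsimp only at h
  set p' := Nat.land (Nat.shiftRight T (Nat.mul 10 (Nat.mod key P))) 1023
  cases h1 : Nat.blt p' n
  · simp [h1] at h
  cases h2 : Nat.beq (keyAt D p') key
  · rw [h1, h2] at h; simp at h
  rw [h1, h2] at h
  simp only [cond_true, Option.some.injEq] at h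
  subst h
  exact ⟨by simpa [Nat.blt_eq] using h1, by simpa using h2⟩

theorem rowValue_eq_mul_eval {κ K : Type} [CommRing K] (c : κ → K) (t x : ℕ → K)
    {loc : ℕ → Option ℕ} {keys : ℕ → ℕ} (hloc : ∀ k p, loc k = some p → keys p = k) {E : ℕ}
    {g : Bil κ} (hg : IsRow loc E g) :
    rowValue c loc (fun j => codedMonomial t (keys j / 16) * x (keys j % 16)) E g =
      codedMonomial t E * g.eval c t x := by
  induction g with
  | nil => simp [rowValue, Bil.eval]
  | cons u g ih =>
    have ih := ih fun w hw => hg w (List.mem_cons_of_mem _ hw)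
    obtain ⟨h7, h8, h16, hs⟩ := hg u (by simp)
    obtain ⟨p, hp⟩ := Option.isSome_iff_exists.1 hs
    simp only [rowValue, Bil.eval, List.map_cons, List.sum_cons, mul_add] at ih ⊢
    rw [ih, hp, Option.elim_some, hloc _ _ hp]
    congr 1
    have hk : keyMul E u.2.1 u.2.2 = (E + 8 ^ u.2.1) * 16 + u.2.2 := rfl
    rw [hk, show ((E + 8 ^ u.2.1) * 16 + u.2.2) / 16 = E + 8 ^ u.2.1 by omega,
      show ((E + 8 ^ u.2.1) * 16 + u.2.2) % 16 = u.2.2 by omega, codedMonomial_add t h8 h7, Coef.eval]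
    ring

theorem Block.check_spec {κ : Type} {B : Block} {e : κ → ℕ} {gens : List (Bil κ)}
    (h : B.check e gens = true) : B.items.length = B.size ∧ ∃ T D,
      B.covers (locate B.size B.P T D) = true ∧
      eliminate e gens (pack (7 + B.size) fun _ => 1) (pack (7 + B.size) fun _ => 31)
        (locate B.size B.P T D) B.items 0 .nil = true := by
  have h31 : Nat.mul 31 (ones (Nat.add B.size 7)) = pack (7 + B.size) fun _ => 31 := by
    rw [ones_eq, show Nat.add B.size 7 = 7 + B.size from Nat.add_comm _ _]; exact mul_pack _ _ _
  unfold check at h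
  split at h
  · simp at h
  next o ho =>
  rw [← ho] at h
  split at h
  · simp at h
  next m hm =>
  rw [← hm] at h
  split at h
  · simp at h
  split at h
  · simp at h
  simp only [Bool.and_eq_true, h31] at h
  rw [ones_eq, show Nat.add B.size 7 = 7 + B.size from Nat.add_comm _ _] at h
  exact ⟨by simpa using h.1, _, _, h.2.1, h.2.2⟩

/-- If the elimination succeeds at one point modulo `31`, then the bilinear equations force the
monomials of the block to vanish for all parameters at which a non-zero polynomial does not
vanish. -/
theorem Block.exists_polynomial {κ : Type} (B : Block) {e : κ → ℕ} {gens : List (Bil κ)}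
    (h : B.check e gens = true) (hdeg : B.deg < 8) (hlen : B.wtT.length ≤ 8)
    (hx : ∀ q ∈ B.wtX, q.1 < 16) :
    ∃ F : MvPolynomial κ ℤ, F ≠ 0 ∧ ∀ c : κ → ℂ, MvPolynomial.aeval c F ≠ 0 →
      ∀ t x : ℕ → ℂ, (∀ g ∈ gens, g.eval c t x = 0) →
        ∀ a < B.wtT.length, ∀ b < B.wtT.length, ∀ i ≤ B.deg, ∀ q ∈ B.wtX,
          (i * B.wtT.getD a 0 + (B.deg - i) * B.wtT.getD b 0 + q.2) % 7 = B.w →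
            t a ^ i * t b ^ (B.deg - i) * x q.1 = 0 := by
  obtain ⟨hsize, T, D, hcov, hel⟩ := check_spec h
  set loc := locate B.size B.P T D
  have hlt : ∀ k p, loc k = some p → p < B.size := fun k p hp => (locate_spec hp).1
  let M {R : Type} [CommRing R] (c : κ → R) : Matrix (Fin B.size) (Fin B.size) R := fun i j =>
    rowCoef c loc (codeOf (B.items.get (i.cast hsize.symm)))
      (gens.getD (genOf (B.items.get (i.cast hsize.symm))) []) j
  have hmap : ∀ {R R' : Type} [CommRing R] [CommRing R'] (f : R →+* R') (c : κ → R),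
      f (M c).det = (M fun p => f (c p)).det := by
    intro R R' _ _ f c
    rw [RingHom.map_det]
    congr 1
    ext i j
    exact map_rowCoef f c loc _ _ _
  have hrow : ∀ V : ℕ → ZMod 31, (∀ u ∈ B.items, rowValue (fun p => (e p : ZMod 31)) loc V (codeOf u)
      (gens.getD (genOf u) []) = 0) → ∀ j < B.size, V j = 0 := by
    intro V hV
    refine eq_zero_of_pivots fun j hj => ?_
    exact (eliminate_spec hlt hel trivial hV).2 j (Nat.zero_le _) (by omega)
  have his : ∀ u ∈ B.items, IsRow loc (codeOf u) (gens.getD (genOf u) []) :=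
    (eliminate_spec (V := fun _ => 0) hlt hel trivial (fun u _ => by
      rw [rowValue_eq_sum _ hlt]; simp)).1
  refine ⟨(M MvPolynomial.X).det, fun h0 => ?_, fun c hc t x hg a ha b hb i hi q hq hw => ?_⟩
  · have h1 : (M fun p => (e p : ZMod 31)).det = 0 := by
      have := hmap (MvPolynomial.eval₂Hom (Int.castRingHom (ZMod 31)) fun p => (e p : ZMod 31))
        MvPolynomial.X
      rw [h0, map_zero] at this
      simpa using this.symm
    obtain ⟨v, hv, hMv⟩ := Matrix.exists_mulVec_eq_zero_iff.2 h1
    refine hv (funext fun j => ?_)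
    have := hrow (fun j => if hj : j < B.size then v ⟨j, hj⟩ else 0) (fun u hu => ?_) j j.2
    · simpa using this
    · obtain ⟨k, rfl⟩ := List.get_of_mem hu
      rw [rowValue_eq_sum _ hlt]
      have := congrFun hMv (k.cast hsize)
      simpa [Matrix.mulVec, dotProduct, M] using this
  · have h1 : (M c).det ≠ 0 := by
      have := hmap (MvPolynomial.aeval c : MvPolynomial κ ℤ →ₐ[ℤ] ℂ).toRingHom MvPolynomial.X
      simp only [AlgHom.toRingHom_eq_coe, RingHom.coe_coe, MvPolynomial.aeval_X] at this
      rwa [this] at hc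
    have hW : (fun j : Fin B.size =>
        codedMonomial t (keyAt D j / 16) * x (keyAt D j % 16)) = 0 := by
      by_contra hne
      refine h1 (Matrix.exists_mulVec_eq_zero_iff.1 ⟨_, hne, funext fun k => ?_⟩)
      have hu := his _ (List.get_mem B.items (k.cast hsize.symm))
      have h2 := rowValue_eq_mul_eval c t x (keys := keyAt D) (fun k p hp => (locate_spec hp).2) hu
      rw [rowValue_eq_sum _ hlt] at h2
      refine h2.trans ?_
      rcases lt_or_ge (genOf (B.items.get (k.cast hsize.symm))) gens.length with hl | hl
      · rw [hg _ (by rw [List.getD_eq_getElem _ _ hl]; exact List.getElem_mem hl), mul_zero]; rfl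
      · rw [List.getD_eq_default _ _ hl]; simp [Bil.eval]
    simp only [covers, List.all_eq_true, List.mem_range] at hcov
    have h3 := hcov a ha b hb i (by omega) q hq
    rw [show Nat.beq (Nat.mod (Nat.add (Nat.add (Nat.mul i (B.wtT.getD a 0))
        (Nat.mul (Nat.sub B.deg i) (B.wtT.getD b 0))) q.2) 7) B.w = true by
      rw [Nat.beq_eq]; exact hw, cond_true] at h3
    obtain ⟨p, hp⟩ := Option.isSome_iff_exists.1 h3
    obtain ⟨hpn, hkey⟩ := locate_spec hp
    have h4 := congrFun hW ⟨p, hpn⟩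
    simp only [hkey, Pi.zero_apply, Nat.add_eq, Nat.mul_eq, Nat.sub_eq, Nat.pow_eq] at h4
    have h16 := hx q hq
    rwa [show ((i * 8 ^ a + (B.deg - i) * 8 ^ b) * 16 + q.1) / 16 =
        i * 8 ^ a + (B.deg - i) * 8 ^ b by omega,
      show ((i * 8 ^ a + (B.deg - i) * 8 ^ b) * 16 + q.1) % 16 = q.1 by omega,
      codedMonomial_pair t (by omega) (by omega) (by omega)] at h4

/-! ### Pointwise smoothness -/

/-- The entries of the skew-symmetric matrix with coordinate vector `p`. -/
def skew {n : ℕ} (p : Pair n → ℂ) (i j : Fin n) : ℂ :=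
  if h : i < j then p ⟨(i, j), h⟩ else if h : j < i then - p ⟨(j, i), h⟩ else 0

theorem skew_of_lt {n : ℕ} (p : Pair n → ℂ) {i j : Fin n} (h : i < j) :
    skew p i j = p ⟨(i, j), h⟩ := dif_pos h

theorem skew_swap {n : ℕ} (p : Pair n → ℂ) (i j : Fin n) : skew p j i = - skew p i j := by
  unfold skew
  rcases lt_trichotomy i j with h | rfl | h
  · simp [h, h.not_gt]
  · simp
  · simp [h, h.not_gt]

theorem skew_self {n : ℕ} (p : Pair n → ℂ) (i : Fin n) : skew p i i = 0 := by simp [skew]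

/-- The Plücker relations. -/
def IsDecomposable {n : ℕ} (p : Pair n → ℂ) : Prop := ∀ i j k l : Fin n,
  skew p i j * skew p k l - skew p i k * skew p j l + skew p i l * skew p j k = 0

/-- The coordinates of the wedge product of the `k`-th basis vector and the `j`-th column of the
skew-symmetric matrix of `p`, a tangent vector of the cone over the Grassmannian. -/
def move {n : ℕ} (p : Pair n → ℂ) (k j : Fin n) : Pair n → ℂ := fun q =>
  (if q.1.1 = k then skew p q.1.2 j else 0) - if q.1.2 = k then skew p q.1.1 j else 0

theorem x_dotProduct {n : ℕ} (i j : Fin n) (h : i < j) (v : Pair n → ℂ) :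
    x i j h ⬝ᵥ v = v (pair i j h) := by simp [x]

theorem formsZ_dotProduct (c : Coeff → ℂ) (v : Pair 7 → ℂ) (s : Fin 6) : formsZ c s ⬝ᵥ v =
    ![v (pair 0 6) - c c26 * v (pair 1 5) - c c35 * v (pair 2 4),
      v (pair 0 5) - c c36 * v (pair 1 4) - c c45 * v (pair 2 3),
      v (pair 0 4) - c c46 * v (pair 1 3) - c c12 * v (pair 5 6),
      v (pair 0 3) - c c12 * v (pair 1 2) - c c46 * v (pair 4 6),
      v (pair 0 2) - c c36 * v (pair 3 6) - c c45 * v (pair 4 5),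
      v (pair 0 1) - c c26 * v (pair 2 6) - c c35 * v (pair 3 5)] s := by
  fin_cases s <;> simp [formsZ, sub_dotProduct, x_dotProduct]

theorem formsH_dotProduct (h : Fin 2 → Fin 3 → ℂ) (v : Pair 7 → ℂ) (r : Fin 2) : formsH h r ⬝ᵥ v =
    h r 0 * v (pair 1 6) + h r 1 * v (pair 2 5) + h r 2 * v (pair 3 4) := by
  simp [formsH, add_dotProduct, x_dotProduct]

theorem mapY_dotProduct (c : Coeff → ℂ) (v : Pair 6 → ℂ) (s : Fin 6) : mapY c s ⬝ᵥ v =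
    ![c c26 * v (pair 1 5) + c c35 * v (pair 2 4),
      c c36 * v (pair 2 5) + c c45 * v (pair 3 4),
      c c12 * v (pair 0 1) + c c46 * v (pair 3 5),
      c c46 * v (pair 0 2) + c c12 * v (pair 4 5),
      c c36 * v (pair 0 3) + c c45 * v (pair 1 2),
      c c26 * v (pair 0 4) + c c35 * v (pair 1 3)] s := by
  rw [show mapY c s = ![c c26 • x 1 5 + c c35 • x 2 4, c c36 • x 2 5 + c c45 • x 3 4,
    c c12 • x 0 1 + c c46 • x 3 5, c c46 • x 0 2 + c c12 • x 4 5, c c36 • x 0 3 + c c45 • x 1 2,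
    c c26 • x 0 4 + c c35 • x 1 3] s from rfl]
  fin_cases s <;> simp [add_dotProduct, x_dotProduct]

/-! #### Evaluation of the symbolic equations -/

def Lin.eval {κ K : Type} [CommRing K] (c : κ → K) (x : ℕ → K) (l : Lin κ) : K :=
  (l.map fun u => u.1.eval c * x u.2).sum

section eval
variable {κ K : Type} [CommRing K] (c : κ → K) (x : ℕ → K)

theorem Coef.eval_neg (q : Coef κ) : q.neg.eval c = - q.eval c := by
  obtain ⟨b, l⟩ := q
  cases b <;> simp [Coef.neg, Coef.eval]

theorem Coef.eval_mul (q r : Coef κ) : (q.mul r).eval c = q.eval c * r.eval c := by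
  obtain ⟨b, l⟩ := q
  obtain ⟨b', l'⟩ := r
  cases b <;> cases b' <;> simp [Coef.mul, Coef.eval]

theorem Lin.eval_cons (u : Coef κ × ℕ) (l : Lin κ) :
    Lin.eval c x (u :: l) = u.1.eval c * x u.2 + Lin.eval c x l := by simp [Lin.eval]

theorem Lin.eval_append (l l' : Lin κ) :
    Lin.eval c x (l ++ l') = Lin.eval c x l + Lin.eval c x l' := by simp [Lin.eval]

theorem Lin.eval_neg (l : Lin κ) :
    Lin.eval c x (l.map fun u => (u.1.neg, u.2)) = - Lin.eval c x l := by
  induction l with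
  | nil => simp [Lin.eval]
  | cons u l ih => rw [List.map_cons, Lin.eval_cons, ih, Lin.eval_cons, Coef.eval_neg]; ring

theorem Lin.eval_mul (q : Coef κ) (l : Lin κ) :
    Lin.eval c x (l.map fun u => (q.mul u.1, u.2)) = q.eval c * Lin.eval c x l := by
  induction l with
  | nil => simp [Lin.eval]
  | cons u l ih => rw [List.map_cons, Lin.eval_cons, ih, Lin.eval_cons, Coef.eval_mul]; ring

theorem Lin.exists_ne_zero {l : Lin κ} (h : Lin.eval c x l ≠ 0) : ∃ u ∈ l, x u.2 ≠ 0 := by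
  by_contra! H
  refine h (List.sum_eq_zero fun y hy => ?_)
  obtain ⟨u, hu, rfl⟩ := List.mem_map.1 hy
  rw [H u hu, mul_zero]

theorem eval_contract_cons (X : ℕ → ℕ → Lin κ) (u : Coef κ × ℕ × ℕ) (φ : Bil κ) (k j : ℕ) :
    (contract X (u :: φ) k j).eval c x = u.1.eval c *
      (if u.2.1 = k then (skewLin X u.2.2 j).eval c x
        else if u.2.2 = k then - (skewLin X u.2.1 j).eval c x else 0) +
      (contract X φ k j).eval c x := by
  rw [contract, List.flatMap_cons, Lin.eval_append]
  congr 1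
  by_cases h1 : u.2.1 = k
  · rw [show Nat.beq u.2.1 k = true by simpa using h1, if_pos h1, cond_true, Lin.eval_mul]
  · rw [show Nat.beq u.2.1 k = false by rw [Bool.eq_false_iff, ne_eq, Nat.beq_eq]; exact h1, if_neg h1, cond_false]
    by_cases h2 : u.2.2 = k
    · rw [show Nat.beq u.2.2 k = true by simpa using h2, if_pos h2, cond_true, mul_neg,
        ← Lin.eval_mul, ← Lin.eval_neg, List.map_map]
      rfl
    · rw [show Nat.beq u.2.2 k = false by rw [Bool.eq_false_iff, ne_eq, Nat.beq_eq]; exact h2, if_neg h2, cond_false, mul_zero]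
      rfl

theorem eval_combine (t : ℕ → K) (l : List (Lin κ)) : (combine l).eval c t x =
    (l.zipIdx.map fun φ => t φ.2 * Lin.eval c x φ.1).sum := by
  unfold combine
  generalize l.zipIdx = l'
  induction l' with
  | nil => simp [Bil.eval]
  | cons φ l' ih =>
    rw [List.flatMap_cons, List.map_cons, List.sum_cons, ← ih]
    simp only [Bil.eval, List.map_append, List.sum_append, List.map_map]
    congr 1
    rw [Lin.eval, ← List.sum_map_mul_left]
    congr 1
    refine List.map_congr_left fun u _ => ?_
    simp only [Function.comp]
    ring

end eval

theorem eval_skewLin {κ : Type} {n : ℕ} {X : ℕ → ℕ → Lin κ} {c : κ → ℂ} {y : ℕ → ℂ}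
    {p : Pair n → ℂ} (h : ∀ q : Pair n, (X q.1.1 q.1.2).eval c y = p q) (i j : Fin n) :
    (skewLin X i j).eval c y = skew p i j := by
  unfold skewLin skew
  rcases lt_trichotomy i j with hij | rfl | hij
  · rw [show Nat.blt i j = true by rw [Nat.blt_eq]; exact hij, dif_pos hij, cond_true, h ⟨(i, j), hij⟩]
  · rw [show Nat.blt i i = false by
      rw [Bool.eq_false_iff, ne_eq, Nat.blt_eq]; exact lt_irrefl _]
    simp [Lin.eval]
  · rw [show Nat.blt j i = true by rw [Nat.blt_eq]; exact hij, dif_neg hij.not_gt, dif_pos hij,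
      show Nat.blt i j = false by rw [Bool.eq_false_iff, ne_eq, Nat.blt_eq]; exact hij.not_gt,
      cond_true, cond_false, Lin.eval_neg, h ⟨(j, i), hij⟩]

/-! #### The dichotomy -/

/-- The conclusion of `Block.exists_polynomial`. -/
def Block.Vanishes (B : Block) (t x : ℕ → ℂ) : Prop :=
  ∀ a < B.wtT.length, ∀ b < B.wtT.length, ∀ i ≤ B.deg, ∀ q ∈ B.wtX,
    (i * B.wtT.getD a 0 + (B.deg - i) * B.wtT.getD b 0 + q.2) % 7 = B.w →
      t a ^ i * t b ^ (B.deg - i) * x q.1 = 0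

/-- If certain monomials vanish, then one of the two supports lies in one weight. -/
theorem weight_dichotomy {deg : ℕ} {W : List ℕ} {wtT : List ℕ} {wtX : List (ℕ × ℕ)} {t x : ℕ → ℂ}
    (hT : ∀ a < wtT.length, wtT.getD a 0 < 7) (hX : ∀ q ∈ wtX, q.2 < 7)
    (h : ∀ a < wtT.length, ∀ b < wtT.length, ∀ i ≤ deg, ∀ q ∈ wtX,
      (i * wtT.getD a 0 + (deg - i) * wtT.getD b 0 + q.2) % 7 ∈ W →
        t a ^ i * t b ^ (deg - i) * x q.1 = 0)
    (hW : ∀ α β ξ η : Fin 7, α ≠ β → ξ ≠ η → ∃ i : Fin (deg + 1),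
      (i * α + (deg - i) * β + ξ : ℕ) % 7 ∈ W ∨ (i * α + (deg - i) * β + η : ℕ) % 7 ∈ W) :
    (∃ w, ∀ a < wtT.length, t a ≠ 0 → wtT.getD a 0 = w) ∨
      ∃ w, ∀ q ∈ wtX, x q.1 ≠ 0 → q.2 = w := by
  by_contra! H
  obtain ⟨H1, H2⟩ := H
  obtain ⟨a, ha, hta, -⟩ := H1 7
  obtain ⟨b, hb, htb, hab⟩ := H1 (wtT.getD a 0)
  obtain ⟨q, hq, hxq, -⟩ := H2 7
  obtain ⟨r, hr, hxr, hqr⟩ := H2 q.2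
  obtain ⟨⟨i, hi⟩, hiW⟩ := hW ⟨_, hT a ha⟩ ⟨_, hT b hb⟩ ⟨_, hX q hq⟩ ⟨_, hX r hr⟩
    (fun h => hab (Fin.ext_iff.1 h).symm) (fun h => hqr (Fin.ext_iff.1 h).symm)
  have key : ∀ y : ℂ, y ≠ 0 → t a ^ i * t b ^ (deg - i) * y ≠ 0 := fun y hy =>
    mul_ne_zero (mul_ne_zero (pow_ne_zero _ hta) (pow_ne_zero _ htb)) hy
  rcases hiW with hiW | hiW
  · exact key _ hxq (h a ha b hb i (by omega) q hq hiW)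
  · exact key _ hxr (h a ha b hb i (by omega) r hr hiW)

/-- A decomposable bivector all of whose coordinates have the same weight has only one. -/
theorem IsDecomposable.eq_single {n : ℕ} {p : Pair n → ℂ} (hp : IsDecomposable p)
    (f : Fin n → ZMod 7) (hf : Function.Injective f) (w : ZMod 7)
    (h : ∀ q, p q ≠ 0 → f q.1.1 + f q.1.2 = w) (hp0 : p ≠ 0) :
    ∃ q y, y ≠ 0 ∧ p = Pi.single q y := by
  have hs : ∀ i j, skew p i j ≠ 0 → f i + f j = w := by
    intro i j hij
    unfold skew at hij
    split_ifs at hij with h1 h2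
    · exact h _ hij
    · rw [add_comm]; exact h ⟨(j, i), h2⟩ (neg_ne_zero.1 hij)
    · exact absurd rfl hij
  obtain ⟨q, hq⟩ := Function.ne_iff.1 hp0
  refine ⟨q, p q, hq, funext fun r => ?_⟩
  by_cases hr : r = q
  · subst hr; simp
  rw [Pi.single_eq_of_ne hr]
  by_contra hr0
  have e1 := h q hq
  have e2 := h r hr0
  obtain ⟨⟨a, b⟩, hab⟩ := q
  obtain ⟨⟨d, e⟩, hde⟩ := r
  simp only [Pi.zero_apply] at hq e1 e2
  have hP := hp a b d e
  rw [skew_of_lt p hab, skew_of_lt p hde] at hP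
  have h1 : skew p a d * skew p b e = 0 := by
    by_contra hne
    have h2 := hs _ _ (left_ne_zero_of_mul hne)
    have h3 := hs _ _ (right_ne_zero_of_mul hne)
    have hdb : d = b := hf (by rw [← e1] at h2; exact add_left_cancel h2)
    have hea : e = a := hf (by rw [← e1, add_comm (f a)] at h3; exact add_left_cancel h3)
    subst hdb hea
    exact absurd hab hde.not_gt
  have h2 : skew p a e * skew p b d = 0 := by
    by_contra hne
    have h2 := hs _ _ (left_ne_zero_of_mul hne)
    have h3 := hs _ _ (right_ne_zero_of_mul hne)
    have hdb : e = b := hf (by rw [← e1] at h2; exact add_left_cancel h2)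
    have hea : d = a := hf (by rw [← e1, add_comm (f a)] at h3; exact add_left_cancel h3)
    subst hdb hea
    exact hr rfl
  rw [h1, h2, sub_zero, add_zero] at hP
  exact (mul_ne_zero hq hr0) hP

theorem eq_zero_of_skew {n : ℕ} {p : Pair n → ℂ} (m : Fin n) (h : ∀ i, i ≠ m → ∀ j, skew p i j = 0) :
    p = 0 := by
  funext q
  by_cases hq : q.1.1 = m
  · have := h q.1.2 (by rw [← hq]; exact q.2.ne') q.1.1
    rw [skew_swap, neg_eq_zero, skew_of_lt p q.2] at this
    exact this
  · have := h q.1.1 hq q.1.2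
    rw [skew_of_lt p q.2] at this
    exact this

theorem eq_zero_of_formsZ_move {c : Coeff → ℂ} (hc : ∀ i, c i ≠ 0) {p : Pair 7 → ℂ} (s : Fin 6)
    (h : ∀ k j, formsZ c s ⬝ᵥ move p k j = 0) : p = 0 := by
  simp only [formsZ_dotProduct] at h
  fin_cases s
  · refine eq_zero_of_skew 3 fun i hi j => ?_
    have e := h (6 - i) j
    fin_cases i <;> simp [move, pair, hc] at e hi ⊢ <;> exact e
  · refine eq_zero_of_skew 6 fun i hi j => ?_
    have e := h (5 - i) j
    fin_cases i <;> simp [move, pair, hc] at e hi ⊢ <;> exact e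
  · refine eq_zero_of_skew 2 fun i hi j => ?_
    have e := h (4 - i) j
    fin_cases i <;> simp [move, pair, hc] at e hi ⊢ <;> exact e
  · refine eq_zero_of_skew 5 fun i hi j => ?_
    have e := h (3 - i) j
    fin_cases i <;> simp [move, pair, hc] at e hi ⊢ <;> exact e
  · refine eq_zero_of_skew 1 fun i hi j => ?_
    have e := h (2 - i) j
    fin_cases i <;> simp [move, pair, hc] at e hi ⊢ <;> exact e
  · refine eq_zero_of_skew 4 fun i hi j => ?_
    have e := h (1 - i) j
    fin_cases i <;> simp [move, pair, hc] at e hi ⊢ <;> exact e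

/-- The extension by zero of a finite family. -/
def extend {n : ℕ} (t : Fin n → ℂ) (s : ℕ) : ℂ := if h : s < n then t ⟨s, h⟩ else 0

/-- The extension by zero of a vector indexed by pairs. -/
def extendPair {n : ℕ} (v : Pair n → ℂ) (a b : ℕ) : ℂ :=
  if h : a < b ∧ b < n then v ⟨(⟨a, h.1.trans h.2⟩, ⟨b, h.2⟩), h.1⟩ else 0

/-- The value of a two-form. -/
def Bil.pairing {κ : Type} {n : ℕ} (c : κ → ℂ) (φ : Bil κ) (v : Pair n → ℂ) : ℂ :=
  (φ.map fun u => u.1.eval c * extendPair v u.2.1 u.2.2).sum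

theorem eval_contract {κ : Type} {n : ℕ} {X : ℕ → ℕ → Lin κ} {c : κ → ℂ} {y : ℕ → ℂ}
    {p : Pair n → ℂ} (h : ∀ q : Pair n, (X q.1.1 q.1.2).eval c y = p q) {φ : Bil κ}
    (hφ : ∀ u ∈ φ, u.2.1 < u.2.2 ∧ u.2.2 < n) (k j : Fin n) :
    (contract X φ k j).eval c y = φ.pairing c (move p k j) := by
  induction φ with
  | nil => rfl
  | cons u φ ih =>
    rw [eval_contract_cons, ih fun w hw => hφ w (List.mem_cons_of_mem _ hw)]
    simp only [Bil.pairing, List.map_cons, List.sum_cons]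
    congr 2
    obtain ⟨h1, h2⟩ := hφ u (by simp)
    have e1 := eval_skewLin h ⟨u.2.1, h1.trans h2⟩ j
    have e2 := eval_skewLin h ⟨u.2.2, h2⟩ j
    dsimp only at e1 e2
    rw [e1, e2, extendPair, dif_pos ⟨h1, h2⟩, move]
    simp only [Fin.ext_iff]
    split_ifs with h3 h4
    · omega
    · simp
    · simp
    · simp

theorem eval_combine_contract {κ : Type} {n : ℕ} {X : ℕ → ℕ → Lin κ} {c : κ → ℂ} {y : ℕ → ℂ}
    {p : Pair n → ℂ} (h : ∀ q : Pair n, (X q.1.1 q.1.2).eval c y = p q) {Φ : List (Bil κ)}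
    (hΦ : ∀ φ ∈ Φ, ∀ u ∈ φ, u.2.1 < u.2.2 ∧ u.2.2 < n) (t : ℕ → ℂ) (k j : Fin n) :
    (combine (Φ.map (contract X · k j))).eval c t y =
      (Φ.zipIdx.map fun φ => t φ.2 * φ.1.pairing c (move p k j)).sum := by
  rw [eval_combine, List.zipIdx_map, List.map_map]
  congr 1
  refine List.map_congr_left fun φ hφ => ?_
  simp only [Function.comp, Prod.map, id]
  rw [eval_contract h (hΦ _ (List.fst_mem_of_mem_zipIdx hφ))]

/-- The coordinates `x_{i,j}` with `1 < i`, in the order of `index`. -/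
def coordsZ (p : Pair 7 → ℂ) (i : ℕ) : ℂ :=
  [p (pair 1 2), p (pair 1 3), p (pair 2 3), p (pair 1 4), p (pair 2 4), p (pair 3 4),
    p (pair 1 5), p (pair 2 5), p (pair 3 5), p (pair 4 5),
    p (pair 1 6), p (pair 2 6), p (pair 3 6), p (pair 4 6), p (pair 5 6)].getD i 0

theorem eval_upperZ {c : Coeff → ℂ} {p : Pair 7 → ℂ} (hp : ∀ s, formsZ c s ⬝ᵥ p = 0)
    (q : Pair 7) : (upperZ q.1.1 q.1.2).eval c (coordsZ p) = p q := by
  simp only [formsZ_dotProduct] at hp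
  have h0 := hp 0; have h1 := hp 1; have h2 := hp 2
  have h3 := hp 3; have h4 := hp 4; have h5 := hp 5
  simp only [Matrix.cons_val, pair] at h0 h1 h2 h3 h4 h5
  obtain ⟨⟨i, j⟩, hij⟩ := q
  fin_cases i <;> fin_cases j <;> first
    | exact absurd hij (by decide)
    | (simp [upperZ, dataZ, Lin.eval, Coef.eval, Coef.neg, index, coordsZ, pair]
       done)
    | (simp [upperZ, dataZ, Lin.eval, Coef.eval, Coef.neg, index, coordsZ, pair]
       first
        | linear_combination (-1) * h0
        | linear_combination (-1) * h1
        | linear_combination (-1) * h2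
        | linear_combination (-1) * h3
        | linear_combination (-1) * h4
        | linear_combination (-1) * h5)

theorem pairing_dataZ (c : Coeff → ℂ) (t : Fin 6 → ℂ) (v : Pair 7 → ℂ) :
    (dataZ.zipIdx.map fun φ => extend t φ.2 * φ.1.pairing c v).sum =
      ∑ s, t s * (formsZ c s ⬝ᵥ v) := by
  simp [dataZ, Bil.pairing, formsZ_dotProduct, Fin.sum_univ_six, Coef.eval, extend, extendPair, pair]
  ring

theorem eval_equationsZ {c : Coeff → ℂ} {p : Pair 7 → ℂ} (hp : ∀ s, formsZ c s ⬝ᵥ p = 0)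
    {t : Fin 6 → ℂ} (h : ∀ k j, ∑ s, t s * (formsZ c s ⬝ᵥ move p k j) = 0) :
    ∀ g ∈ equationsZ, g.eval c (extend t) (coordsZ p) = 0 := by
  intro g hg
  simp only [equationsZ, contractions, List.mem_flatMap, List.mem_map, List.mem_range] at hg
  obtain ⟨k, hk, j, hj, rfl⟩ := hg
  have e := eval_combine_contract (eval_upperZ hp) (Φ := dataZ) (by decide) (extend t)
    ⟨k, hk⟩ ⟨j, hj⟩
  rw [pairing_dataZ, h] at e
  exact e

theorem ne_zero_of_skewLin {κ : Type} {n : ℕ} {X : ℕ → ℕ → Lin κ} {c : κ → ℂ} {y : ℕ → ℂ}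
    {p : Pair n → ℂ} (h : ∀ q : Pair n, (X q.1.1 q.1.2).eval c y = p q) {wtX : List (ℕ × ℕ)}
    {m w : ℕ} (hX : ∀ q : Pair n, ∀ u ∈ X q.1.1 q.1.2, (u.2, (q.1.1 + q.1.2 + m) % 7) ∈ wtX)
    (hw : ∀ q ∈ wtX, y q.1 ≠ 0 → q.2 = w) (q : Pair n) (hq : p q ≠ 0) :
    (q.1.1 + q.1.2 + m) % 7 = w := by
  rw [← h] at hq
  obtain ⟨u, hu, hy⟩ := Lin.exists_ne_zero c y hq
  exact hw _ (hX q u hu) hy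

/-- At a decomposable vector on which the forms of `Z` vanish, they are transversal. -/
theorem transversalZ {c : Coeff → ℂ} (hc : ∀ i, c i ≠ 0) {p : Pair 7 → ℂ} (hd : IsDecomposable p)
    (hp : ∀ s, formsZ c s ⬝ᵥ p = 0) {t : Fin 6 → ℂ}
    (h : ∀ k j, ∑ s, t s * (formsZ c s ⬝ᵥ move p k j) = 0)
    (hv : blockZ1.Vanishes (extend t) (coordsZ p)) (hp0 : p ≠ 0) : t = 0 := by
  have hdich := weight_dichotomy (deg := 5) (W := [1]) (wtT := blockZ1.wtT) (wtX := blockZ1.wtX)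
    (t := extend t) (x := coordsZ p) (by decide) (by decide)
    (fun a ha b hb i hi q hq hw => hv a ha b hb i hi q hq (List.mem_singleton.1 hw)) (by decide +kernel)
  rcases hdich with ⟨w, hw⟩ | ⟨w, hw⟩
  · by_contra ht
    obtain ⟨s, hs⟩ := Function.ne_iff.1 ht
    refine hp0 (eq_zero_of_formsZ_move hc s fun k j => ?_)
    have e := h k j
    rw [Finset.sum_eq_single s] at e
    · exact (mul_eq_zero.1 e).resolve_left hs
    · intro r _ hr
      by_contra hne
      have e1 := hw s s.2 (by simpa [extend] using hs)
      have e2 := hw r r.2 (by simpa [extend] using left_ne_zero_of_mul hne)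
      have key : ∀ r s : Fin 6, blockZ1.wtT.getD r 0 = blockZ1.wtT.getD s 0 → r = s := by decide
      exact hr (key r s (e2.trans e1.symm))
    · simp
  · have hX : ∀ q : Pair 7, ∀ u ∈ upperZ q.1.1 q.1.2,
        (u.2, (q.1.1 + q.1.2 + 0 : ℕ) % 7) ∈ blockZ1.wtX := by decide +kernel
    obtain ⟨q, y, hy, rfl⟩ := hd.eq_single (fun i => ((i : ℕ) : ZMod 7)) (by decide) w (fun q hq => by
      have := ne_zero_of_skewLin (eval_upperZ hp) hX hw q hq
      rw [← this, ZMod.natCast_mod]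
      push_cast
      ring) hp0
    simp only [formsZ_dotProduct] at hp h
    obtain ⟨⟨i, j⟩, hij⟩ := q
    fin_cases i <;> fin_cases j <;> first
      | exact absurd hij (by decide)
      | (exfalso
         simp [pair, Fin.forall_fin_succ, hc, hy] at hp
         done)
      | (simp [Pi.single_apply, pair, Fin.sum_univ_six, move, skew] at h
         simp [funext_iff, Fin.forall_fin_succ, hc, hy] at h ⊢
         tauto)

/-- The coordinates on `⋀² ℂ^6`, in the order of `index`. -/
def coordsY (p : Pair 6 → ℂ) (i : ℕ) : ℂ :=
  [p (pair 0 1), p (pair 0 2), p (pair 1 2), p (pair 0 3), p (pair 1 3), p (pair 2 3),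
    p (pair 0 4), p (pair 1 4), p (pair 2 4), p (pair 3 4),
    p (pair 0 5), p (pair 1 5), p (pair 2 5), p (pair 3 5), p (pair 4 5)].getD i 0

theorem eval_upperY (c : Coeff → ℂ) (p : Pair 6 → ℂ) (q : Pair 6) :
    (upperY q.1.1 q.1.2).eval c (coordsY p) = p q := by
  obtain ⟨⟨i, j⟩, hij⟩ := q
  fin_cases i <;> fin_cases j <;> first
    | exact absurd hij (by decide)
    | (simp [upperY, Lin.eval, Coef.eval, index, coordsY, pair])

theorem pairing_dataY_getD (c : Coeff → ℂ) (v : Pair 6 → ℂ) (j : Fin 6) :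
    (dataY.getD j []).pairing c v = mapY c j ⬝ᵥ v := by
  rw [mapY_dotProduct]
  fin_cases j <;> simp [dataY, Bil.pairing, Coef.eval, extendPair, pair]

theorem eval_linearY (c : Coeff → ℂ) (p : Pair 6 → ℂ) {φ : Bil Coeff}
    (hφ : ∀ u ∈ φ, u.2.1 < u.2.2 ∧ u.2.2 < 6) :
    (linearY φ).eval c (coordsY p) = φ.pairing c p := by
  unfold linearY Lin.eval Bil.pairing
  rw [List.map_map]
  congr 1
  refine List.map_congr_left fun u hu => ?_
  obtain ⟨h1, h2⟩ := hφ u hu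
  have e := eval_upperY c p ⟨(⟨u.2.1, h1.trans h2⟩, ⟨u.2.2, h2⟩), h1⟩
  simp only [upperY, Lin.eval, List.map_cons, List.map_nil, List.sum_cons, List.sum_nil,
    Coef.eval, List.prod_nil, Bool.false_eq_true, if_false, one_mul, add_zero] at e
  simp only [Function.comp, e, extendPair, dif_pos (And.intro h1 h2)]

theorem sum_dataY {c : Coeff → ℂ} (t : Fin 6 → ℂ) (f : ℕ → ℂ) (v : Pair 6 → ℂ) :
    (dataY.zipIdx.zipIdx.map fun φ => extend t φ.2 * (φ.1.1.pairing c v + f φ.1.2)).sum =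
      ∑ s : Fin 6, t s * (mapY c s ⬝ᵥ v + f s) := by
  simp only [← pairing_dataY_getD]
  simp [dataY, Fin.sum_univ_six, extend, add_assoc]

theorem eval_equationsY {c : Coeff → ℂ} {p : Pair 6 → ℂ} {t : Fin 6 → ℂ}
    (h1 : ∀ j, ∑ i, t i * skew p i j = 0)
    (h2 : ∀ k j, ∑ s, t s * (mapY c s ⬝ᵥ move p k j + if s = k then mapY c j ⬝ᵥ p else 0) = 0) :
    ∀ g ∈ equationsY, g.eval c (extend t) (coordsY p) = 0 := by
  intro g hg
  simp only [equationsY, List.mem_append, List.mem_flatMap, List.mem_map, List.mem_range] at hg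
  rcases hg with ⟨j, hj, rfl⟩ | ⟨k, hk, j, hj, rfl⟩
  · have hs := fun i : Fin 6 => eval_skewLin (eval_upperY c p) i ⟨j, hj⟩
    have hs0 : Lin.eval c (coordsY p) (skewLin upperY 0 j) = _ := hs 0
    have hs1 : Lin.eval c (coordsY p) (skewLin upperY 1 j) = _ := hs 1
    have hs2 : Lin.eval c (coordsY p) (skewLin upperY 2 j) = _ := hs 2
    have hs3 : Lin.eval c (coordsY p) (skewLin upperY 3 j) = _ := hs 3
    have hs4 : Lin.eval c (coordsY p) (skewLin upperY 4 j) = _ := hs 4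
    have hs5 : Lin.eval c (coordsY p) (skewLin upperY 5 j) = _ := hs 5
    rw [eval_combine, ← h1 ⟨j, hj⟩, Fin.sum_univ_six]
    simp [List.range_succ, extend, hs0, hs1, hs2, hs3, hs4, hs5, add_assoc]
  · rw [eval_combine, List.zipIdx_map, List.map_map]
    have e0 := sum_dataY (c := c) t (fun s => if s = k then mapY c ⟨j, hj⟩ ⬝ᵥ p else 0)
      (move p ⟨k, hk⟩ ⟨j, hj⟩)
    refine (congrArg List.sum ?_).trans (e0.trans ?_)
    rotate_left
    · have e1 := h2 ⟨k, hk⟩ ⟨j, hj⟩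
      simp only [Fin.ext_iff] at e1
      exact e1
    · refine List.map_congr_left fun φ hφ => ?_
      have hmem : φ.1.1 ∈ dataY :=
        List.fst_mem_of_mem_zipIdx (List.fst_mem_of_mem_zipIdx hφ)
      have hlt : ∀ φ ∈ dataY, ∀ u ∈ φ, u.2.1 < u.2.2 ∧ u.2.2 < 6 := by decide
      have e := eval_contract (eval_upperY c p) (hlt _ hmem) ⟨k, hk⟩ ⟨j, hj⟩
      simp only [Function.comp, Prod.map, id, Lin.eval_append]
      dsimp only at e
      rw [e]
      congr 2
      by_cases hs : φ.1.2 = k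
      · rw [show Nat.beq φ.1.2 k = true by simpa using hs, if_pos hs, cond_true,
          eval_linearY c p (fun u hu => ?_), ← pairing_dataY_getD]
        have : ∀ j < 6, ∀ u ∈ dataY.getD j [], u.2.1 < u.2.2 ∧ u.2.2 < 6 := by decide
        exact this j hj u hu
      · rw [show Nat.beq φ.1.2 k = false by rw [Bool.eq_false_iff, ne_eq, Nat.beq_eq]; exact hs,
          if_neg hs, cond_false]
        rfl

theorem eq_zero_of_mapY_move {c : Coeff → ℂ} (hc : ∀ i, c i ≠ 0) {p : Pair 6 → ℂ} (s : Fin 6)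
    (h1 : ∀ j, skew p s j = 0)
    (h2 : ∀ k j, mapY c s ⬝ᵥ move p k j + (if s = k then mapY c j ⬝ᵥ p else 0) = 0) : p = 0 := by
  have h3 : ∀ k j, k ≠ s → mapY c s ⬝ᵥ move p k j = 0 := fun k j hk => by
    have := h2 k j
    rwa [if_neg hk.symm, add_zero] at this
  simp only [mapY_dotProduct] at h3
  fin_cases s
  · refine eq_zero_of_skew 3 fun i hi j => ?_
    have e := h1 j
    have e1 := h3 1 j (by decide); have e2 := h3 2 j (by decide); have e4 := h3 4 j (by decide)
    have e5 := h3 5 j (by decide)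
    fin_cases i <;> simp [move, pair, hc] at e1 e2 e4 e5 hi ⊢ <;> assumption
  · refine eq_zero_of_skew 0 fun i hi j => ?_
    have e := h1 j
    have e1 := h3 5 j (by decide); have e2 := h3 2 j (by decide); have e4 := h3 4 j (by decide)
    have e5 := h3 3 j (by decide)
    fin_cases i <;> simp [move, pair, hc] at e1 e2 e4 e5 hi ⊢ <;> assumption
  · refine eq_zero_of_skew 4 fun i hi j => ?_
    have e := h1 j
    have e1 := h3 5 j (by decide); have e2 := h3 0 j (by decide); have e4 := h3 1 j (by decide)
    have e5 := h3 3 j (by decide)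
    fin_cases i <;> simp [move, pair, hc] at e1 e2 e4 e5 hi ⊢ <;> assumption
  · refine eq_zero_of_skew 1 fun i hi j => ?_
    have e := h1 j
    have e1 := h3 5 j (by decide); have e2 := h3 0 j (by decide); have e4 := h3 2 j (by decide)
    have e5 := h3 4 j (by decide)
    fin_cases i <;> simp [move, pair, hc] at e1 e2 e4 e5 hi ⊢ <;> assumption
  · refine eq_zero_of_skew 5 fun i hi j => ?_
    have e := h1 j
    have e1 := h3 1 j (by decide); have e2 := h3 0 j (by decide); have e4 := h3 2 j (by decide)
    have e5 := h3 3 j (by decide)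
    fin_cases i <;> simp [move, pair, hc] at e1 e2 e4 e5 hi ⊢ <;> assumption
  · refine eq_zero_of_skew 2 fun i hi j => ?_
    have e := h1 j
    have e1 := h3 1 j (by decide); have e2 := h3 0 j (by decide); have e4 := h3 4 j (by decide)
    have e5 := h3 3 j (by decide)
    fin_cases i <;> simp [move, pair, hc] at e1 e2 e4 e5 hi ⊢ <;> assumption

/-- At a point of `Y`, the differential of the section that defines it is surjective. -/
theorem transversalY {c : Coeff → ℂ} (hc : ∀ i, c i ≠ 0) {p : Pair 6 → ℂ} (hd : IsDecomposable p)
    (hp : ∀ i j k, (mapY c i ⬝ᵥ p) * skew p j k - (mapY c j ⬝ᵥ p) * skew p i k +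
      (mapY c k ⬝ᵥ p) * skew p i j = 0) {t : Fin 6 → ℂ}
    (h1 : ∀ j, ∑ i, t i * skew p i j = 0)
    (h2 : ∀ k j, ∑ s, t s * (mapY c s ⬝ᵥ move p k j + if s = k then mapY c j ⬝ᵥ p else 0) = 0)
    (hv : blockY1.Vanishes (extend t) (coordsY p)) (hp0 : p ≠ 0) : t = 0 := by
  have hdich := weight_dichotomy (deg := 5) (W := [1]) (wtT := blockY1.wtT) (wtX := blockY1.wtX)
    (t := extend t) (x := coordsY p) (by decide) (by decide)
    (fun a ha b hb i hi q hq hw => hv a ha b hb i hi q hq (List.mem_singleton.1 hw))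
    (by decide +kernel)
  rcases hdich with ⟨w, hw⟩ | ⟨w, hw⟩
  · by_contra ht
    obtain ⟨s, hs⟩ := Function.ne_iff.1 ht
    have hr : ∀ r, r ≠ s → t r = 0 := fun r hr => by
      by_contra hne
      have e1 := hw s s.2 (by simpa [extend] using hs)
      have e2 := hw r r.2 (by simpa [extend] using hne)
      have key : ∀ r s : Fin 6, blockY1.wtT.getD r 0 = blockY1.wtT.getD s 0 → r = s := by decide
      exact hr (key r s (e2.trans e1.symm))
    refine hp0 (eq_zero_of_mapY_move hc s (fun j => ?_) fun k j => ?_)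
    · have e := h1 j
      rw [Finset.sum_eq_single s (fun r _ h => by rw [hr r h, zero_mul]) (by simp)] at e
      exact (mul_eq_zero.1 e).resolve_left hs
    · have e := h2 k j
      rw [Finset.sum_eq_single s (fun r _ h => by rw [hr r h, zero_mul]) (by simp)] at e
      exact (mul_eq_zero.1 e).resolve_left hs
  · have hX : ∀ q : Pair 6, ∀ u ∈ upperY q.1.1 q.1.2,
        (u.2, (q.1.1 + q.1.2 + 2 : ℕ) % 7) ∈ blockY1.wtX := by decide +kernel
    obtain ⟨q, y, hy, rfl⟩ := hd.eq_single (fun i => ((i : ℕ) + 1 : ZMod 7)) (by decide) w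
      (fun q hq => by
        have := ne_zero_of_skewLin (eval_upperY c p) hX hw q hq
        rw [← this, ZMod.natCast_mod]
        push_cast
        ring) hp0
    simp only [mapY_dotProduct] at hp h2
    obtain ⟨⟨i, j⟩, hij⟩ := q
    have hp := fun m => hp m i j
    fin_cases i <;> fin_cases j <;> first
      | exact absurd hij (by decide)
      | (exfalso
         simp [pair, skew, Fin.forall_fin_succ, hc, hy] at hp
         done)
      | (simp [Pi.single_apply, pair, Fin.sum_univ_six, move, skew] at h1 h2
         simp [funext_iff, Fin.forall_fin_succ, hc, hy] at h1 h2 ⊢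
         tauto)

/-- The cross product of the rows of `h`. -/
def minors (h : Fin 2 → Fin 3 → ℂ) : Fin 3 → ℂ :=
  ![h 0 1 * h 1 2 - h 0 2 * h 1 1, h 0 2 * h 1 0 - h 0 0 * h 1 2, h 0 0 * h 1 1 - h 0 1 * h 1 0]

/-- The coordinates for the surface; the one with index `5` is `y`. -/
def coordsS (p : Pair 7 → ℂ) (y : ℂ) (i : ℕ) : ℂ := if i = 5 then y else coordsZ p i

/-- The parameters of the surface. -/
def paramsS (c : Coeff → ℂ) (h : Fin 2 → Fin 3 → ℂ) : CoeffS → ℂ :=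
  Sum.elim c fun rs => h rs.1 rs.2

theorem exists_smul_minors {h : Fin 2 → Fin 3 → ℂ} (hm : ∀ i, minors h i ≠ 0) {p : Pair 7 → ℂ}
    (hp : ∀ r, formsH h r ⬝ᵥ p = 0) : ∃ y, p (pair 1 6) = y * minors h 0 ∧
      p (pair 2 5) = y * minors h 1 ∧ p (pair 3 4) = y * minors h 2 := by
  have h0 := hm 0
  have e0 := hp 0
  have e1 := hp 1
  rw [formsH_dotProduct] at e0 e1
  refine ⟨p (pair 1 6) / minors h 0, by field_simp, ?_, ?_⟩
  · rw [div_mul_eq_mul_div, eq_div_iff h0]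
    simp only [minors, Matrix.cons_val]
    linear_combination h 1 2 * e0 - h 0 2 * e1
  · rw [div_mul_eq_mul_div, eq_div_iff h0]
    simp only [minors, Matrix.cons_val]
    linear_combination -h 1 1 * e0 + h 0 1 * e1

theorem eval_upperS {c : Coeff → ℂ} {h : Fin 2 → Fin 3 → ℂ} {p : Pair 7 → ℂ} {y : ℂ}
    (hp : ∀ s, formsZ c s ⬝ᵥ p = 0) (h1 : p (pair 1 6) = y * minors h 0)
    (h2 : p (pair 2 5) = y * minors h 1) (h3 : p (pair 3 4) = y * minors h 2)
    (q : Pair 7) : (upperS q.1.1 q.1.2).eval (paramsS c h) (coordsS p y) = p q := by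
  have hZ := eval_upperZ hp q
  simp only [minors, Matrix.cons_val, pair] at h1 h2 h3
  obtain ⟨⟨i, j⟩, hij⟩ := q
  fin_cases i <;> fin_cases j <;> first
    | exact absurd hij (by decide)
    | (simp [upperS, minorLin, Lin.eval, Coef.eval, coordsS, paramsS]
       first
        | linear_combination (-1) * h1
        | linear_combination (-1) * h2
        | linear_combination (-1) * h3)
    | (rw [← hZ]
       simp [upperS, upperZ, dataZ, Lin.eval, Coef.eval, Coef.neg, Coef.map, index, coordsS,
        coordsZ, paramsS])

theorem pairing_dataS (c : Coeff → ℂ) (h : Fin 2 → Fin 3 → ℂ) (t : Fin 6 → ℂ) (u : Fin 2 → ℂ)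
    (v : Pair 7 → ℂ) :
    (dataS.zipIdx.map fun φ => extend (Fin.append t u) φ.2 *
      φ.1.pairing (paramsS c h) v).sum =
      ∑ s, t s * (formsZ c s ⬝ᵥ v) + ∑ r, u r * (formsH h r ⬝ᵥ v) := by
  have ht : ∀ s : Fin 6, extend (Fin.append t u) s = t s := fun s => by
    rw [extend, dif_pos (show (s : ℕ) < 6 + 2 by omega)]
    exact Fin.append_left t u s
  have hu : ∀ r : Fin 2, extend (Fin.append t u) (6 + r) = u r := fun r => by
    rw [extend, dif_pos (show (6 + r : ℕ) < 6 + 2 by omega)]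
    exact Fin.append_right t u r
  have t0 : extend (Fin.append t u) 0 = _ := ht 0
  have t1 : extend (Fin.append t u) 1 = _ := ht 1
  have t2 : extend (Fin.append t u) 2 = _ := ht 2
  have t3 : extend (Fin.append t u) 3 = _ := ht 3
  have t4 : extend (Fin.append t u) 4 = _ := ht 4
  have t5 : extend (Fin.append t u) 5 = _ := ht 5
  have u0 : extend (Fin.append t u) 6 = _ := hu 0
  have u1 : extend (Fin.append t u) 7 = _ := hu 1
  simp [dataS, dataZ, Bil.pairing, formsZ_dotProduct, formsH_dotProduct, Fin.sum_univ_six,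
    Coef.eval, Coef.map, extendPair, pair, paramsS, t0, t1, t2, t3, t4, t5, u0, u1]
  ring

theorem eval_equationsS {c : Coeff → ℂ} {h : Fin 2 → Fin 3 → ℂ} {p : Pair 7 → ℂ} {y : ℂ}
    (hp : ∀ s, formsZ c s ⬝ᵥ p = 0) (h1 : p (pair 1 6) = y * minors h 0)
    (h2 : p (pair 2 5) = y * minors h 1) (h3 : p (pair 3 4) = y * minors h 2)
    {t : Fin 6 → ℂ} {u : Fin 2 → ℂ} (hs : ∀ k j, ∑ s, t s * (formsZ c s ⬝ᵥ move p k j) +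
      ∑ r, u r * (formsH h r ⬝ᵥ move p k j) = 0) :
    ∀ g ∈ equationsS, g.eval (paramsS c h) (extend (Fin.append t u)) (coordsS p y) = 0 := by
  intro g hg
  simp only [equationsS, contractions, List.mem_flatMap, List.mem_map, List.mem_range] at hg
  obtain ⟨k, hk, j, hj, rfl⟩ := hg
  have e := eval_combine_contract (eval_upperS hp h1 h2 h3) (Φ := dataS) (by decide)
    (extend (Fin.append t u)) ⟨k, hk⟩ ⟨j, hj⟩
  rw [pairing_dataS, hs] at e
  exact e

/-- A combination of the two additional forms is singular only at the excluded points. -/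
theorem eq_zero_of_formsH_move {c : Coeff → ℂ} {h : Fin 2 → Fin 3 → ℂ} (hm : ∀ i, minors h i ≠ 0)
    {p : Pair 7 → ℂ} (hp : ∀ s, formsZ c s ⬝ᵥ p = 0) (hp' : ∀ r, formsH h r ⬝ᵥ p = 0)
    {u : Fin 2 → ℂ} (hs : ∀ k j, ∑ r, u r * (formsH h r ⬝ᵥ move p k j) = 0) (hp0 : p ≠ 0) :
    u = 0 := by
  set η : Fin 3 → ℂ := fun i => u 0 * h 0 i + u 1 * h 1 i with hη
  have m0 := hm 0; have m1 := hm 1; have m2 := hm 2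
  simp only [minors, Matrix.cons_val] at m0 m1 m2
  have hu : ∀ i j, h 0 i * h 1 j - h 0 j * h 1 i ≠ 0 → η i = 0 → η j = 0 → u = 0 := by
    intro i j hij hi hj
    simp only [hη] at hi hj
    have e0 : (h 0 i * h 1 j - h 0 j * h 1 i) * u 0 = 0 := by
      linear_combination h 1 j * hi - h 1 i * hj
    have e1 : (h 0 i * h 1 j - h 0 j * h 1 i) * u 1 = 0 := by
      linear_combination -h 0 j * hi + h 0 i * hj
    funext r
    fin_cases r
    · exact (mul_eq_zero.1 e0).resolve_left hij
    · exact (mul_eq_zero.1 e1).resolve_left hij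
  by_contra hu0
  have hs' : ∀ k j, η 0 * move p k j (pair 1 6) + η 1 * move p k j (pair 2 5) +
      η 2 * move p k j (pair 3 4) = 0 := fun k j => by
    have e := hs k j
    simp only [Fin.sum_univ_two, formsH_dotProduct] at e
    simp only [hη]
    linear_combination e
  have a1 : η 0 ≠ 0 → ∀ j, skew p 1 j = 0 ∧ skew p 6 j = 0 := fun h0 j => by
    have e1 := hs' 1 j; have e2 := hs' 6 j
    simp [move, pair, h0] at e1 e2
    exact ⟨e2, e1⟩
  have a2 : η 1 ≠ 0 → ∀ j, skew p 2 j = 0 ∧ skew p 5 j = 0 := fun h0 j => by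
    have e1 := hs' 2 j; have e2 := hs' 5 j
    simp [move, pair, h0] at e1 e2
    exact ⟨e2, e1⟩
  have a3 : η 2 ≠ 0 → ∀ j, skew p 3 j = 0 ∧ skew p 4 j = 0 := fun h0 j => by
    have e1 := hs' 3 j; have e2 := hs' 4 j
    simp [move, pair, h0] at e1 e2
    exact ⟨e2, e1⟩
  simp only [formsZ_dotProduct] at hp
  simp only [formsH_dotProduct] at hp'
  have f0 := hp 0; have f1 := hp 1; have f2 := hp 2; have f3 := hp 3; have f4 := hp 4
  have f5 := hp 5; have g0 := hp' 0; have g1 := hp' 1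
  simp only [Matrix.cons_val] at f0 f1 f2 f3 f4 f5
  have row : ∀ i, (∀ j, skew p i j = 0) → ∀ q : Pair 7, q.1.1 = i ∨ q.1.2 = i → p q = 0 := by
    rintro i hi q (rfl | rfl)
    · have := hi q.1.2
      rwa [skew_of_lt p q.2] at this
    · have := hi q.1.1
      rwa [skew_swap, neg_eq_zero, skew_of_lt p q.2] at this
  have mul_eq : ∀ {a b : ℂ}, a ≠ 0 → a * b = 0 → b = 0 := fun ha hab =>
    (mul_eq_zero.1 hab).resolve_left ha
  have b0 : ¬(η 1 ≠ 0 ∧ η 2 ≠ 0) := fun ⟨h1, h2⟩ => by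
    have z2 := row 2 fun j => (a2 h1 j).1
    have z5 := row 5 fun j => (a2 h1 j).2
    have z3 := row 3 fun j => (a3 h2 j).1
    have z4 := row 4 fun j => (a3 h2 j).2
    have e3 : p (pair 3 4) = 0 := z3 _ (Or.inl rfl)
    simp [z2, z3, z5, pair] at f0 f5
    have e1 : p (pair 1 6) = 0 := mul_eq m2 (by
      linear_combination h 1 1 * g0 - h 0 1 * g1 - (h 1 1 * h 0 2 - h 0 1 * h 1 2) * e3)
    refine hp0 (funext fun q => ?_)
    obtain ⟨⟨i, j⟩, hij⟩ := q
    fin_cases i <;> fin_cases j <;> first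
      | exact absurd hij (by decide)
      | exact z2 _ (Or.inl rfl)
      | exact z2 _ (Or.inr rfl)
      | exact z3 _ (Or.inl rfl)
      | exact z3 _ (Or.inr rfl)
      | exact z4 _ (Or.inl rfl)
      | exact z4 _ (Or.inr rfl)
      | exact z5 _ (Or.inl rfl)
      | exact z5 _ (Or.inr rfl)
      | assumption
  have b1 : ¬(η 0 ≠ 0 ∧ η 2 ≠ 0) := fun ⟨h1, h2⟩ => by
    have z2 := row 1 fun j => (a1 h1 j).1
    have z5 := row 6 fun j => (a1 h1 j).2
    have z3 := row 3 fun j => (a3 h2 j).1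
    have z4 := row 4 fun j => (a3 h2 j).2
    have e3 : p (pair 3 4) = 0 := z3 _ (Or.inl rfl)
    simp [z2, z3, z4, pair] at f1 f4
    have e1 : p (pair 2 5) = 0 := mul_eq m2 (by
      linear_combination -h 1 0 * g0 + h 0 0 * g1 - (h 0 0 * h 1 2 - h 1 0 * h 0 2) * e3)
    refine hp0 (funext fun q => ?_)
    obtain ⟨⟨i, j⟩, hij⟩ := q
    fin_cases i <;> fin_cases j <;> first
      | exact absurd hij (by decide)
      | exact z2 _ (Or.inl rfl)
      | exact z2 _ (Or.inr rfl)
      | exact z3 _ (Or.inl rfl)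
      | exact z3 _ (Or.inr rfl)
      | exact z4 _ (Or.inl rfl)
      | exact z4 _ (Or.inr rfl)
      | exact z5 _ (Or.inl rfl)
      | exact z5 _ (Or.inr rfl)
      | assumption
  have b2 : ¬(η 0 ≠ 0 ∧ η 1 ≠ 0) := fun ⟨h1, h2⟩ => by
    have z2 := row 1 fun j => (a1 h1 j).1
    have z5 := row 6 fun j => (a1 h1 j).2
    have z3 := row 2 fun j => (a2 h2 j).1
    have z4 := row 5 fun j => (a2 h2 j).2
    have e3 : p (pair 2 5) = 0 := z3 _ (Or.inl rfl)
    simp [z2, z4, z5, pair] at f2 f3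
    have e1 : p (pair 3 4) = 0 := mul_eq m1 (by
      linear_combination h 1 0 * g0 - h 0 0 * g1 - (h 1 0 * h 0 1 - h 0 0 * h 1 1) * e3)
    refine hp0 (funext fun q => ?_)
    obtain ⟨⟨i, j⟩, hij⟩ := q
    fin_cases i <;> fin_cases j <;> first
      | exact absurd hij (by decide)
      | exact z2 _ (Or.inl rfl)
      | exact z2 _ (Or.inr rfl)
      | exact z3 _ (Or.inl rfl)
      | exact z3 _ (Or.inr rfl)
      | exact z4 _ (Or.inl rfl)
      | exact z4 _ (Or.inr rfl)
      | exact z5 _ (Or.inl rfl)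
      | exact z5 _ (Or.inr rfl)
      | assumption
  by_cases c0 : η 0 = 0
  · by_cases c1 : η 1 = 0
    · exact hu0 (hu 0 1 m2 c0 c1)
    · exact hu0 (hu 2 0 (by rwa [mul_comm (h 0 2)] at m1 ⊢) (not_not.1 fun h => b0 ⟨c1, h⟩) c0)
  · exact hu0 (hu 1 2 m0 (not_not.1 fun h => b2 ⟨c0, h⟩) (not_not.1 fun h => b1 ⟨c0, h⟩))

/-- At a decomposable vector on which the forms of `S` vanish, they are transversal. -/
theorem transversalS {c : Coeff → ℂ} (hc : ∀ i, c i ≠ 0) {h : Fin 2 → Fin 3 → ℂ}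
    (hm : ∀ i, minors h i ≠ 0) {p : Pair 7 → ℂ} (hd : IsDecomposable p)
    (hp : ∀ s, formsZ c s ⬝ᵥ p = 0) (hp' : ∀ r, formsH h r ⬝ᵥ p = 0)
    {t : Fin 6 → ℂ} {u : Fin 2 → ℂ} (hs : ∀ k j, ∑ s, t s * (formsZ c s ⬝ᵥ move p k j) +
      ∑ r, u r * (formsH h r ⬝ᵥ move p k j) = 0)
    (hv : ∀ x : ℕ → ℂ, (∀ g ∈ equationsS, g.eval (paramsS c h) (extend (Fin.append t u)) x = 0) →
      blockS1.Vanishes (extend (Fin.append t u)) x ∧ blockS6.Vanishes (extend (Fin.append t u)) x)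
    (hp0 : p ≠ 0) : t = 0 ∧ u = 0 := by
  obtain ⟨y, h1, h2, h3⟩ := exists_smul_minors hm hp'
  obtain ⟨hv1, hv6⟩ := hv _ (eval_equationsS hp h1 h2 h3 hs)
  have ht : ∀ s : Fin 6, extend (Fin.append t u) s = t s := fun s => by
    rw [extend, dif_pos (show (s : ℕ) < 6 + 2 by omega)]
    exact Fin.append_left t u s
  have hu : ∀ r : Fin 2, extend (Fin.append t u) (6 + r) = u r := fun r => by
    rw [extend, dif_pos (show (6 + r : ℕ) < 6 + 2 by omega)]
    exact Fin.append_right t u r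
  have hdich := weight_dichotomy (deg := 4) (W := [1, 6]) (wtT := blockS1.wtT) (wtX := blockS1.wtX)
    (t := extend (Fin.append t u)) (x := coordsS p y) (by decide) (by decide)
    (fun a ha b hb i hi q hq hw => by
      rcases List.mem_cons.1 hw with hw | hw
      · exact hv1 a ha b hb i hi q hq hw
      · exact hv6 a ha b hb i hi q hq (List.mem_singleton.1 hw)) (by decide +kernel)
  rcases hdich with ⟨w, hw⟩ | ⟨w, hw⟩
  · have hts : ∀ s : Fin 6, t s ≠ 0 → w = s + 1 := fun s hs => by
      have e1 := hw s (s.2.trans (by decide)) (by rwa [ht])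
      rw [← e1]
      clear hs e1
      revert s
      decide
    have hur : ∀ r : Fin 2, u r ≠ 0 → w = 0 := fun r hr => by
      have e1 := hw (6 + r) (by have : blockS1.wtT.length = 8 := rfl
                                omega) (by rwa [hu])
      rw [← e1]
      clear hr e1
      revert r
      decide
    by_cases ht0 : t = 0
    · subst ht0
      exact ⟨rfl, eq_zero_of_formsH_move hm hp hp' (fun k j => by simpa using hs k j) hp0⟩
    · obtain ⟨s, hs0⟩ := Function.ne_iff.1 ht0
      have hw' := hts s hs0
      refine absurd (eq_zero_of_formsZ_move hc s fun k j => ?_) hp0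
      have e := hs k j
      rw [Finset.sum_eq_zero (s := Finset.univ (α := Fin 2)) fun r _ => by
          by_contra hne
          have := hur r (left_ne_zero_of_mul hne)
          omega, add_zero, Finset.sum_eq_single s (fun r _ hr => by
          by_contra hne
          have := hts r (left_ne_zero_of_mul hne)
          exact hr (Fin.ext (by omega))) (by simp)] at e
      exact (mul_eq_zero.1 e).resolve_left hs0
  · have hX : ∀ q : Pair 7, ∀ u ∈ upperS q.1.1 q.1.2,
        (u.2, (q.1.1 + q.1.2 + 0 : ℕ) % 7) ∈ blockS1.wtX := by decide +kernel
    obtain ⟨q, z, hz, rfl⟩ := hd.eq_single (fun i => ((i : ℕ) : ZMod 7)) (by decide) w (fun q hq => by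
      have := ne_zero_of_skewLin (eval_upperS hp h1 h2 h3) hX hw q hq
      rw [← this, ZMod.natCast_mod]
      push_cast
      ring) hp0
    exfalso
    have m0 := hm 0; have m1 := hm 1; have m2 := hm 2
    simp only [minors, Matrix.cons_val] at m0 m1 m2
    simp only [formsZ_dotProduct] at hp
    simp only [formsH_dotProduct] at hp'
    have g0 := hp' 0; have g1 := hp' 1
    clear hp' hs hv hv1 hv6 hd
    obtain ⟨⟨i, j⟩, hij⟩ := q
    fin_cases i <;> fin_cases j <;> first
      | exact absurd hij (by decide)
      | (simp [pair, Fin.forall_fin_succ, hc, hz] at hp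
         done)
      | (simp [pair, hz] at g0 g1
         simp [g0, g1] at m0 m1 m2)

/-! ### The Jacobian criterion -/

/-- A matrix with independent rows has a non-zero maximal minor. -/
theorem exists_submatrix_det_ne_zero {ρ ι : Type} [Fintype ρ] [DecidableEq ρ] [Fintype ι]
    (N : Matrix ρ ι ℂ) (h : ∀ τ : ρ → ℂ, (∀ v, ∑ r, τ r * N r v = 0) → τ = 0) :
    ∃ e : ρ → ι, Function.Injective e ∧ (N.submatrix id e).det ≠ 0 := by
  have hspan : Submodule.span ℂ (Set.range fun v => fun r => N r v) = ⊤ := by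
    by_contra hne
    obtain ⟨φ, hφ, hle⟩ := Submodule.exists_le_ker_of_lt_top _ (lt_top_iff_ne_top.2 hne)
    refine hφ ?_
    have hτ := h (fun r => φ (Pi.single r 1)) fun v => by
      have : φ (fun r => N r v) = 0 := hle (Submodule.subset_span ⟨v, rfl⟩)
      rw [← this, LinearMap.pi_apply_eq_sum_univ φ (fun r => N r v)]
      refine Finset.sum_congr rfl fun r _ => ?_
      rw [smul_eq_mul, mul_comm]
      congr 2
      ext s
      simp [Pi.single_apply, eq_comm]
    refine (Pi.basisFun ℂ ρ).ext fun r => ?_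
    simpa using congrFun hτ r
  obtain ⟨κ, a, ha, hspan', hli⟩ := exists_linearIndependent' ℂ fun v => fun r => N r v
  rw [hspan] at hspan'
  have : Finite κ := Finite.of_injective a ha
  have := Fintype.ofFinite κ
  let b := Module.Basis.mk hli hspan'.ge
  let eq : ρ ≃ κ := (Pi.basisFun ℂ ρ).indexEquiv b
  refine ⟨a ∘ eq, ha.comp eq.injective, ?_⟩
  have hli' : LinearIndependent ℂ (N.submatrix id (a ∘ eq)).col :=
    hli.comp eq eq.injective
  rw [Matrix.linearIndependent_cols_iff_isUnit, Matrix.isUnit_iff_isUnit_det] at hli'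
  exact hli'.ne_zero

theorem isStandardSmooth_localization_minor {ρ ι : Type} [Fintype ρ] [DecidableEq ρ] [Fintype ι]
    (f : ρ → MvPolynomial ι ℂ) {d : ℕ} (hcard : Fintype.card ι = d + Fintype.card ρ)
    (e : ρ → ι) (he : Function.Injective e)
    (g : MvPolynomial ι ℂ ⧸ Ideal.span (Set.range f))
    (hg : g = Ideal.Quotient.mk _ (Matrix.of fun i j => MvPolynomial.pderiv (e i) (f j)).det) :
    Algebra.IsStandardSmoothOfRelativeDimension d ℂ (Localization.Away g) := by
  let P : Algebra.PreSubmersivePresentation ℂ (MvPolynomial ι ℂ ⧸ Ideal.span (Set.range f)) ι ρ :=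
    .naive e he
  let Q := Algebra.PreSubmersivePresentation.localizationAway (Localization.Away g) g
  have hjac : P.jacobian = g := by
    rw [P.jacobian_eq_jacobiMatrix_det, hg]
    change Ideal.Quotient.mk _ _ = Ideal.Quotient.mk _ _
    congr 2
    ext i j
    simp [P]
  let R : Algebra.SubmersivePresentation ℂ (Localization.Away g) (Unit ⊕ ι) (Unit ⊕ ρ) :=
    { Q.comp P with
      jacobian_isUnit := by
        rw [Algebra.PreSubmersivePresentation.comp_jacobian_eq_jacobian_smul_jacobian, hjac,
          Algebra.PreSubmersivePresentation.localizationAway_jacobian, Algebra.smul_def]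
        have := IsLocalization.Away.algebraMap_isUnit (S := Localization.Away g) g
        exact this.mul this }
  refine R.isStandardSmoothOfRelativeDimension ?_
  change Nat.card _ - Nat.card _ = d
  simp [hcard]
  omega

/-- The directional derivative of a polynomial. -/
def dirDeriv {ι : Type} (v : ι → ℂ) :
    Derivation ℂ (MvPolynomial ι ℂ) (MvPolynomial ι ℂ) :=
  MvPolynomial.mkDerivation ℂ fun i => MvPolynomial.C (v i)

theorem dirDeriv_X {ι : Type} (v : ι → ℂ) (i : ι) :
    dirDeriv v (MvPolynomial.X i) = MvPolynomial.C (v i) := MvPolynomial.mkDerivation_X _ _ _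

theorem dirDeriv_eq_sum {ι : Type} [Fintype ι] (v : ι → ℂ) (p : MvPolynomial ι ℂ) :
    dirDeriv v p = ∑ i, MvPolynomial.C (v i) * MvPolynomial.pderiv i p := by
  classical
  have hs : ∀ q : MvPolynomial ι ℂ,
      (∑ i, MvPolynomial.C (σ := ι) (v i) • MvPolynomial.pderiv i : Derivation ℂ _ _) q =
        ∑ i, MvPolynomial.C (v i) * MvPolynomial.pderiv i q := fun q => by
    have := congrFun (map_sum Derivation.coeFnAddMonoidHom
      (fun i => MvPolynomial.C (σ := ι) (v i) • MvPolynomial.pderiv (R := ℂ) i) Finset.univ) q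
    rw [Finset.sum_apply] at this
    exact this
  rw [← hs]
  congr 1
  refine MvPolynomial.derivation_ext fun j => ?_
  rw [dirDeriv_X, hs, Finset.sum_eq_single j]
  · simp
  · intro i _ hi
    simp [MvPolynomial.pderiv_X_of_ne hi.symm]
  · simp

/-- At every common zero with independent gradients some maximal minor of the Jacobian matrix does
not vanish, so the minors generate the unit ideal. -/
theorem span_minors_eq_top {ρ ι : Type} [Fintype ρ] [DecidableEq ρ] [Fintype ι]
    (f : ρ → MvPolynomial ι ℂ)
    (h : ∀ x : ι → ℂ, (∀ r, MvPolynomial.eval x (f r) = 0) → ∀ τ : ρ → ℂ,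
      (∀ v : ι → ℂ, ∑ r, τ r * MvPolynomial.eval x (dirDeriv v (f r)) = 0) → τ = 0) :
    Ideal.span {g : MvPolynomial ι ℂ ⧸ Ideal.span (Set.range f) | ∃ e : ρ → ι,
      Function.Injective e ∧ g = Ideal.Quotient.mk _
        (Matrix.of fun i j => MvPolynomial.pderiv (e i) (f j)).det} = ⊤ := by
  by_contra hne
  obtain ⟨m, hm, hle⟩ := Ideal.exists_le_maximal _ hne
  have hM := Ideal.comap_isMaximal_of_surjective
    (Ideal.Quotient.mk (Ideal.span (Set.range f))) Ideal.Quotient.mk_surjective (K := m)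
  obtain ⟨x, hx⟩ := MvPolynomial.isMaximal_iff_eq_vanishingIdeal_singleton.1 hM
  have hmem : ∀ p, Ideal.Quotient.mk (Ideal.span (Set.range f)) p ∈ m →
      MvPolynomial.eval x p = 0 := fun p hp => by
    have : p ∈ Ideal.comap (Ideal.Quotient.mk (Ideal.span (Set.range f))) m := hp
    rw [hx, MvPolynomial.mem_vanishingIdeal_singleton_iff] at this
    exact this
  have hf : ∀ r, MvPolynomial.eval x (f r) = 0 := fun r => hmem _ (by
    rw [Ideal.Quotient.eq_zero_iff_mem.2 (Ideal.subset_span (Set.mem_range_self r))]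
    exact m.zero_mem)
  obtain ⟨e, he, hdet⟩ := exists_submatrix_det_ne_zero
    (Matrix.of fun r i => MvPolynomial.eval x (MvPolynomial.pderiv i (f r))) fun τ hτ =>
      h x hf τ fun v => by
        simp only [dirDeriv_eq_sum, map_sum, map_mul, MvPolynomial.eval_C, Finset.mul_sum]
        rw [Finset.sum_comm]
        refine Finset.sum_eq_zero fun i _ => ?_
        have := hτ i
        simp only [Matrix.of_apply] at this
        calc _ = v i * ∑ r, τ r * MvPolynomial.eval x (MvPolynomial.pderiv i (f r)) := by
              rw [Finset.mul_sum]; exact Finset.sum_congr rfl fun r _ => by ring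
          _ = 0 := by rw [this, mul_zero]
  refine hdet ?_
  have := hmem _ (hle (Ideal.subset_span ⟨e, he, rfl⟩))
  rw [RingHom.map_det] at this
  rw [← Matrix.det_transpose, ← this]
  rfl

/-- The Jacobian criterion for a complete intersection in affine space. -/
theorem smooth_of_independent_gradients {ρ ι : Type} [Fintype ρ] [Fintype ι]
    (f : ρ → MvPolynomial ι ℂ) {d : ℕ} (hcard : Fintype.card ι = d + Fintype.card ρ)
    (h : ∀ x : ι → ℂ, (∀ r, MvPolynomial.eval x (f r) = 0) → ∀ τ : ρ → ℂ,
      (∀ v : ι → ℂ, ∑ r, τ r * MvPolynomial.eval x (dirDeriv v (f r)) = 0) → τ = 0) :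
    AlgebraicGeometry.SmoothOfRelativeDimension d (AlgebraicGeometry.Spec.map (CommRingCat.ofHom
      (algebraMap ℂ (MvPolynomial ι ℂ ⧸ Ideal.span (Set.range f))))) := by
  classical
  rw [AlgebraicGeometry.HasRingHomProperty.Spec_iff
    (P := @AlgebraicGeometry.SmoothOfRelativeDimension d), CommRingCat.hom_ofHom]
  refine ⟨_, span_minors_eq_top f h, ?_⟩
  rintro g ⟨e, he, hg⟩
  have := isStandardSmooth_localization_minor f hcard e he g hg
  rw [← RingHom.isStandardSmoothOfRelativeDimension_algebraMap] at this
  rw [IsScalarTower.algebraMap_eq ℂ (MvPolynomial ι ℂ ⧸ Ideal.span (Set.range f))] at this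
  exact this

/-! ### Affine charts of sections of Grassmannians of planes -/

section chart
variable {n : ℕ}

/-- A quadratic Plücker relation. -/
def pluckerRelation (i j k l : Fin n) : PluckerRing n :=
  skewEntry i j * skewEntry k l - skewEntry i k * skewEntry j l + skewEntry i l * skewEntry j k

theorem skewEntry_of_lt {i j : Fin n} (h : i < j) :
    skewEntry i j = MvPolynomial.X ⟨(i, j), h⟩ := dif_pos h

theorem skewEntry_swap (i j : Fin n) : skewEntry j i = - skewEntry i j := by
  unfold skewEntry
  rcases lt_trichotomy i j with h | rfl | h
  · simp [h, h.not_gt]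
  · simp
  · simp [h, h.not_gt]

theorem skewEntry_self (i : Fin n) : skewEntry i i = 0 := by simp [skewEntry]

theorem eval_skewEntry (p : Pair n → ℂ) (i j : Fin n) :
    MvPolynomial.eval p (skewEntry i j) = skew p i j := by
  unfold skewEntry skew
  split_ifs <;> simp

theorem dirDeriv_skewEntry (v : Pair n → ℂ) (i j : Fin n) :
    dirDeriv v (skewEntry i j) = MvPolynomial.C (skew v i j) := by
  unfold skewEntry skew
  split_ifs <;> simp [dirDeriv_X]

theorem eval_linearForm (ω p : Pair n → ℂ) : MvPolynomial.eval p (linearForm ω) = ω ⬝ᵥ p := by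
  simp [linearForm, dotProduct]

theorem dirDeriv_linearForm (ω v : Pair n → ℂ) :
    dirDeriv v (linearForm ω) = MvPolynomial.C (ω ⬝ᵥ v) := by
  rw [linearForm, dotProduct, map_sum, map_sum]
  refine Finset.sum_congr rfl fun q _ => ?_
  rw [Derivation.leibniz, dirDeriv_X, MvPolynomial.derivation_C, smul_zero, add_zero, smul_eq_mul,
    MvPolynomial.C_mul]

theorem eval_pluckerRelation (p : Pair n → ℂ) (i j k l : Fin n) :
    MvPolynomial.eval p (pluckerRelation i j k l) =
      skew p i j * skew p k l - skew p i k * skew p j l + skew p i l * skew p j k := by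
  simp [pluckerRelation, eval_skewEntry]

theorem eval_dirDeriv_pluckerRelation (p v : Pair n → ℂ) (i j k l : Fin n) :
    MvPolynomial.eval p (dirDeriv v (pluckerRelation i j k l)) =
      skew p i j * skew v k l + skew p k l * skew v i j
        - (skew p i k * skew v j l + skew p j l * skew v i k)
        + (skew p i l * skew v j k + skew p j k * skew v i l) := by
  simp [pluckerRelation, eval_skewEntry, dirDeriv_skewEntry]

theorem skew_move (p : Pair n → ℂ) (m c i j : Fin n) : skew (move p m c) i j =
    (if j = m then 1 else 0) * skew p c i - (if i = m then 1 else 0) * skew p c j := by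
  rcases lt_trichotomy i j with h | rfl | h
  · rw [skew_of_lt _ h, move, skew_swap p j c, skew_swap p i c]
    split_ifs <;> ring
  · rw [skew_self]; ring
  · rw [skew_swap, skew_of_lt _ h, move, skew_swap p j c, skew_swap p i c]
    split_ifs <;> ring

theorem skew_sub_smul (v p : Pair n → ℂ) (a : ℂ) (i j : Fin n) :
    skew (v - a • p) i j = skew v i j - a * skew p i j := by
  unfold skew
  split_ifs <;> simp
  ring

theorem skew_single {q : Pair n} {i : Fin n} (h1 : i ≠ q.1.1) (h2 : i ≠ q.1.2) (j : Fin n) :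
    skew (Pi.single q 1) i j = 0 := by
  unfold skew
  split_ifs
  · exact Pi.single_eq_of_ne (fun h => h1 (congrArg (fun r : Pair n => r.1.1) h)) _
  · rw [neg_eq_zero]
    exact Pi.single_eq_of_ne (fun h => h2 (congrArg (fun r : Pair n => r.1.2) h)) _
  · rfl

/-- The tangent vectors `move p m c` and `p` annihilate the Plücker relations. -/
theorem IsDecomposable.tangent {p : Pair n → ℂ} (hp : IsDecomposable p) (m c i j k l : Fin n)
    (a : ℂ) : MvPolynomial.eval p (dirDeriv (move p m c - a • p) (pluckerRelation i j k l)) = 0 := by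
  rw [eval_dirDeriv_pluckerRelation]
  simp only [skew_sub_smul, skew_move]
  linear_combination -(if i = m then 1 else 0) * hp c j k l + (if j = m then 1 else 0) * hp c i k l
    - (if k = m then 1 else 0) * hp c i j l + (if l = m then 1 else 0) * hp c i j k
    - 2 * a * hp i j k l

/-- The pairs disjoint from `q`. -/
abbrev Complementary (q : Pair n) : Type := {r : Pair n //
  r.1.1 ≠ q.1.1 ∧ r.1.1 ≠ q.1.2 ∧ r.1.2 ≠ q.1.1 ∧ r.1.2 ≠ q.1.2}

/-- On the chart `x_q = 1` the Plücker coordinates are quadratic in those that meet `q`. -/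
theorem map_skewEntry_eq {A : Type} [CommRing A] (φ : PluckerRing n →+* A) (q : Pair n)
    (h1 : φ (MvPolynomial.X q) = 1)
    (h2 : ∀ r : Complementary q, φ (pluckerRelation q.1.1 q.1.2 r.1.1.1 r.1.1.2) = 0)
    (k l : Fin n) : φ (skewEntry k l) = φ (skewEntry q.1.1 k) * φ (skewEntry q.1.2 l) -
      φ (skewEntry q.1.1 l) * φ (skewEntry q.1.2 k) := by
  have hq : φ (skewEntry q.1.1 q.1.2) = 1 := by rw [skewEntry_of_lt q.2]; exact h1
  have hq' : φ (skewEntry q.1.2 q.1.1) = -1 := by rw [skewEntry_swap, map_neg, hq]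
  have hs (i : Fin n) : φ (skewEntry i i) = 0 := by rw [skewEntry_self, map_zero]
  have key (k l : Fin n) (hkl : k < l) : φ (skewEntry k l) = φ (skewEntry q.1.1 k) *
      φ (skewEntry q.1.2 l) - φ (skewEntry q.1.1 l) * φ (skewEntry q.1.2 k) := by
    by_cases h : k ≠ q.1.1 ∧ k ≠ q.1.2 ∧ l ≠ q.1.1 ∧ l ≠ q.1.2
    · have := h2 ⟨⟨(k, l), hkl⟩, h⟩
      simp only [pluckerRelation, map_add, map_sub, map_mul, hq] at this
      linear_combination this
    · have : k = q.1.1 ∨ k = q.1.2 ∨ l = q.1.1 ∨ l = q.1.2 := by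
        by_contra! h'
        exact h h'
      rcases this with rfl | rfl | rfl | rfl
      · rw [hs, hq']; ring
      · rw [hs, hq]; ring
      · rw [hs, hq', skewEntry_swap, map_neg]; ring
      · rw [hs, hq, skewEntry_swap, map_neg]; ring
  rcases lt_trichotomy k l with h | rfl | h
  · exact key k l h
  · rw [hs]; ring
  · rw [skewEntry_swap, map_neg, key l k h]; ring

theorem map_pluckerRelation_eq_zero {A : Type} [CommRing A] (φ : PluckerRing n →+* A) (q : Pair n)
    (h1 : φ (MvPolynomial.X q) = 1)
    (h2 : ∀ r : Complementary q, φ (pluckerRelation q.1.1 q.1.2 r.1.1.1 r.1.1.2) = 0)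
    (i j k l : Fin n) : φ (pluckerRelation i j k l) = 0 := by
  have h := map_skewEntry_eq φ q h1 h2
  simp only [pluckerRelation, map_add, map_sub, map_mul]
  rw [h i j, h k l, h i k, h j l, h i l, h j k]
  ring

variable {σ : Type}

/-- The equations on the chart `x_q = 1` of the zero scheme of `e` in the Grassmannian. -/
def chartEquations (q : Pair n) (e : σ → PluckerRing n) :
    Complementary q ⊕ Unit ⊕ σ → PluckerRing n :=
  Sum.elim (fun r => pluckerRelation q.1.1 q.1.2 r.1.1.1 r.1.1.2)
    (Sum.elim (fun _ => MvPolynomial.X q - 1) e)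

theorem span_chartEquations (q : Pair n) (e : σ → PluckerRing n) (E : Set (PluckerRing n))
    (h1 : ∀ s, e s ∈ E)
    (h2 : ∀ f ∈ E, f ∈ Ideal.span (Set.range (chartEquations q e))) :
    (pluckerIdeal n ⊔ Ideal.span E) ⊔ Ideal.span {MvPolynomial.X q - 1} =
      Ideal.span (Set.range (chartEquations q e)) := by
  have hmem (r) : chartEquations q e r ∈ Ideal.span (Set.range (chartEquations q e)) :=
    Ideal.subset_span (Set.mem_range_self r)
  have hφ (r) : Ideal.Quotient.mk (Ideal.span (Set.range (chartEquations q e)))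
      (chartEquations q e r) = 0 := Ideal.Quotient.eq_zero_iff_mem.2 (hmem r)
  apply le_antisymm
  · refine sup_le (sup_le (Ideal.span_le.2 ?_) (Ideal.span_le.2 h2)) (Ideal.span_le.2 ?_)
    · rintro f ⟨i, j, k, l, rfl⟩
      refine Ideal.Quotient.eq_zero_iff_mem.1 (map_pluckerRelation_eq_zero
        (Ideal.Quotient.mk (Ideal.span (Set.range (chartEquations q e)))) q ?_
        (fun r => hφ (Sum.inl r)) i j k l)
      have := hφ (Sum.inr (Sum.inl ()))
      rwa [show chartEquations q e (Sum.inr (Sum.inl ())) = MvPolynomial.X q - 1 from rfl, map_sub,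
        map_one, sub_eq_zero] at this
    · rintro f rfl
      exact hmem (Sum.inr (Sum.inl ()))
  · refine Ideal.span_le.2 ?_
    rintro f ⟨r | r | r, rfl⟩
    · exact Ideal.mem_sup_left (Ideal.mem_sup_left (Ideal.subset_span ⟨_, _, _, _, rfl⟩))
    · exact Ideal.mem_sup_right (Ideal.subset_span rfl)
    · exact Ideal.mem_sup_left (Ideal.mem_sup_right (Ideal.subset_span (h1 r)))

variable [Fintype σ]

/-- The Jacobian criterion on a chart: it is enough to test on the tangent vectors of the cone over
the Grassmannian. -/
theorem smooth_chart {d : ℕ} (q : Pair n) (e : σ → PluckerRing n)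
    (hcard : Fintype.card (Pair n) = d + (Fintype.card (Complementary q) + (1 + Fintype.card σ)))
    (h : ∀ p : Pair n → ℂ, p q = 1 → IsDecomposable p → (∀ s, MvPolynomial.eval p (e s) = 0) →
      ∀ t : σ → ℂ, (∀ m c, ∑ s, t s * MvPolynomial.eval p
        (dirDeriv (move p m c - move p m c q • p) (e s)) = 0) → t = 0) :
    AlgebraicGeometry.SmoothOfRelativeDimension d (AlgebraicGeometry.Spec.map (CommRingCat.ofHom
      (algebraMap ℂ (PluckerRing n ⧸ Ideal.span (Set.range (chartEquations q e)))))) := by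
  refine smooth_of_independent_gradients _ (by simp [hcard]) fun p hp τ hτ => ?_
  simp only [Fintype.sum_sum_type, Finset.univ_unique, Finset.sum_singleton] at hτ
  have hpq : p q = 1 := by
    have := hp (Sum.inr (Sum.inl ()))
    simpa [chartEquations, sub_eq_zero] using this
  have hdec : IsDecomposable p := fun i j k l => by
    rw [← eval_pluckerRelation]
    exact map_pluckerRelation_eq_zero (MvPolynomial.eval p) q (by simpa using hpq)
      (fun r => hp (Sum.inl r)) i j k l
  have hX (v : Pair n → ℂ) : MvPolynomial.eval p (dirDeriv v (MvPolynomial.X q - 1)) = v q := by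
    simp [dirDeriv_X]
  have ht : (fun s => τ (Sum.inr (Sum.inr s))) = 0 :=
    h p hpq hdec (fun s => hp (Sum.inr (Sum.inr s))) _ fun m c => by
      have := hτ (move p m c - move p m c q • p)
      simp only [chartEquations, Sum.elim_inl, Sum.elim_inr, hdec.tangent, hX, mul_zero,
        Finset.sum_const_zero, zero_add] at this
      simpa [hpq] using this
  have hr (r : Complementary q) : τ (Sum.inl r) = 0 := by
    have := hτ (Pi.single r.1 1)
    have ha := skew_single r.2.1.symm r.2.2.2.1.symm
    have hb := skew_single r.2.2.1.symm r.2.2.2.2.symm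
    have hrq : q ≠ r.1 := fun h => r.2.1 (congrArg (fun r : Pair n => r.1.1) h.symm)
    simp only [chartEquations, Sum.elim_inl, Sum.elim_inr, eval_dirDeriv_pluckerRelation, ha, hb,
      hX, skew_of_lt p q.2, Prod.mk.eta, Subtype.coe_eta, hpq, Pi.single_eq_of_ne hrq,
      fun s => congrFun ht s, Pi.zero_apply, zero_mul, mul_zero, Finset.sum_const_zero, add_zero,
      sub_zero, one_mul] at this
    rw [Finset.sum_eq_single r] at this
    · rw [skew_of_lt _ r.1.2] at this
      simpa using this
    · intro r' _ hr'
      rw [skew_of_lt _ r'.1.2]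
      exact mul_eq_zero_of_right _ (Pi.single_eq_of_ne (fun h => hr' (Subtype.ext h)) _)
    · simp
  have h0 : τ (Sum.inr (Sum.inl ())) = 0 := by
    have := hτ (Pi.single q 1)
    simpa [hr, fun s => congrFun ht s, chartEquations, dirDeriv_X] using this
  funext r
  rcases r with r | r | r
  · exact hr r
  · exact h0
  · exact congrFun ht r

end chart

/-! ### Smoothness of linear sections -/

section linear
variable {n : ℕ} {σ : Type}

/-- The linear form attached to a two-form depends linearly on it. -/
def linearFormHom (n : ℕ) : (Pair n → ℂ) →ₗ[ℂ] PluckerRing n where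
  toFun := linearForm
  map_add' ω ω' := by simp [linearForm, add_mul, Finset.sum_add_distrib]
  map_smul' a ω := by simp [linearForm, MvPolynomial.smul_eq_C_mul, Finset.mul_sum, mul_assoc]

theorem eval_eq_zero_of_mem_sup {p : Pair n → ℂ} (hp : IsDecomposable p)
    {E : Set (PluckerRing n)} (hE : ∀ f ∈ E, MvPolynomial.eval p f = 0) :
    ∀ f ∈ pluckerIdeal n ⊔ Ideal.span E, MvPolynomial.eval p f = 0 := by
  have : pluckerIdeal n ⊔ Ideal.span E ≤ RingHom.ker (MvPolynomial.eval p) := by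
    refine sup_le (Ideal.span_le.2 ?_) (Ideal.span_le.2 hE)
    rintro f ⟨i, j, k, l, rfl⟩
    exact (eval_pluckerRelation p i j k l).trans (hp i j k l)
  exact this

theorem isSmoothProjective_linearSection [Fintype σ] (ω : σ → Pair n → ℂ) {d : ℕ}
    (hcard : ∀ q : Pair n, Fintype.card (Pair n) =
      d + (Fintype.card (Complementary q) + (1 + Fintype.card σ)))
    (hne : ∃ p : Pair n → ℂ, p ≠ 0 ∧ IsDecomposable p ∧ ∀ s, ω s ⬝ᵥ p = 0)
    (h : ∀ p : Pair n → ℂ, p ≠ 0 → IsDecomposable p → (∀ s, ω s ⬝ᵥ p = 0) →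
      ∀ t : σ → ℂ, (∀ m c, ∑ s, t s * (ω s ⬝ᵥ move p m c) = 0) → t = 0) :
    IsSmoothProjective d (linearSectionIdeal (Submodule.span ℂ (Set.range ω))) := by
  constructor
  · obtain ⟨p, hp0, hp, hω⟩ := hne
    refine ⟨p, hp0, eval_eq_zero_of_mem_sup hp ?_⟩
    rintro f ⟨η, hη, rfl⟩
    rw [eval_linearForm]
    induction hη using Submodule.span_induction with
    | mem η hη => obtain ⟨s, rfl⟩ := hη; exact hω s
    | zero => exact zero_dotProduct p
    | add η η' _ _ h1 h2 => rw [add_dotProduct, h1, h2, add_zero]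
    | smul a η _ h1 => rw [smul_dotProduct, h1, smul_zero]
  · intro q
    rw [linearSectionIdeal, span_chartEquations q (fun s => linearForm (ω s))]
    · refine smooth_chart q _ (hcard q) fun p hpq hp hω t ht => ?_
      simp only [eval_linearForm] at hω
      refine h p (fun h0 => by simp [h0] at hpq) hp hω t fun m c => ?_
      simpa [dirDeriv_linearForm, dotProduct_sub, hω] using ht m c
    · exact fun s => ⟨ω s, Submodule.subset_span (Set.mem_range_self s), rfl⟩
    · rintro f ⟨η, hη, rfl⟩
      have : Submodule.span ℂ (Set.range ω) ≤
          ((Ideal.span (Set.range (chartEquations q fun s => linearForm (ω s)))).restrictScalars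
            ℂ).comap (linearFormHom n) := by
        refine Submodule.span_le.2 ?_
        rintro _ ⟨s, rfl⟩
        exact Ideal.subset_span ⟨Sum.inr (Sum.inr s), rfl⟩
      exact this hη

end linear

theorem card_complementary7 : ∀ q : Pair 7, Fintype.card (Complementary q) = 10 := by decide +kernel

theorem card_complementary6 : ∀ q : Pair 6, Fintype.card (Complementary q) = 6 := by decide +kernel

theorem isDecomposable_single {n : ℕ} (q : Pair n) : IsDecomposable (Pi.single q (1 : ℂ)) := by
  intro i j k l
  by_cases h1 : i = q.1.1 ∨ i = q.1.2
  · by_cases h2 : j = q.1.1 ∨ j = q.1.2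
    · by_cases h3 : k = q.1.1 ∨ k = q.1.2
      · have : i = j ∨ i = k ∨ j = k := by
          rcases h1 with rfl | rfl <;> rcases h2 with rfl | rfl <;> rcases h3 with rfl | rfl <;> simp
        rcases this with rfl | rfl | rfl <;> simp only [skew_self]
        · ring
        · rw [skew_swap _ i j]; ring
        · ring
      · rw [not_or] at h3
        simp [skew_single h3.1 h3.2, skew_swap _ k]
    · rw [not_or] at h2
      simp [skew_single h2.1 h2.2, skew_swap _ j]
  · rw [not_or] at h1
    simp [skew_single h1.1 h1.2]

theorem isSmoothProjective_systemZ {c : Coeff → ℂ} (hc : ∀ i, c i ≠ 0)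
    (hv : ∀ t x : ℕ → ℂ, (∀ g ∈ equationsZ, g.eval c t x = 0) → blockZ1.Vanishes t x) :
    IsSmoothProjective 4 (linearSectionIdeal (systemZ c)) := by
  refine isSmoothProjective_linearSection _ (fun q => by rw [card_complementary7]; rfl)
    ⟨Pi.single (pair 1 6) 1, ?_, isDecomposable_single _, fun s => ?_⟩
    fun p hp0 hd hp t ht => transversalZ hc hd hp ht (hv _ _ (eval_equationsZ hp ht)) hp0
  · simp
  · rw [formsZ_dotProduct]
    fin_cases s <;> simp [pair]

/-! ### Smoothness of the fourfold in `Gr(2, 6)` -/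

/-- A coordinate of `λ(p) ∧ p`. -/
def quotientEquation {n : ℕ} (lam : Matrix (Fin n) (Pair n) ℂ) (i j k : Fin n) : PluckerRing n :=
  linearForm (lam i) * skewEntry j k - linearForm (lam j) * skewEntry i k
    + linearForm (lam k) * skewEntry i j

section quotient
variable {n : ℕ}

/-- The indices outside `q`. -/
abbrev Outside (q : Pair n) : Type := {k : Fin n // k ≠ q.1.1 ∧ k ≠ q.1.2}

theorem map_quotientEquation_eq_zero {A : Type} [CommRing A] (φ : PluckerRing n →+* A)
    (lam : Matrix (Fin n) (Pair n) ℂ) (q : Pair n)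
    (h1 : φ (MvPolynomial.X q) = 1)
    (h2 : ∀ r : Complementary q, φ (pluckerRelation q.1.1 q.1.2 r.1.1.1 r.1.1.2) = 0)
    (h3 : ∀ k : Outside q, φ (quotientEquation lam q.1.1 q.1.2 k) = 0) (i j k : Fin n) :
    φ (quotientEquation lam i j k) = 0 := by
  have hq : φ (skewEntry q.1.1 q.1.2) = 1 := by rw [skewEntry_of_lt q.2]; exact h1
  have hq' : φ (skewEntry q.1.2 q.1.1) = -1 := by rw [skewEntry_swap, map_neg, hq]
  have hs (i : Fin n) : φ (skewEntry i i) = 0 := by rw [skewEntry_self, map_zero]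
  have hL (k : Fin n) : φ (linearForm (lam k)) =
      φ (linearForm (lam q.1.2)) * φ (skewEntry q.1.1 k) -
        φ (linearForm (lam q.1.1)) * φ (skewEntry q.1.2 k) := by
    by_cases ha : k = q.1.1
    · rw [ha, hs, hq']; ring
    by_cases hb : k = q.1.2
    · rw [hb, hs, hq]; ring
    have := h3 ⟨k, ha, hb⟩
    simp only [quotientEquation, map_add, map_sub, map_mul, hq] at this
    linear_combination this
  have h := map_skewEntry_eq φ q h1 h2
  simp only [quotientEquation, map_add, map_sub, map_mul]
  rw [hL i, hL j, hL k, h i j, h i k, h j k]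
  ring

theorem isSmoothProjective_quotientSection (lam : Matrix (Fin n) (Pair n) ℂ) {d : ℕ}
    (hcard : ∀ q : Pair n, Fintype.card (Pair n) =
      d + (Fintype.card (Complementary q) + (1 + Fintype.card (Outside q))))
    (hne : ∃ p : Pair n → ℂ, p ≠ 0 ∧ IsDecomposable p ∧ ∀ i j k,
      (lam i ⬝ᵥ p) * skew p j k - (lam j ⬝ᵥ p) * skew p i k + (lam k ⬝ᵥ p) * skew p i j = 0)
    (h : ∀ p : Pair n → ℂ, p ≠ 0 → IsDecomposable p →
      (∀ i j k, (lam i ⬝ᵥ p) * skew p j k - (lam j ⬝ᵥ p) * skew p i k +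
        (lam k ⬝ᵥ p) * skew p i j = 0) →
      ∀ t : Fin n → ℂ, (∀ j, ∑ i, t i * skew p i j = 0) →
        (∀ m c, ∑ s, t s * (lam s ⬝ᵥ move p m c + if s = m then lam c ⬝ᵥ p else 0) = 0) → t = 0) :
    IsSmoothProjective d (quotientSectionIdeal lam) := by
  have hev (p : Pair n → ℂ) (i j k) : MvPolynomial.eval p (quotientEquation lam i j k) =
      (lam i ⬝ᵥ p) * skew p j k - (lam j ⬝ᵥ p) * skew p i k + (lam k ⬝ᵥ p) * skew p i j := by
    simp [quotientEquation, eval_linearForm, eval_skewEntry]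
  have hdv (p v : Pair n → ℂ) (i j k) :
      MvPolynomial.eval p (dirDeriv v (quotientEquation lam i j k)) =
      (lam i ⬝ᵥ p) * skew v j k - (lam j ⬝ᵥ p) * skew v i k + (lam k ⬝ᵥ p) * skew v i j +
      ((lam i ⬝ᵥ v) * skew p j k - (lam j ⬝ᵥ v) * skew p i k + (lam k ⬝ᵥ v) * skew p i j) := by
    simp [quotientEquation, eval_linearForm, eval_skewEntry, dirDeriv_linearForm,
      dirDeriv_skewEntry]
    ring
  constructor
  · obtain ⟨p, hp0, hp, hlam⟩ := hne
    refine ⟨p, hp0, eval_eq_zero_of_mem_sup hp ?_⟩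
    rintro f ⟨i, j, k, rfl⟩
    exact (hev p i j k).trans (hlam i j k)
  · intro q
    rw [quotientSectionIdeal,
      span_chartEquations q (fun k : Outside q => quotientEquation lam q.1.1 q.1.2 k)]
    · refine smooth_chart q _ (hcard q) fun p hpq hp hlam t ht => ?_
      have hT : ∀ i j k, (lam i ⬝ᵥ p) * skew p j k - (lam j ⬝ᵥ p) * skew p i k +
          (lam k ⬝ᵥ p) * skew p i j = 0 := fun i j k => by
        rw [← hev]
        exact map_quotientEquation_eq_zero (MvPolynomial.eval p) lam q (by simpa using hpq)
          (fun r => (eval_pluckerRelation _ _ _ _ _).trans (hp _ _ _ _)) hlam i j k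
      have hab : skew p q.1.1 q.1.2 = 1 := (skew_of_lt p q.2).trans hpq
      let φ (k i : Fin n) : ℂ := (if k = i then 1 else 0) +
        ((if q.1.1 = i then 1 else 0) * skew p q.1.2 k -
          (if q.1.2 = i then 1 else 0) * skew p q.1.1 k)
      have hφ (k : Fin n) (y : Fin n → ℂ) :
          ∑ i, φ k i * y i = y k + (skew p q.1.2 k * y q.1.1 - skew p q.1.1 k * y q.1.2) := by
        simp only [φ, add_mul, sub_mul, Finset.sum_add_distrib, Finset.sum_sub_distrib, ite_mul,
          one_mul, zero_mul, Finset.sum_ite_eq, Finset.mem_univ, if_true]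
      have hsum (y : Fin n → ℂ) : ∑ i, (∑ k : Outside q, t k * φ k i) * y i =
          ∑ k : Outside q, t k *
            (y k + (skew p q.1.2 k * y q.1.1 - skew p q.1.1 k * y q.1.2)) := by
        simp only [Finset.sum_mul]
        rw [Finset.sum_comm]
        refine Finset.sum_congr rfl fun k _ => ?_
        rw [← hφ, Finset.mul_sum]
        exact Finset.sum_congr rfl fun i _ => by ring
      have hψ := h p (fun h0 => by simp [h0] at hpq) hp hT (fun i => ∑ k : Outside q, t k * φ k i)
        (fun j => by
          rw [hsum]
          refine Finset.sum_eq_zero fun k _ => ?_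
          refine mul_eq_zero_of_right _ ?_
          linear_combination hp q.1.1 q.1.2 k j - skew p k j * hab) fun m c => by
          rw [hsum]
          refine Eq.trans ?_ (ht m c)
          refine Finset.sum_congr rfl fun k _ => ?_
          congr 1
          rw [hdv]
          simp only [skew_sub_smul, skew_move, dotProduct_sub, dotProduct_smul, smul_eq_mul]
          have hite (P : Prop) [Decidable P] (y : ℂ) :
              (if P then y else 0) = (if P then 1 else 0) * y := by simp
          rw [hite ((k : Fin n) = m), hite (q.1.1 = m), hite (q.1.2 = m), skew_swap p q.1.1 c,
            skew_swap p q.1.2 c]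
          generalize ((if (k : Fin n) = m then 1 else 0 : ℂ)) = δk
          generalize ((if q.1.1 = m then 1 else 0 : ℂ)) = δa
          generalize ((if q.1.2 = m then 1 else 0 : ℂ)) = δb
          linear_combination δk * (hT q.1.1 q.1.2 c - (lam c ⬝ᵥ p) * hab) - δa * hT q.1.2 c k
            + δb * hT q.1.1 c k - (lam k ⬝ᵥ move p m c) * hab
            + 2 * move p m c q * hT q.1.1 q.1.2 k
      funext k
      have := congrFun hψ k
      simp only [φ, Pi.zero_apply] at this
      rw [Finset.sum_eq_single k] at this
      · simpa [k.2.1.symm, k.2.2.symm] using this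
      · intro r _ hr
        simp [k.2.1.symm, k.2.2.symm, Subtype.coe_injective.ne hr]
      · simp
    · exact fun k => ⟨_, _, _, rfl⟩
    · rintro f ⟨i, j, k, rfl⟩
      have hφ (r) : Ideal.Quotient.mk (Ideal.span (Set.range (chartEquations q
          fun k : Outside q => quotientEquation lam q.1.1 q.1.2 k)))
          (chartEquations q (fun k : Outside q => quotientEquation lam q.1.1 q.1.2 k) r) = 0 :=
        Ideal.Quotient.eq_zero_iff_mem.2 (Ideal.subset_span (Set.mem_range_self r))
      refine Ideal.Quotient.eq_zero_iff_mem.1 (map_quotientEquation_eq_zero _ lam q ?_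
        (fun r => hφ (Sum.inl r)) (fun r => hφ (Sum.inr (Sum.inr r))) i j k)
      have := hφ (Sum.inr (Sum.inl ()))
      rwa [show chartEquations q (fun k : Outside q => quotientEquation lam q.1.1 q.1.2 k)
        (Sum.inr (Sum.inl ())) = MvPolynomial.X q - 1 from rfl, map_sub,
        map_one, sub_eq_zero] at this

end quotient

theorem isSmoothProjective_mapY {c : Coeff → ℂ} (hc : ∀ i, c i ≠ 0)
    (hv : ∀ t x : ℕ → ℂ, (∀ g ∈ equationsY, g.eval c t x = 0) → blockY1.Vanishes t x) :
    IsSmoothProjective 4 (quotientSectionIdeal (mapY c)) := by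
  refine isSmoothProjective_quotientSection _ (fun q => ?_)
    ⟨Pi.single (pair 0 5) 1, ?_, isDecomposable_single _, fun i j k => ?_⟩
    fun p hp0 hd hp t h1 h2 => transversalY hc hd hp h1 h2 (hv _ _ (eval_equationsY h1 h2)) hp0
  · rw [card_complementary6]
    revert q
    decide +kernel
  · simp
  · have : ∀ s, mapY c s ⬝ᵥ Pi.single (pair 0 5) 1 = 0 := fun s => by
      rw [mapY_dotProduct]
      fin_cases s <;> simp [pair]
    simp [this]

/-! ### Smoothness of the surface -/

/-- The Plücker vector of the row space of a `2 × n` matrix. -/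
def planeVector {n : ℕ} (z : Fin n → ℂ × ℂ) (q : Pair n) : ℂ :=
  (z q.1.1).1 * (z q.1.2).2 - (z q.1.2).1 * (z q.1.1).2

theorem isDecomposable_planeVector {n : ℕ} (z : Fin n → ℂ × ℂ) : IsDecomposable (planeVector z) := by
  have h (i j : Fin n) : skew (planeVector z) i j = (z i).1 * (z j).2 - (z j).1 * (z i).2 := by
    unfold skew planeVector
    split_ifs with h1 h2
    · rfl
    · ring
    · rw [le_antisymm (not_lt.1 h2) (not_lt.1 h1)]; ring
  intro i j k l
  simp only [h]
  ring

theorem exists_mem_surface {c : Coeff → ℂ} (hc : c c36 ≠ 0) (h : Fin 2 → Fin 3 → ℂ) :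
    ∃ p : Pair 7 → ℂ, p ≠ 0 ∧ IsDecomposable p ∧ (∀ s, formsZ c s ⬝ᵥ p = 0) ∧
      ∀ r, formsH h r ⬝ᵥ p = 0 := by
  obtain ⟨b, hb⟩ := exists_quadratic_eq_zero (b := - c c46) (c := - c c12) hc
    (IsAlgClosed.exists_eq_mul_self _)
  refine ⟨planeVector ![(- (c c36 * b), - c c26), (1, 0), (0, 1), (0, - b), (0, b), (0, -1), (-1, 0)],
    fun h0 => ?_, isDecomposable_planeVector _, fun s => ?_, fun r => ?_⟩
  · have := congrFun h0 (pair 1 2)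
    simp [planeVector, pair] at this
  · rw [formsZ_dotProduct]
    fin_cases s <;> simp [planeVector, pair] <;> first | linear_combination hb | linear_combination -hb
  · simp [formsH_dotProduct, planeVector, pair]

theorem systemS_eq (c : Coeff → ℂ) (h : Fin 2 → Fin 3 → ℂ) :
    systemS c h = Submodule.span ℂ (Set.range (Sum.elim (formsZ c) (formsH h))) := by
  rw [Set.Sum.elim_range, Submodule.span_union]
  rfl

theorem isSmoothProjective_systemS {c : Coeff → ℂ} (hc : ∀ i, c i ≠ 0) {h : Fin 2 → Fin 3 → ℂ}
    (hm : ∀ i, minors h i ≠ 0) (hv : ∀ t x : ℕ → ℂ,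
      (∀ g ∈ equationsS, g.eval (paramsS c h) t x = 0) →
        blockS1.Vanishes t x ∧ blockS6.Vanishes t x) :
    IsSmoothProjective 2 (linearSectionIdeal (systemS c h)) := by
  rw [systemS_eq]
  refine isSmoothProjective_linearSection _ (fun q => by rw [card_complementary7]; rfl) ?_
    fun p hp0 hd hp t ht => ?_
  · obtain ⟨p, h0, h1, h2, h3⟩ := exists_mem_surface (hc c36) h
    exact ⟨p, h0, h1, fun s => by rcases s with s | s; exacts [h2 s, h3 s]⟩
  · obtain ⟨h1, h2⟩ := transversalS hc hm hd (fun s => hp (Sum.inl s)) (fun r => hp (Sum.inr r))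
      (t := fun s => t (Sum.inl s)) (u := fun r => t (Sum.inr r))
      (fun k j => by simpa [Fintype.sum_sum_type] using ht k j) (fun x => hv _ x) hp0
    funext s
    rcases s with s | s
    exacts [congrFun h1 s, congrFun h2 s]

/-! ### General members -/

instance : Fintype Coeff where
  elems := ⟨↑[c12, c26, c35, c36, c45, c46], by simp⟩
  complete := fun i => by cases i <;> simp

theorem eval_map_ne_zero {κ : Type} {c : κ → ℂ} {F : MvPolynomial κ ℤ}
    (h : MvPolynomial.eval c (MvPolynomial.map (Int.castRingHom ℂ) F) ≠ 0) :
    MvPolynomial.aeval c F ≠ 0 := by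
  rwa [MvPolynomial.eval_map] at h

theorem map_ne_zero {κ : Type} {F : MvPolynomial κ ℤ} (h : F ≠ 0) :
    MvPolynomial.map (Int.castRingHom ℂ) F ≠ 0 := fun h0 =>
  h (MvPolynomial.map_injective (Int.castRingHom ℂ) Int.cast_injective (by rw [h0, map_zero]))

theorem general_fourfolds_smooth : ∃ F : MvPolynomial Coeff ℂ, F ≠ 0 ∧
    ∀ c : Coeff → ℂ, MvPolynomial.eval c F ≠ 0 →
      IsSmoothProjective 4 (linearSectionIdeal (systemZ c)) ∧
      IsSmoothProjective 4 (quotientSectionIdeal (mapY c)) := by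
  obtain ⟨F, hF, hF'⟩ := Block.exists_polynomial _ blockZ1_check (by decide) (by decide) (by decide)
  obtain ⟨F', hY, hY'⟩ := Block.exists_polynomial _ blockY1_check (by decide) (by decide) (by decide)
  refine ⟨MvPolynomial.map (Int.castRingHom ℂ) F * MvPolynomial.map (Int.castRingHom ℂ) F' *
    ∏ i, MvPolynomial.X i, mul_ne_zero (mul_ne_zero (map_ne_zero hF) (map_ne_zero hY))
      (Finset.prod_ne_zero_iff.2 fun i _ => MvPolynomial.X_ne_zero i), fun c hc => ?_⟩
  rw [map_mul, map_mul, mul_ne_zero_iff, mul_ne_zero_iff, map_prod, Finset.prod_ne_zero_iff] at hc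
  simp only [MvPolynomial.eval_X] at hc
  obtain ⟨⟨h1, h2⟩, h3⟩ := hc
  have hc' : ∀ i, c i ≠ 0 := fun i => h3 i (Finset.mem_univ i)
  exact ⟨isSmoothProjective_systemZ hc' (hF' c (eval_map_ne_zero h1)),
    isSmoothProjective_mapY hc' (hY' c (eval_map_ne_zero h2))⟩

theorem general_surface_smooth : ∃ G : MvPolynomial (Coeff ⊕ Fin 2 × Fin 3) ℂ, G ≠ 0 ∧
    ∀ (c : Coeff → ℂ) (h : Fin 2 → Fin 3 → ℂ),
      MvPolynomial.eval (Sum.elim c fun rs => h rs.1 rs.2) G ≠ 0 →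
        IsSmoothProjective 2 (linearSectionIdeal (systemS c h)) := by
  obtain ⟨F, hF, hF'⟩ := Block.exists_polynomial _ blockS1_check (by decide) (by decide) (by decide)
  obtain ⟨F', hS, hS'⟩ := Block.exists_polynomial _ blockS6_check (by decide) (by decide) (by decide)
  let Y (r : Fin 2) (s : Fin 3) : MvPolynomial (Coeff ⊕ Fin 2 × Fin 3) ℂ :=
    MvPolynomial.X (Sum.inr (r, s))
  let D : Fin 3 → MvPolynomial (Coeff ⊕ Fin 2 × Fin 3) ℂ :=
    ![Y 0 1 * Y 1 2 - Y 0 2 * Y 1 1, Y 0 2 * Y 1 0 - Y 0 0 * Y 1 2, Y 0 0 * Y 1 1 - Y 0 1 * Y 1 0]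
  have hD (c : Coeff → ℂ) (h : Fin 2 → Fin 3 → ℂ) (i : Fin 3) :
      MvPolynomial.eval (Sum.elim c fun rs => h rs.1 rs.2) (D i) = minors h i := by
    fin_cases i <;> simp [D, Y, minors]
  have hD0 (i : Fin 3) : D i ≠ 0 := fun h0 => by
    have := hD 0 ![![1, 1, 1], ![0, 1, 3]] i
    rw [h0, map_zero] at this
    revert this
    fin_cases i <;> simp [minors] <;> norm_num
  refine ⟨MvPolynomial.map (Int.castRingHom ℂ) F * MvPolynomial.map (Int.castRingHom ℂ) F' *
    ((∏ i, MvPolynomial.X (Sum.inl i)) * ∏ i, D i),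
    mul_ne_zero (mul_ne_zero (map_ne_zero hF) (map_ne_zero hS)) (mul_ne_zero
      (Finset.prod_ne_zero_iff.2 fun i _ => MvPolynomial.X_ne_zero _)
      (Finset.prod_ne_zero_iff.2 fun i _ => hD0 i)), fun c h hc => ?_⟩
  rw [map_mul, map_mul, map_mul, mul_ne_zero_iff, mul_ne_zero_iff, mul_ne_zero_iff, map_prod,
    map_prod, Finset.prod_ne_zero_iff, Finset.prod_ne_zero_iff] at hc
  simp only [MvPolynomial.eval_X, hD, Sum.elim_inl] at hc
  obtain ⟨⟨h1, h2⟩, h3, h4⟩ := hc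
  exact isSmoothProjective_systemS (fun i => h3 i (Finset.mem_univ i))
    (fun i => h4 i (Finset.mem_univ i)) fun t x hx =>
      ⟨hF' _ (eval_map_ne_zero h1) t x hx, hS' _ (eval_map_ne_zero h2) t x hx⟩

/-! ### The invariant families -/

theorem pow_eq_pow_iff_of_isPrimitiveRoot {ε : ℂ} (hε : IsPrimitiveRoot ε 7) (a b : ℕ) :
    ε ^ a = ε ^ b ↔ a % 7 = b % 7 := by
  have h (a : ℕ) : ε ^ a = ε ^ (a % 7) := by
    conv_lhs => rw [← Nat.div_add_mod a 7, pow_add, pow_mul, hε.pow_eq_one, one_pow, one_mul]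
  rw [h a, h b]
  exact ⟨hε.pow_inj (Nat.mod_lt _ (by norm_num)) (Nat.mod_lt _ (by norm_num)), fun h => by rw [h]⟩

/-- The weight of a Plücker coordinate on `Gr(2, 7)` with respect to the cyclic group. -/
def weight (q : Pair 7) : ℕ := (q.1.1 + q.1.2 : ℕ) % 7

/-- The projection to the two-forms of weight `k`. -/
def weightProj (k : ℕ) : (Pair 7 → ℂ) →ₗ[ℂ] (Pair 7 → ℂ) where
  toFun ω q := if weight q = k then ω q else 0
  map_add' ω ω' := by ext q; by_cases h : weight q = k <;> simp [h]
  map_smul' a ω := by ext q; by_cases h : weight q = k <;> simp [h]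

theorem weightProj_apply (k : ℕ) (ω : Pair 7 → ℂ) (q : Pair 7) :
    weightProj k ω q = if weight q = k then ω q else 0 := rfl

theorem weightProj_eq_self {k : ℕ} {ω : Pair 7 → ℂ} :
    weightProj k ω = ω ↔ ∀ q, weight q ≠ k → ω q = 0 := by
  constructor
  · intro h q hq
    rw [← h, weightProj_apply, if_neg hq]
  · intro h
    funext q
    rw [weightProj_apply]
    split_ifs with hq
    exacts [rfl, (h q hq).symm]

theorem weightProj_idem (k : ℕ) (ω : Pair 7 → ℂ) : weightProj k (weightProj k ω) = weightProj k ω :=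
  weightProj_eq_self.2 fun q hq => by rw [weightProj_apply, if_neg hq]

theorem sum_weightProj (ω : Pair 7 → ℂ) : ∑ k ∈ Finset.range 7, weightProj k ω = ω := by
  funext q
  rw [Finset.sum_apply]
  simp only [weightProj_apply]
  have : weight q < 7 := Nat.mod_lt _ (by norm_num)
  rw [Finset.sum_ite_eq, if_pos (Finset.mem_range.2 this)]

theorem mem_eigenspace_tau7 {ε : ℂ} (hε : IsPrimitiveRoot ε 7) {k : ℕ} (hk : k < 7)
    {ω : Pair 7 → ℂ} :
    ω ∈ Module.End.eigenspace (tau7 ε) (ε ^ k) ↔ weightProj k ω = ω := by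
  rw [Module.End.mem_eigenspace_iff, weightProj_eq_self, funext_iff]
  refine forall_congr' fun q => ?_
  change ε ^ (q.1.1 + q.1.2 : ℕ) * ω q = ε ^ k * ω q ↔ _
  rw [mul_eq_mul_right_iff, pow_eq_pow_iff_of_isPrimitiveRoot hε, Nat.mod_eq_of_lt hk]
  unfold weight
  tauto

/-- The homogeneous components of the elements of a stable subspace lie in it. -/
theorem weightProj_mem {ε : ℂ} (hε : IsPrimitiveRoot ε 7) {S : Submodule ℂ (Pair 7 → ℂ)}
    (hS : ∀ ω ∈ S, tau7 ε ω ∈ S) {ω : Pair 7 → ℂ} (hω : ω ∈ S) {k : ℕ} (hk : k < 7) :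
    weightProj k ω ∈ S := by
  have hpow (j : ℕ) : (tau7 ε ^ j) ω ∈ S := by
    induction j with
    | zero => exact hω
    | succ j ih => rw [pow_succ']; exact hS _ ih
  have hval (j : ℕ) (q : Pair 7) : (tau7 ε ^ j) ω q = ε ^ (j * (q.1.1 + q.1.2 : ℕ)) * ω q := by
    induction j with
    | zero => simp
    | succ j ih =>
      rw [pow_succ']
      change ε ^ (q.1.1 + q.1.2 : ℕ) * (tau7 ε ^ j) ω q = _
      rw [ih]
      ring
  have key : (7 : ℂ) • weightProj k ω =
      ∑ j ∈ Finset.range 7, ε ^ (j * (7 - k)) • (tau7 ε ^ j) ω := by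
    funext q
    rw [Finset.sum_apply, Pi.smul_apply, weightProj_apply]
    have hterm (j : ℕ) : (ε ^ (j * (7 - k)) • (tau7 ε ^ j) ω) q =
        (ε ^ (7 - k + (q.1.1 + q.1.2 : ℕ))) ^ j * ω q := by
      rw [Pi.smul_apply, smul_eq_mul, hval, ← pow_mul]
      ring
    simp only [hterm]
    rw [← Finset.sum_mul, smul_eq_mul]
    have h7 : (ε ^ (7 - k + (q.1.1 + q.1.2 : ℕ))) ^ 7 = 1 := by
      rw [← pow_mul, mul_comm, pow_mul, hε.pow_eq_one, one_pow]
    have h1 : ε ^ (7 - k + (q.1.1 + q.1.2 : ℕ)) = 1 ↔ weight q = k := by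
      rw [← pow_zero ε, pow_eq_pow_iff_of_isPrimitiveRoot hε, weight]
      omega
    split_ifs with hq
    · rw [h1.2 hq]; simp
    · have := mul_neg_geom_sum (ε ^ (7 - k + (q.1.1 + q.1.2 : ℕ))) 7
      rw [h7, sub_self, mul_eq_zero, sub_eq_zero] at this
      rw [this.resolve_left fun h => hq (h1.1 h.symm), zero_mul, mul_zero]
  have h7 : (7 : ℂ) • weightProj k ω ∈ S := by
    rw [key]
    exact Submodule.sum_mem _ fun j _ => S.smul_mem _ (hpow j)
  simpa [smul_smul] using S.smul_mem (7⁻¹ : ℂ) h7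

theorem weightProj_x (k : ℕ) (i j : Fin 7) (h : i < j) :
    weightProj k (x i j h) = if weight (pair i j h) = k then x i j h else 0 := by
  funext q
  rw [weightProj_apply]
  by_cases hq : q = pair i j h
  · subst hq
    split_ifs <;> rfl
  · have : x i j h q = 0 := Pi.single_eq_of_ne hq _
    split_ifs <;> simp [this]

theorem sigma_x {n : ℕ} (e : Equiv.Perm (Fin n)) {i j i' j' : Fin n} (h : i < j) (h' : i' < j')
    (H : ∀ q, pairMap e q = pair i j h ↔ q = pair i' j' h') :
    sigma e (x i j h) = x i' j' h' := by
  funext q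
  change (Pi.single (pair i j h) 1 : Pair n → ℂ) (pairMap e q) =
    (Pi.single (pair i' j' h') 1 : Pair n → ℂ) q
  simp only [Pi.single_apply, H]

theorem sigma7_formsZ (c : Coeff → ℂ) (s : Fin 6) : sigma7 (formsZ c s) = formsZ c s.rev := by
  have h (i j i' j' : Fin 7) (h : i < j) (h' : i' < j')
      (H : ∀ q, pairMap (Equiv.neg (Fin 7)) q = pair i j h ↔ q = pair i' j' h') :
      sigma7 (x i j h) = x i' j' h' := sigma_x _ h h' H
  fin_cases s
  · change sigma7 (x 0 6 - c c26 • x 1 5 - c c35 • x 2 4) = x 0 1 - c c26 • x 2 6 - c c35 • x 3 5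
    rw [map_sub, map_sub, map_smul, map_smul, h 0 6 0 1 (by decide) (by decide) (by decide),
      h 1 5 2 6 (by decide) (by decide) (by decide), h 2 4 3 5 (by decide) (by decide) (by decide)]
  · change sigma7 (x 0 5 - c c36 • x 1 4 - c c45 • x 2 3) = x 0 2 - c c36 • x 3 6 - c c45 • x 4 5
    rw [map_sub, map_sub, map_smul, map_smul, h 0 5 0 2 (by decide) (by decide) (by decide),
      h 1 4 3 6 (by decide) (by decide) (by decide), h 2 3 4 5 (by decide) (by decide) (by decide)]
  · change sigma7 (x 0 4 - c c46 • x 1 3 - c c12 • x 5 6) = x 0 3 - c c12 • x 1 2 - c c46 • x 4 6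
    rw [map_sub, map_sub, map_smul, map_smul, h 0 4 0 3 (by decide) (by decide) (by decide),
      h 1 3 4 6 (by decide) (by decide) (by decide), h 5 6 1 2 (by decide) (by decide) (by decide),
      sub_right_comm]
  · change sigma7 (x 0 3 - c c12 • x 1 2 - c c46 • x 4 6) = x 0 4 - c c46 • x 1 3 - c c12 • x 5 6
    rw [map_sub, map_sub, map_smul, map_smul, h 0 3 0 4 (by decide) (by decide) (by decide),
      h 1 2 5 6 (by decide) (by decide) (by decide), h 4 6 1 3 (by decide) (by decide) (by decide),
      sub_right_comm]
  · change sigma7 (x 0 2 - c c36 • x 3 6 - c c45 • x 4 5) = x 0 5 - c c36 • x 1 4 - c c45 • x 2 3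
    rw [map_sub, map_sub, map_smul, map_smul, h 0 2 0 5 (by decide) (by decide) (by decide),
      h 3 6 1 4 (by decide) (by decide) (by decide), h 4 5 2 3 (by decide) (by decide) (by decide)]
  · change sigma7 (x 0 1 - c c26 • x 2 6 - c c35 • x 3 5) = x 0 6 - c c26 • x 1 5 - c c35 • x 2 4
    rw [map_sub, map_sub, map_smul, map_smul, h 0 1 0 6 (by decide) (by decide) (by decide),
      h 2 6 1 5 (by decide) (by decide) (by decide), h 3 5 2 4 (by decide) (by decide) (by decide)]

theorem weightProj_formsZ (c : Coeff → ℂ) (s : Fin 6) (k : ℕ) :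
    weightProj k (formsZ c s) = if 6 - (s : ℕ) = k then formsZ c s else 0 := by
  have h (i j : Fin 7) (hij : i < j) (hw : weight (pair i j hij) = 6 - (s : ℕ)) :
      weightProj k (x i j hij) = (if 6 - (s : ℕ) = k then (1 : ℂ) else 0) • x i j hij := by
    rw [weightProj_x, hw]
    split_ifs <;> simp
  have : weightProj k (formsZ c s) = (if 6 - (s : ℕ) = k then (1 : ℂ) else 0) • formsZ c s := by
    fin_cases s <;> dsimp only [formsZ] <;>
    · simp only [Fin.zero_eta, Fin.mk_one, Fin.reduceFinMk, Matrix.cons_val, map_sub, map_smul,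
        smul_sub]
      rw [h _ _ _ (by rfl), h _ _ _ (by rfl), h _ _ _ (by rfl), smul_comm _ (c _), smul_comm _ (c _)]
  rw [this]
  split_ifs <;> simp

theorem eq_sum_single {ι : Type} [DecidableEq ι] {ω : ι → ℂ} (s : Finset ι)
    (h : ∀ q, ω q ≠ 0 → q ∈ s) : ω = ∑ q ∈ s, ω q • Pi.single q 1 := by
  funext q
  rw [Finset.sum_apply]
  simp only [Pi.smul_apply, Pi.single_apply, smul_eq_mul, mul_ite, mul_one, mul_zero,
    Finset.sum_ite_eq]
  split_ifs with hq
  · rfl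
  · by_contra h0
    exact hq (h q h0)

theorem eq_of_support {ι : Type} [DecidableEq ι] {ω : ι → ℂ} {a b d : ι}
    (h : ∀ q, ω q ≠ 0 → q = a ∨ q = b ∨ q = d) (hab : a ≠ b) (had : a ≠ d) (hbd : b ≠ d) :
    ω = ω a • Pi.single a 1 + ω b • Pi.single b 1 + ω d • Pi.single d 1 := by
  refine (eq_sum_single {a, b, d} fun q hq => by simpa using h q hq).trans ?_
  rw [Finset.sum_insert (by simp [hab, had]), Finset.sum_pair hbd, add_assoc]

/-- The position of the leading coordinate `x_{1,k+1}`. -/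
def leading (k : ℕ) (h0 : 0 < k) (h7 : k < 7) : Pair 7 := ⟨(0, ⟨k, h7⟩), h0⟩

theorem formsZ_leading (c : Coeff → ℂ) (s : Fin 6) :
    formsZ c s (leading (6 - s) (by omega) (by omega)) = 1 := by
  fin_cases s <;> simp [formsZ, x, leading, pair]

theorem sigma7_of_weight_zero {ω : Pair 7 → ℂ} (h : weightProj 0 ω = ω) : sigma7 ω = ω := by
  funext q
  rw [weightProj_eq_self] at h
  by_cases hq : weight q = 0
  · have : ∀ q : Pair 7, weight q = 0 → pairMap (Equiv.neg (Fin 7)) q = q := by decide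
    exact congrArg ω (this q hq)
  · have : ∀ q : Pair 7, weight q ≠ 0 → weight (pairMap (Equiv.neg (Fin 7)) q) ≠ 0 := by decide
    exact (h _ (this q hq)).trans (h q hq).symm

theorem exists_coeff {ε : ℂ} (hε : IsPrimitiveRoot ε 7) {m : ℕ} {S : Submodule ℂ (Pair 7 → ℂ)}
    (hS : IsInvariantSystem ε m S) (hl : HasLeadingTerms S) :
    ∃ c, S = systemZ c ⊔ (S ⊓ Module.End.eigenspace (tau7 ε) 1) := by
  obtain ⟨hst, hk, -⟩ := hS
  have hproj {ω} (hω : ω ∈ S) {k : ℕ} (hk : k < 7) : weightProj k ω ∈ S :=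
    weightProj_mem hε (fun ω hω => (hst ω hω).1) hω hk
  have hg (k : ℕ) (h0 : 0 < k) (h7 : k < 7) :
      ∃ g ∈ S, weightProj k g = g ∧ g (leading k h0 h7) = 1 := by
    obtain ⟨ω, hω, hne⟩ := hl (leading k h0 h7) rfl
    refine ⟨(ω (leading k h0 h7))⁻¹ • weightProj k ω, S.smul_mem _ (hproj hω h7), ?_, ?_⟩
    · rw [map_smul, weightProj_idem]
    · have : weight (leading k h0 h7) = k := by simp [weight, leading, Nat.mod_eq_of_lt h7]
      rw [Pi.smul_apply, weightProj_apply, if_pos this, smul_eq_mul, inv_mul_cancel₀ hne]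
  obtain ⟨g4, hg4, hw4, hl4⟩ := hg 4 (by norm_num) (by norm_num)
  obtain ⟨g5, hg5, hw5, hl5⟩ := hg 5 (by norm_num) (by norm_num)
  obtain ⟨g6, hg6, hw6, hl6⟩ := hg 6 (by norm_num) (by norm_num)
  let c : Coeff → ℂ := fun
    | c12 => - g4 (pair 5 6)
    | c26 => - g6 (pair 1 5)
    | c35 => - g6 (pair 2 4)
    | c36 => - g5 (pair 1 4)
    | c45 => - g5 (pair 2 3)
    | c46 => - g4 (pair 1 3)
  have hsupp {k : ℕ} {g : Pair 7 → ℂ} (hw : weightProj k g = g) (q : Pair 7) (hq : g q ≠ 0) :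
      weight q = k := by
    by_contra h
    exact hq (weightProj_eq_self.1 hw q h)
  have e6 : formsZ c 0 = g6 := by
    rw [eq_of_support (a := pair 0 6) (b := pair 1 5) (d := pair 2 4)
      (fun q hq => (by decide : ∀ q : Pair 7, weight q = 6 →
        q = pair 0 6 ∨ q = pair 1 5 ∨ q = pair 2 4) q (hsupp hw6 q hq)) (by decide) (by decide)
      (by decide), show g6 (pair 0 6) = 1 from hl6, one_smul]
    change x 0 6 - (- g6 (pair 1 5)) • x 1 5 - (- g6 (pair 2 4)) • x 2 4 = _
    rw [neg_smul, neg_smul, sub_neg_eq_add, sub_neg_eq_add]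
    rfl
  have e5 : formsZ c 1 = g5 := by
    rw [eq_of_support (a := pair 0 5) (b := pair 1 4) (d := pair 2 3)
      (fun q hq => (by decide : ∀ q : Pair 7, weight q = 5 →
        q = pair 0 5 ∨ q = pair 1 4 ∨ q = pair 2 3) q (hsupp hw5 q hq)) (by decide) (by decide)
      (by decide), show g5 (pair 0 5) = 1 from hl5, one_smul]
    change x 0 5 - (- g5 (pair 1 4)) • x 1 4 - (- g5 (pair 2 3)) • x 2 3 = _
    rw [neg_smul, neg_smul, sub_neg_eq_add, sub_neg_eq_add]
    rfl
  have e4 : formsZ c 2 = g4 := by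
    rw [eq_of_support (a := pair 0 4) (b := pair 1 3) (d := pair 5 6)
      (fun q hq => (by decide : ∀ q : Pair 7, weight q = 4 →
        q = pair 0 4 ∨ q = pair 1 3 ∨ q = pair 5 6) q (hsupp hw4 q hq)) (by decide) (by decide)
      (by decide), show g4 (pair 0 4) = 1 from hl4, one_smul]
    change x 0 4 - (- g4 (pair 1 3)) • x 1 3 - (- g4 (pair 5 6)) • x 5 6 = _
    rw [neg_smul, neg_smul, sub_neg_eq_add, sub_neg_eq_add]
    rfl
  have hF (s : Fin 6) : formsZ c s ∈ S := by
    have hr (s : Fin 6) (h : formsZ c s ∈ S) : formsZ c s.rev ∈ S := by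
      rw [← sigma7_formsZ]
      exact (hst _ h).2
    have h0 : formsZ c 0 ∈ S := e6 ▸ hg6
    have h1 : formsZ c 1 ∈ S := e5 ▸ hg5
    have h2 : formsZ c 2 ∈ S := e4 ▸ hg4
    fin_cases s
    exacts [h0, h1, h2, hr 2 h2, hr 1 h1, hr 0 h0]
  refine ⟨c, le_antisymm (fun ω hω => ?_) (sup_le (Submodule.span_le.2 ?_) inf_le_left)⟩
  · rw [← sum_weightProj ω]
    refine Submodule.sum_mem _ fun k hk7 => ?_
    rw [Finset.mem_range] at hk7
    rcases Nat.eq_zero_or_pos k with rfl | h0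
    · refine Submodule.mem_sup_right ⟨hproj hω hk7, ?_⟩
      rw [← pow_zero ε]
      exact (mem_eigenspace_tau7 hε hk7).2 (weightProj_idem _ _)
    · refine Submodule.mem_sup_left ?_
      let s : Fin 6 := ⟨6 - k, by omega⟩
      have hs : 6 - (s : ℕ) = k := by simp only [s]; omega
      have hne : formsZ c s ≠ 0 := fun h => by
        have := formsZ_leading c s
        rw [h] at this
        exact zero_ne_one this
      have hmem : formsZ c s ∈ S ⊓ Module.End.eigenspace (tau7 ε) (ε ^ k) :=
        ⟨hF s, (mem_eigenspace_tau7 hε hk7).2 (by rw [weightProj_formsZ, if_pos hs])⟩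
      have hmem' : weightProj k ω ∈ S ⊓ Module.End.eigenspace (tau7 ε) (ε ^ k) :=
        ⟨hproj hω hk7, (mem_eigenspace_tau7 hε hk7).2 (weightProj_idem _ _)⟩
      obtain ⟨a, ha⟩ := exists_smul_eq_of_finrank_eq_one (hk k h0 hk7) (x := ⟨_, hmem⟩)
        (fun h => hne (congrArg Subtype.val h)) ⟨_, hmem'⟩
      rw [← show a • formsZ c s = weightProj k ω from congrArg Subtype.val ha]
      exact Submodule.smul_mem _ _ (Submodule.subset_span (Set.mem_range_self s))
  · rintro _ ⟨s, rfl⟩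
    exact hF s

theorem inf_eigenspace_eq_map {ε : ℂ} (hε : IsPrimitiveRoot ε 7) {S : Submodule ℂ (Pair 7 → ℂ)}
    (hS : ∀ ω ∈ S, tau7 ε ω ∈ S) {k : ℕ} (hk : k < 7) :
    S ⊓ Module.End.eigenspace (tau7 ε) (ε ^ k) = S.map (weightProj k) := by
  ext ω
  rw [Submodule.mem_inf, mem_eigenspace_tau7 hε hk, Submodule.mem_map]
  constructor
  · exact fun h => ⟨ω, h⟩
  · rintro ⟨η, hη, rfl⟩
    exact ⟨weightProj_mem hε hS hη hk, weightProj_idem _ _⟩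

theorem map_systemZ (c : Coeff → ℂ) (k : ℕ) : (systemZ c).map (weightProj k) =
    Submodule.span ℂ (Set.range fun s : Fin 6 => if 6 - (s : ℕ) = k then formsZ c s else 0) := by
  rw [systemZ, Submodule.map_span, ← Set.range_comp]
  congr 2
  funext s
  exact weightProj_formsZ c s k

theorem isInvariantSystem_sup {ε : ℂ} (hε : IsPrimitiveRoot ε 7) (c : Coeff → ℂ)
    {T : Submodule ℂ (Pair 7 → ℂ)} (hT : T ≤ Module.End.eigenspace (tau7 ε) 1) :
    IsInvariantSystem ε (Module.finrank ℂ T) (systemZ c ⊔ T) ∧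
      HasLeadingTerms (systemZ c ⊔ T) := by
  have hT' : ∀ ω ∈ T, weightProj 0 ω = ω := fun ω hω =>
    (mem_eigenspace_tau7 hε (by norm_num)).1 (by rw [pow_zero]; exact hT hω)
  have hF (s : Fin 6) : formsZ c s ∈ systemZ c := Submodule.subset_span (Set.mem_range_self s)
  have hτ : ∀ ω ∈ systemZ c ⊔ T, tau7 ε ω ∈ systemZ c ⊔ T := by
    have : systemZ c ⊔ T ≤ (systemZ c ⊔ T).comap (tau7 ε) := by
      refine sup_le (Submodule.span_le.2 ?_) fun ω hω => ?_
      · rintro _ ⟨s, rfl⟩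
        have : formsZ c s ∈ Module.End.eigenspace (tau7 ε) (ε ^ (6 - (s : ℕ))) :=
          (mem_eigenspace_tau7 hε (by omega)).2 (by rw [weightProj_formsZ, if_pos rfl])
        rw [Module.End.mem_eigenspace_iff] at this
        change tau7 ε (formsZ c s) ∈ systemZ c ⊔ T
        rw [this]
        exact Submodule.smul_mem _ _ (Submodule.mem_sup_left (hF s))
      · have := Module.End.mem_eigenspace_iff.1 (hT hω)
        change tau7 ε ω ∈ systemZ c ⊔ T
        rw [this, one_smul]
        exact Submodule.mem_sup_right hω
    exact this
  have hσ : ∀ ω ∈ systemZ c ⊔ T, sigma7 ω ∈ systemZ c ⊔ T := by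
    have : systemZ c ⊔ T ≤ (systemZ c ⊔ T).comap sigma7 := by
      refine sup_le (Submodule.span_le.2 ?_) fun ω hω => ?_
      · rintro _ ⟨s, rfl⟩
        change sigma7 (formsZ c s) ∈ systemZ c ⊔ T
        rw [sigma7_formsZ]
        exact Submodule.mem_sup_left (hF _)
      · change sigma7 ω ∈ systemZ c ⊔ T
        rw [sigma7_of_weight_zero (hT' ω hω)]
        exact Submodule.mem_sup_right hω
    exact this
  refine ⟨⟨fun ω hω => ⟨hτ ω hω, hσ ω hω⟩, fun k h0 h7 => ?_, ?_⟩, fun q hq => ?_⟩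
  · let s : Fin 6 := ⟨6 - k, by omega⟩
    have hs : 6 - (s : ℕ) = k := by simp only [s]; omega
    have hne : formsZ c s ≠ 0 := fun h => by
      have := formsZ_leading c s
      rw [h] at this
      exact zero_ne_one this
    rw [inf_eigenspace_eq_map hε hτ h7, Submodule.map_sup, map_systemZ,
      show T.map (weightProj k) = ⊥ from ?_, sup_bot_eq,
      show Submodule.span ℂ _ = Submodule.span ℂ {formsZ c s} from ?_, finrank_span_singleton hne]
    · apply le_antisymm <;> rw [Submodule.span_le]
      · rintro _ ⟨r, rfl⟩
        dsimp only
        split_ifs with hr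
        · have : r = s := Fin.ext (by omega)
          rw [this]
          exact Submodule.mem_span_singleton_self _
        · exact Submodule.zero_mem _
      · rintro _ rfl
        exact Submodule.subset_span ⟨s, if_pos hs⟩
    · refine (Submodule.eq_bot_iff _).2 ?_
      rintro _ ⟨ω, hω, rfl⟩
      rw [← hT' ω hω]
      funext q
      rw [weightProj_apply, weightProj_apply]
      split_ifs <;> first | rfl | omega
  · rw [← pow_zero ε, inf_eigenspace_eq_map hε hτ (by norm_num), Submodule.map_sup, map_systemZ,
      show Submodule.span ℂ _ = ⊥ from ?_, bot_sup_eq, show T.map (weightProj 0) = T from ?_]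
    · ext ω
      constructor
      · rintro ⟨η, hη, rfl⟩
        rwa [hT' η hη]
      · exact fun hω => ⟨ω, hω, hT' ω hω⟩
    · rw [Submodule.span_eq_bot]
      rintro _ ⟨s, rfl⟩
      exact if_neg (by omega)
  · obtain ⟨⟨i, j⟩, hij⟩ := q
    simp only at hq
    subst hq
    have hj : 0 < (j : ℕ) := hij
    refine ⟨_, Submodule.mem_sup_left (hF ⟨6 - j, by omega⟩), ?_⟩
    have : (⟨(0, j), hij⟩ : Pair 7) = leading (6 - (6 - j)) (by omega) (by omega) :=
      Subtype.ext (Prod.ext rfl (Fin.ext (show (j : ℕ) = 6 - (6 - j) by omega)))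
    rw [this]
    exact (formsZ_leading c ⟨6 - j, by omega⟩).trans_ne one_ne_zero

theorem isInvariantSystem_zero_iff {ε : ℂ} (hε : IsPrimitiveRoot ε 7)
    (S : Submodule ℂ (Pair 7 → ℂ)) :
    (IsInvariantSystem ε 0 S ∧ HasLeadingTerms S) ↔ ∃ c : Coeff → ℂ, S = systemZ c := by
  constructor
  · rintro ⟨hS, hl⟩
    obtain ⟨c, hc⟩ := exists_coeff hε hS hl
    rw [Submodule.finrank_eq_zero.1 hS.2.2, sup_bot_eq] at hc
    exact ⟨c, hc⟩
  · rintro ⟨c, rfl⟩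
    have := isInvariantSystem_sup hε c (T := ⊥) bot_le
    rwa [finrank_bot, sup_bot_eq] at this

/-- The two-forms of weight zero. -/
def formsHHom : (Fin 3 → ℂ) →ₗ[ℂ] (Pair 7 → ℂ) where
  toFun u := u 0 • x 1 6 + u 1 • x 2 5 + u 2 • x 3 4
  map_add' u v := by simp only [Pi.add_apply, add_smul]; abel
  map_smul' a u := by simp only [Pi.smul_apply, smul_eq_mul, mul_smul, smul_add, RingHom.id_apply]

theorem ker_formsHHom : LinearMap.ker formsHHom = ⊥ := by
  rw [LinearMap.ker_eq_bot']
  intro u hu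
  funext i
  fin_cases i
  · simpa [formsHHom, x, pair, Pi.single_apply] using congrFun hu (pair 1 6)
  · simpa [formsHHom, x, pair, Pi.single_apply] using congrFun hu (pair 2 5)
  · simpa [formsHHom, x, pair, Pi.single_apply] using congrFun hu (pair 3 4)

theorem weightProj_formsHHom (u : Fin 3 → ℂ) : weightProj 0 (formsHHom u) = formsHHom u := by
  change weightProj 0 (u 0 • x 1 6 + u 1 • x 2 5 + u 2 • x 3 4) = _
  rw [map_add, map_add, map_smul, map_smul, map_smul, weightProj_x, weightProj_x, weightProj_x,
    if_pos (by rfl), if_pos (by rfl), if_pos (by rfl)]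
  rfl

theorem isInvariantSystem_two_iff {ε : ℂ} (hε : IsPrimitiveRoot ε 7)
    (S : Submodule ℂ (Pair 7 → ℂ)) :
    (IsInvariantSystem ε 2 S ∧ HasLeadingTerms S) ↔
      ∃ (c : Coeff → ℂ) (h : Fin 2 → Fin 3 → ℂ), LinearIndependent ℂ h ∧ S = systemS c h := by
  constructor
  · rintro ⟨hS, hl⟩
    obtain ⟨c, hc⟩ := exists_coeff hε hS hl
    let b := Module.finBasisOfFinrankEq ℂ _ hS.2.2
    let h (r : Fin 2) : Fin 3 → ℂ :=
      ![(b r : Pair 7 → ℂ) (pair 1 6), (b r : Pair 7 → ℂ) (pair 2 5), (b r : Pair 7 → ℂ) (pair 3 4)]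
    have hb (r : Fin 2) : formsHHom (h r) = b r := by
      have hw : weightProj 0 (b r : Pair 7 → ℂ) = b r :=
        (mem_eigenspace_tau7 hε (by norm_num)).1 (by rw [pow_zero]; exact (b r).2.2)
      exact (eq_of_support (a := pair 1 6) (b := pair 2 5) (d := pair 3 4) (fun q hq =>
        (by decide : ∀ q : Pair 7, weight q = 0 → q = pair 1 6 ∨ q = pair 2 5 ∨ q = pair 3 4) q
          (by
            by_contra h
            exact hq (weightProj_eq_self.1 hw q h)))
        (by decide) (by decide) (by decide)).symm
    refine ⟨c, h, ?_, ?_⟩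
    · rw [← LinearMap.linearIndependent_iff _ ker_formsHHom]
      have : formsHHom ∘ h = Submodule.subtype _ ∘ b := funext hb
      rw [this, LinearMap.linearIndependent_iff _ (Submodule.ker_subtype _)]
      exact b.linearIndependent
    · rw [hc, systemS]
      congr 1
      have : formsH h = Submodule.subtype _ ∘ b := funext hb
      rw [this, Set.range_comp, ← Submodule.map_span, b.span_eq, Submodule.map_top,
        Submodule.range_subtype]
  · rintro ⟨c, h, hh, rfl⟩
    have hf : formsH h = formsHHom ∘ h := rfl
    have := isInvariantSystem_sup hε c (T := Submodule.span ℂ (Set.range (formsH h))) (by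
      rw [Submodule.span_le]
      rintro _ ⟨r, rfl⟩
      have := (mem_eigenspace_tau7 hε (k := 0) (by norm_num)).2 (weightProj_formsHHom (h r))
      rwa [pow_zero] at this)
    rwa [finrank_span_eq_card (by
      rw [hf, LinearMap.linearIndependent_iff _ ker_formsHHom]; exact hh)] at this

theorem tau6_single (ε : ℂ) (q : Pair 6) : tau6 ε (Pi.single q 1) =
    ε ^ ((q.1.1 : ℕ) + 1 + ((q.1.2 : ℕ) + 1)) • Pi.single q 1 := by
  funext r
  change ε ^ ((r.1.1 : ℕ) + 1 + ((r.1.2 : ℕ) + 1)) * (Pi.single q 1 : Pair 6 → ℂ) r = _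
  by_cases h : r = q
  · subst h; simp
  · simp [h]

theorem sigma6_single (q : Pair 6) :
    sigma6 (Pi.single q 1) = Pi.single (pairMap Fin.revPerm q) 1 := by
  have h : ∀ q : Pair 6, pairMap Fin.revPerm (pairMap Fin.revPerm q) = q := by decide +kernel
  funext r
  change (Pi.single q 1 : Pair 6 → ℂ) (pairMap Fin.revPerm r) =
    (Pi.single (pairMap Fin.revPerm q) 1 : Pair 6 → ℂ) r
  rw [Pi.single_apply, Pi.single_apply]
  congr 1
  exact propext ⟨fun e => by rw [← e, h], fun e => by rw [e, h]⟩

theorem isInvariantMap_mapY {ε : ℂ} (hε : IsPrimitiveRoot ε 7) (c : Coeff → ℂ) :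
    IsInvariantMap ε (mapY c) := by
  have h (k : ℕ) : ε ^ (k + 7) = ε ^ k := by rw [pow_add, hε.pow_eq_one, mul_one]
  have h8 : ε ^ 8 = ε := (h 1).trans (pow_one ε)
  have h9 : ε ^ 9 = ε ^ 2 := h 2
  have h10 : ε ^ 10 = ε ^ 3 := h 3
  have h11 : ε ^ 11 = ε ^ 4 := h 4
  intro p
  constructor <;> funext i <;> change mapY c _ ⬝ᵥ _ = _
  · change _ = _ * (mapY c _ ⬝ᵥ _)
    rw [mapY_dotProduct, mapY_dotProduct]
    fin_cases i <;> simp [tau6, tau, pair, h8, h9, h10, h11] <;> ring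
  · change _ = mapY c _ ⬝ᵥ _
    have hs (i j i' j' : Fin 6) (h : i < j) (h' : i' < j')
        (H : pairMap Fin.revPerm (pair i j h) = pair i' j' h') :
        sigma6 p (pair i j h) = p (pair i' j' h') := congrArg p H
    rw [mapY_dotProduct, mapY_dotProduct]
    fin_cases i
    · change c c26 * sigma6 p (pair 1 5) + c c35 * sigma6 p (pair 2 4) =
        c c26 * p (pair 0 4) + c c35 * p (pair 1 3)
      rw [hs 1 5 0 4 (by decide) (by decide) (by decide),
        hs 2 4 1 3 (by decide) (by decide) (by decide)]
    · change c c36 * sigma6 p (pair 2 5) + c c45 * sigma6 p (pair 3 4) =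
        c c36 * p (pair 0 3) + c c45 * p (pair 1 2)
      rw [hs 2 5 0 3 (by decide) (by decide) (by decide),
        hs 3 4 1 2 (by decide) (by decide) (by decide)]
    · change c c12 * sigma6 p (pair 0 1) + c c46 * sigma6 p (pair 3 5) =
        c c46 * p (pair 0 2) + c c12 * p (pair 4 5)
      rw [hs 0 1 4 5 (by decide) (by decide) (by decide),
        hs 3 5 0 2 (by decide) (by decide) (by decide), add_comm]
    · change c c46 * sigma6 p (pair 0 2) + c c12 * sigma6 p (pair 4 5) =
        c c12 * p (pair 0 1) + c c46 * p (pair 3 5)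
      rw [hs 0 2 3 5 (by decide) (by decide) (by decide),
        hs 4 5 0 1 (by decide) (by decide) (by decide), add_comm]
    · change c c36 * sigma6 p (pair 0 3) + c c45 * sigma6 p (pair 1 2) =
        c c36 * p (pair 2 5) + c c45 * p (pair 3 4)
      rw [hs 0 3 2 5 (by decide) (by decide) (by decide),
        hs 1 2 3 4 (by decide) (by decide) (by decide)]
    · change c c26 * sigma6 p (pair 0 4) + c c35 * sigma6 p (pair 1 3) =
        c c26 * p (pair 1 5) + c c35 * p (pair 2 4)
      rw [hs 0 4 1 5 (by decide) (by decide) (by decide),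
        hs 1 3 2 4 (by decide) (by decide) (by decide)]

theorem exists_mapY_of_isInvariantMap {ε : ℂ} (hε : IsPrimitiveRoot ε 7)
    {lam : Matrix (Fin 6) (Pair 6) ℂ} (h : IsInvariantMap ε lam) :
    ∃ c : Coeff → ℂ, lam = mapY c := by
  have hτ (i : Fin 6) (q : Pair 6) (hq : lam i q ≠ 0) :
      ((q.1.1 : ℕ) + 1 + ((q.1.2 : ℕ) + 1)) % 7 = ((i : ℕ) + 1) % 7 := by
    have := congrFun (h (Pi.single q 1)).1 i
    rw [tau6_single, Matrix.mulVec_smul, Pi.smul_apply, Matrix.mulVec_single_one, smul_eq_mul,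
      Matrix.col_apply, mul_left_inj' hq] at this
    exact (pow_eq_pow_iff_of_isPrimitiveRoot hε _ _).1 this
  have hσ (i : Fin 6) (q : Pair 6) : lam i (pairMap Fin.revPerm q) = lam i.rev q := by
    have := congrFun (h (Pi.single q 1)).2 i
    rwa [sigma6_single, Matrix.mulVec_single_one, Matrix.mulVec_single_one] at this
  have key (i : Fin 6) (a b : Pair 6) (hab : a ≠ b) (H : ∀ q : Pair 6,
      ((q.1.1 : ℕ) + 1 + ((q.1.2 : ℕ) + 1)) % 7 = ((i : ℕ) + 1) % 7 → q = a ∨ q = b) :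
      lam i = lam i a • Pi.single a 1 + lam i b • Pi.single b 1 := by
    refine (eq_sum_single {a, b} fun q hq => by simpa using H q (hτ i q hq)).trans ?_
    rw [Finset.sum_pair hab]
  refine ⟨fun
    | c12 => lam 2 (pair 0 1)
    | c26 => lam 0 (pair 1 5)
    | c35 => lam 0 (pair 2 4)
    | c36 => lam 1 (pair 2 5)
    | c45 => lam 1 (pair 3 4)
    | c46 => lam 2 (pair 3 5), funext fun i => ?_⟩
  fin_cases i
  · exact key 0 (pair 1 5) (pair 2 4) (by decide) (by decide)
  · exact key 1 (pair 2 5) (pair 3 4) (by decide) (by decide)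
  · exact key 2 (pair 0 1) (pair 3 5) (by decide) (by decide)
  · refine (key 3 (pair 0 2) (pair 4 5) (by decide) (by decide)).trans ?_
    rw [show lam 3 (pair 0 2) = lam 2 (pair 3 5) from hσ 3 (pair 3 5),
      show lam 3 (pair 4 5) = lam 2 (pair 0 1) from hσ 3 (pair 0 1)]
    rfl
  · refine (key 4 (pair 0 3) (pair 1 2) (by decide) (by decide)).trans ?_
    rw [show lam 4 (pair 0 3) = lam 1 (pair 2 5) from hσ 4 (pair 2 5),
      show lam 4 (pair 1 2) = lam 1 (pair 3 4) from hσ 4 (pair 3 4)]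
    rfl
  · refine (key 5 (pair 0 4) (pair 1 3) (by decide) (by decide)).trans ?_
    rw [show lam 5 (pair 0 4) = lam 0 (pair 1 5) from hσ 5 (pair 1 5),
      show lam 5 (pair 1 3) = lam 0 (pair 2 4) from hσ 5 (pair 2 4)]
    rfl

end DihedralSections

end

open DihedralSections
theorem mainTheorem8 (ε : ℂ) (hε : IsPrimitiveRoot ε 7) :
    (∀ S : Submodule ℂ (Pair 7 → ℂ),
      (IsInvariantSystem ε 0 S ∧ HasLeadingTerms S) ↔ ∃ c : Coeff → ℂ, S = systemZ c) ∧
    (∀ S : Submodule ℂ (Pair 7 → ℂ),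
      (IsInvariantSystem ε 2 S ∧ HasLeadingTerms S) ↔
        ∃ (c : Coeff → ℂ) (h : Fin 2 → Fin 3 → ℂ), LinearIndependent ℂ h ∧ S = systemS c h) ∧
    (∀ lam : Matrix (Fin 6) (Pair 6) ℂ,
      IsInvariantMap ε lam ↔ ∃ c : Coeff → ℂ, lam = mapY c) ∧
    (∃ G : MvPolynomial (Coeff ⊕ Fin 2 × Fin 3) ℂ, G ≠ 0 ∧
      ∀ (c : Coeff → ℂ) (h : Fin 2 → Fin 3 → ℂ), LinearIndependent ℂ h →
        MvPolynomial.eval (Sum.elim c fun rs => h rs.1 rs.2) G ≠ 0 →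
          IsSmoothProjective 2 (linearSectionIdeal (systemS c h))) ∧
    (∃ F : MvPolynomial Coeff ℂ, F ≠ 0 ∧
      ∀ c : Coeff → ℂ, MvPolynomial.eval c F ≠ 0 →
        IsSmoothProjective 4 (linearSectionIdeal (systemZ c)) ∧
        IsSmoothProjective 4 (quotientSectionIdeal (mapY c))) := by
  refine ⟨isInvariantSystem_zero_iff hε, isInvariantSystem_two_iff hε, fun lam =>
    ⟨exists_mapY_of_isInvariantMap hε, ?_⟩, ?_, general_fourfolds_smooth⟩
  · rintro ⟨c, rfl⟩
    exact isInvariantMap_mapY hε c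
  · obtain ⟨G, hG, h⟩ := general_surface_smooth
    exact ⟨G, hG, fun c r _ => h c r⟩
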